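/- **Theorem (global well-posedness of the mutual synchronization intertwinement).** Let $\mathbb{T}^2=\mathbb{R}^2/(2\pi\mathbb{Z})^2$, and let $H$ be the space of real-valued vector fields $u\in L^2(\mathbb{T}^2)^2$ that are mean-free and divergence-free (in the sense of distributions), with the $L^2$ norm. Let $\mathbb{P}$ be the Leray projection, i.e. the orthogonal projection of $L^2(\mathbb{T}^2)^2$ onto $H$, and let $A=-\mathbb{P}\Delta$ be the Stokes operator; in terms of the Fourier coefficients $\hat u_k$, $A^{n/2}u=\sum_{k\in\mathbb{Z}^2}|k|^n\hat u_k e^{ik\cdot x}$, with domain $D(A^{n/2})=\{u\in H:\sum_k|k|^{2n}|\hat u_k|^2<\infty\}$ normed by $|A^{n/2}u|_{L^2}$. Let $V=D(A^{1/2})$, let $B(u,v)=\mathbb{P}((u\cdot\nabla)v)$, and for a real number $N>0$ let $P_N$ be the projection onto the Fourier wavenumbers $|k|\le N$. Let $\nu>0$, $N>0$, let $\theta_1,\theta_2\in[0,1]$ with $\theta_1+\theta_2=1$, and let $g_1,g_2\in L^\infty(0,\infty;H)$. Consider the system $$\frac{dv_1}{dt}+\nu Av_1+B(v_1,v_1)=g_1+\theta_1\bigl(P_NB(v_1,v_1)-P_NB(v_2,v_2)\bigr),$$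 $$\frac{dv_2}{dt}+\nu Av_2+B(v_2,v_2)=g_2+\theta_2\bigl(P_NB(v_2,v_2)-P_NB(v_1,v_1)\bigr).$$ For $T>0$, a solution on $[0,T]$ with initial value $(v_0^1,v_0^2)$ is a pair $v_1,v_2\in C([0,T];V)\cap L^2(0,T;D(A))$ with $\frac{dv_1}{dt},\frac{dv_2}{dt}\in L^2(0,T;H)$ and $v_j(0)=v_0^j$, $j=1,2$, that satisfies both equations in $H$ for almost every $t\in(0,T)$. Then the initial value problem is globally well-posed on $V\times V$: for every $(v_0^1,v_0^2)\in V\times V$ there is a pair $(v_1,v_2)$ of functions on $[0,\infty)$ which is a solution on $[0,T]$ with this initial value for every $T>0$; and for every $T>0$, every solution on $[0,T]$ with this initial value coincides with $(v_1,v_2)$ on $[0,T]$. -/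

import Mathlib

open MeasureTheory

noncomputable section

namespace SyncNSE

/-- The flat torus `ℝ² / (2πℤ)²`. A point `y : (ℝ/ℤ)²` stands for the point `x = 2πy`, so that
`UnitAddTorus.mFourier k` is the character `x ↦ exp (i k·x)`, and functions on this space are the
functions that are `2π`-periodic in each direction. -/
abbrev Torus : Type := UnitAddTorus (Fin 2)

/-- The Lebesgue measure of the torus, normalised to total mass one
(that is, `dx / (2π)²` in the variable `x`). -/
abbrev torusMeasure : Measure Torus := Measure.pi fun _ : Fin 2 => AddCircle.haarAddCircle

/-- Values of a planar real vector field. -/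
abbrev Vec : Type := EuclideanSpace ℝ (Fin 2)

/-- Square integrable real vector fields on the torus. -/
abbrev L2Field : Type := Lp Vec 2 torusMeasure

/-- The `i`-th component of the Fourier coefficient `û_k`, `k ∈ ℤ²`,
of the field `u = ∑ û_k exp (i k·x)`. -/
def coef (u : L2Field) (k : Fin 2 → ℤ) (i : Fin 2) : ℂ :=
  UnitAddTorus.mFourierCoeff (fun x => ((u x i : ℝ) : ℂ)) k

/-- `coef` as a continuous linear functional. -/
def coefL (k : Fin 2 → ℤ) (i : Fin 2) : L2Field →L[ℝ] ℂ :=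
  ((innerSL ℂ (ContinuousMap.toLp (E := ℂ) 2 torusMeasure ℂ
      (UnitAddTorus.mFourier k))).restrictScalars ℝ).comp
    ((Complex.ofRealCLM.comp (EuclideanSpace.proj i : Vec →L[ℝ] ℝ)).compLpL 2 torusMeasure)

theorem coef_eq_coefL (u : L2Field) (k : Fin 2 → ℤ) (i : Fin 2) : coef u k i = coefL k i u := by
  simp only [coefL, ContinuousLinearMap.comp_apply, ContinuousLinearMap.coe_restrictScalars',
    innerSL_apply_apply, L2.inner_def]
  unfold coef UnitAddTorus.mFourierCoeff
  refine integral_congr_ae ?_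
  filter_upwards [ContinuousMap.coeFn_toLp (p := 2) (𝕜 := ℂ) torusMeasure (UnitAddTorus.mFourier k),
    ContinuousLinearMap.coeFn_compLpL
      (Complex.ofRealCLM.comp (EuclideanSpace.proj i : Vec →L[ℝ] ℝ)) (p := 2) u] with x h1 h2
  rw [h1, h2]
  simp [UnitAddTorus.mFourier_neg, mul_comm]

theorem coef_add (u w : L2Field) (k : Fin 2 → ℤ) (i : Fin 2) :
    coef (u + w) k i = coef u k i + coef w k i := by
  simp [coef_eq_coefL]

theorem coef_smul (c : ℝ) (u : L2Field) (k : Fin 2 → ℤ) (i : Fin 2) :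
    coef (c • u) k i = (c : ℂ) * coef u k i := by
  simp [coef_eq_coefL]

theorem coef_zero (k : Fin 2 → ℤ) (i : Fin 2) : coef 0 k i = 0 := by
  simp [coef_eq_coefL]

theorem continuous_coef (k : Fin 2 → ℤ) (i : Fin 2) : Continuous fun u => coef u k i := by
  simp only [coef_eq_coefL]
  exact (coefL k i).continuous

/-- The space `H` of square integrable real vector fields on the torus that are mean-free
and divergence-free in the sense of distributions (`k · û_k = 0` for every `k`). -/
def H : Submodule ℝ L2Field where
  carrier := {u | (∀ i, coef u 0 i = 0) ∧ ∀ k : Fin 2 → ℤ, ∑ i, (k i : ℂ) * coef u k i = 0}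
  zero_mem' := by simp [coef_zero]
  add_mem' := by
    rintro u w ⟨hu, hu'⟩ ⟨hw, hw'⟩
    refine ⟨fun i => by rw [coef_add, hu, hw, add_zero], fun k => ?_⟩
    simp only [coef_add, mul_add, Finset.sum_add_distrib, hu', hw', add_zero]
  smul_mem' := by
    rintro c u ⟨hu, hu'⟩
    refine ⟨fun i => by rw [coef_smul, hu, mul_zero], fun k => ?_⟩
    simp only [coef_smul, mul_left_comm _ (c : ℂ), ← Finset.mul_sum, hu', mul_zero]

theorem isClosed_H : IsClosed (H : Set L2Field) := by
  refine IsClosed.inter (s₁ := {u | ∀ i, coef u 0 i = 0})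
    (s₂ := {u | ∀ k : Fin 2 → ℤ, ∑ i, (k i : ℂ) * coef u k i = 0}) ?_ ?_
  · simp only [Set.ofPred_forall]
    exact isClosed_iInter fun i => isClosed_eq (continuous_coef 0 i) continuous_const
  · simp only [Set.ofPred_forall]
    exact isClosed_iInter fun k => isClosed_eq
      (continuous_finsetSum _ fun i _ => continuous_const.mul (continuous_coef k i))
      continuous_const

instance : CompleteSpace H := isClosed_H.completeSpace_coe

/-- The Leray projection: the orthogonal projection of `L²` onto `H`. -/
def leray : L2Field →L[ℝ] H := H.orthogonalProjectionOnto

/-- The length `|k|` of a wavenumber `k ∈ ℤ²`. -/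
def waveNorm (k : Fin 2 → ℤ) : ℝ := Real.sqrt (∑ i, (k i : ℝ) ^ 2)

/-- `w = A^{n/2} u`, where `A = -ℙΔ` is the Stokes operator: `ŵ_k = |k|ⁿ û_k` for every `k`. -/
def IsStokesPow (n : ℕ) (u w : H) : Prop :=
  ∀ k i, coef w k i = ((waveNorm k : ℂ) ^ n) * coef u k i

/-- The domain `D(A^{n/2})`: all `u ∈ H` for which `∑ |k|ⁿ û_k exp (i k·x)` is in `H`. -/
def stokesDom (n : ℕ) : Set H := {u | ∃ w, IsStokesPow n u w}

open Classical in
/-- The operator `A^{n/2}` (its value outside the domain is irrelevant). -/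
def stokesPow (n : ℕ) (u : H) : H :=
  if h : ∃ w, IsStokesPow n u w then h.choose else 0

/-- The space `V = D(A^{1/2})`, normed by `‖u‖ = |A^{1/2} u| = |∇u|`. -/
abbrev V : Set H := stokesDom 1

/-- The domain `D(A)`, normed by `|A u|`. -/
abbrev DA : Set H := stokesDom 2

/-- The Stokes operator `A`. -/
abbrev stokes (u : H) : H := stokesPow 2 u

open Classical in
/-- The distributional derivative `∂u/∂x_j`, when it is square integrable (as for every `u ∈ V`):
its Fourier coefficients are `i k_j û_k`. -/
def partialDeriv (j : Fin 2) (u : L2Field) : L2Field :=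
  if h : ∃ w : L2Field, ∀ k i, coef w k i = Complex.I * (k j : ℂ) * coef u k i
  then h.choose else 0

/-- The pointwise field `(u · ∇) w = ∑_j u_j ∂w/∂x_j`. -/
def convection (u w : L2Field) (x : Torus) : Vec := ∑ j, u x j • partialDeriv j w x

open Classical in
/-- `B(u, w) = ℙ ((u · ∇) w)`. The field `(u · ∇) w` is square integrable
for `u ∈ D(A)` and `w ∈ V`. -/
def bilin (u w : H) : H :=
  if h : MemLp (convection u w) 2 torusMeasure then leray h.toLp else 0

/-- The fields in `H` whose Fourier coefficients vanish at every wavenumber with `|k| > N`. -/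
def lowModes (N : ℝ) : Submodule ℝ H where
  carrier := {u | ∀ k, N < waveNorm k → ∀ i, coef u k i = 0}
  zero_mem' := by
    intro k _ i
    exact coef_zero k i
  add_mem' := by
    intro u w hu hw k hk i
    rw [Submodule.coe_add, coef_add, hu k hk, hw k hk, add_zero]
  smul_mem' := by
    intro c u hu k hk i
    rw [Submodule.coe_smul, coef_smul, hu k hk, mul_zero]

theorem isClosed_lowModes (N : ℝ) : IsClosed (lowModes N : Set H) := by
  change IsClosed {u : H | ∀ k, N < waveNorm k → ∀ i, coef u k i = 0}
  simp only [Set.ofPred_forall]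
  exact isClosed_iInter fun k => isClosed_iInter fun _ => isClosed_iInter fun i =>
    isClosed_eq ((continuous_coef k i).comp continuous_subtype_val) continuous_const

instance (N : ℝ) : CompleteSpace (lowModes N) := (isClosed_lowModes N).completeSpace_coe

/-- `P_N`: the orthogonal projection of `H` onto the Fourier wavenumbers `|k| ≤ N`. -/
def PN (N : ℝ) : H →L[ℝ] H := (lowModes N).starProjection

/-- `v ∈ C([0,T]; V)`. -/
def ContInV (T : ℝ) (v : ℝ → H) : Prop :=
  (∀ t ∈ Set.Icc 0 T, v t ∈ V) ∧ ContinuousOn (fun t => stokesPow 1 (v t)) (Set.Icc 0 T)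

/-- `v ∈ L²(0,T; D(A))`. -/
def SqIntDA (T : ℝ) (v : ℝ → H) : Prop :=
  (∀ᵐ t ∂(volume.restrict (Set.Ioc 0 T)), v t ∈ DA) ∧
    MemLp (fun t => stokes (v t)) 2 (volume.restrict (Set.Ioc 0 T))

/-- `v : [0,T] → H` is absolutely continuous and `dv/dt = d` with `d ∈ L²(0,T; H)`. -/
def HasTimeDeriv (T : ℝ) (v d : ℝ → H) : Prop :=
  MemLp d 2 (volume.restrict (Set.Ioc 0 T)) ∧
    ∀ t ∈ Set.Icc 0 T, v t = v 0 + ∫ s in (0 : ℝ)..t, d s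

/-- The pair `v = (v₁, v₂)` solves, on `[0,T]` and with initial value `v₀`,
the intertwined Navier-Stokes system
`dv_i/dt + ν A v_i + B(v_i, v_i) = g_i + ∑_j m_{ij} F_j(v_j)`, `i = 1, 2`,
in the class `C([0,T]; V) ∩ L²(0,T; D(A))`. The equations hold in `H` for almost every time. -/
structure IsSolutionOn (ν : ℝ) (g : Fin 2 → ℝ → H) (M : Matrix (Fin 2) (Fin 2) ℝ)
    (F : Fin 2 → H → H) (v₀ : Fin 2 → H) (T : ℝ) (v : Fin 2 → ℝ → H) : Prop where
  continuous_V : ∀ i, ContInV T (v i)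
  sq_int_DA : ∀ i, SqIntDA T (v i)
  initial : ∀ i, v i 0 = v₀ i
  equation : ∀ i, ∃ d, HasTimeDeriv T (v i) d ∧
    ∀ᵐ t ∂(volume.restrict (Set.Ioc 0 T)),
      d t + ν • stokes (v i t) + bilin (v i t) (v i t) = g i t + ∑ j, M i j • F j (v j t)

/-- Global well-posedness over `V × V`: for every initial value in `V × V` there is a pair that is
a solution on `[0,T]` for every `T > 0`, and every solution on any `[0,T]` with the same
initial value coincides with it there. -/
def GloballyWellPosed (ν : ℝ) (g : Fin 2 → ℝ → H) (M : Matrix (Fin 2) (Fin 2) ℝ)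
    (F : Fin 2 → H → H) : Prop :=
  ∀ v₀ : Fin 2 → H, (∀ i, v₀ i ∈ V) →
    ∃ v : Fin 2 → ℝ → H, (∀ T > 0, IsSolutionOn ν g M F v₀ T v) ∧
      ∀ T > 0, ∀ w, IsSolutionOn ν g M F v₀ T w → ∀ i, Set.EqOn (w i) (v i) (Set.Icc 0 T)

/-- Intertwining matrix of the mutual synchronization intertwinement. -/
def mutualMatrix (θ₁ θ₂ : ℝ) : Matrix (Fin 2) (Fin 2) ℝ := !![θ₁, -θ₁; -θ₂, θ₂]

/-- Intertwining function of the synchronization intertwinement: `F₁(u) = F₂(u) = P_N B(u, u)`. -/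
def syncFunction (N : ℝ) : Fin 2 → H → H := fun _ u => PN N (bilin u u)

end SyncNSE

end

/-! ### Absolutely continuous functions, energy equality, Gronwall. -/

namespace SyncNSE

open Set Filter Topology intervalIntegral

section Calculus

/-! The problem is locally well posed in `V` as for the planar Navier-Stokes equations, so
everything rests on an a priori bound in `V`. The difficulty is that the coupling destroys the usual
energy balance: testing an equation with its own solution kills `B(v_j, v_j)`, but not its low-mode
projection. The bound is recovered in four stages, gathered in `exists_apriori_bound`.

Subtract the equations and apply `P_N`. Because θ₁ + θ₂ = 1, the nonlinear terms cancel exactly, so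
`P_N (v₁ - v₂)` solves a forced Stokes equation and is bounded on finite intervals
(`energy_low_diff`). Next test the equations with θ₂ v₁ and θ₁ v₂. Both coupling coefficients become
θ₁θ₂, and what remains is the pairing of `P_N (v₁ - v₂)` with `B(v₁,v₁) - B(v₂,v₂)`. The trilinear
form is antisymmetric, so the derivative can be moved onto the low-mode factor, at a cost depending
only on `N`. The pairing is then quadratic in the `L²` norms, and Gronwall bounds the weighted
energy (`energy_weighted`).

If a weight vanishes, this controls only one component. But the weighted mean and the difference
together determine the low modes of both components, so both are bounded. The unweighted energy
therefore satisfies a linear Gronwall inequality too, and integrating it once more bounds the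
dissipation (`energy_total`, `IsSol.energy_bound`). Finally, testing with `A v_j` and using the
planar estimate |B(u,u)| ≤ C |u|^{1/2} |Au|^{1/2} |A^{1/2}u| gives a Gronwall inequality for the
enstrophy with an integrable coefficient (`enstrophy_component`).

Local existence is a contraction argument for the right-hand side `f` in `L²(s,T;H)` of the linear
equation (`exists_local`). The length of the interval depends only on bounds for the data, so
finitely many steps reach any `T`. Uniqueness is Gronwall for the difference in `V`
(`diff_estimate`).

The evolution argument takes place in an abstract Hilbert space with an eigenbasis. A trajectory is
carried by `x = A^{1/2} u` and `a = A u`, so that only the bounded operator `A^{-1/2}` and the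
bounded bilinear map `B(A⁻¹ a, A⁻¹ b)` occur. On the torus the basis consists of the real fields
(cos + sin)(k·x) k^⊥/|k|. In it `A` is diagonal, derivatives exchange k and -k, Agmon's inequality
is a lattice sum (`sum_abs_inner_le`), and antisymmetry is a computation with three modes
(`perp_dot_mul_integral_add`). -/

theorem absolutelyContinuousOnInterval_of_dist_le {X Y : Type*} [PseudoMetricSpace X]
    [PseudoMetricSpace Y] {F : ℝ → X} {G : ℝ → Y} {a b : ℝ}
    (hG : AbsolutelyContinuousOnInterval G a b)
    (h : ∀ r ∈ uIcc a b, ∀ t ∈ uIcc a b, dist (F r) (F t) ≤ dist (G r) (G t)) :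
    AbsolutelyContinuousOnInterval F a b := by
  rw [absolutelyContinuousOnInterval_iff] at hG ⊢
  intro ε hε
  obtain ⟨δ, hδ, H⟩ := hG ε hε
  refine ⟨δ, hδ, fun E hE hlt => lt_of_le_of_lt (Finset.sum_le_sum fun i hi => ?_) (H E hE hlt)⟩
  exact h _ (hE.1 i hi).1 _ (hE.1 i hi).2

theorem integral_eq_sub_of_ae_hasDerivAt {F ψ : ℝ → ℝ} {a b : ℝ}
    (hF : AbsolutelyContinuousOnInterval F a b)
    (h : ∀ᵐ t, t ∈ uIcc a b → HasDerivAt F (ψ t) t) :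
    ∫ t in a..b, ψ t = F b - F a := by
  rw [← hF.integral_deriv_eq_sub]
  refine integral_congr_ae ?_
  filter_upwards [h] with t ht hmem
  exact (ht (uIoc_subset_uIcc hmem)).deriv.symm

theorem continuousOn_of_eq_integral {E : Type*} [NormedAddCommGroup E] [NormedSpace ℝ E]
    {u d : ℝ → E} {a b : ℝ}
    (hd : IntervalIntegrable d volume a b)
    (hu : ∀ t ∈ Icc a b, u t = u a + ∫ r in a..t, d r) : ContinuousOn u (Icc a b) := by
  rcases lt_or_ge b a with h | hab
  · simp [Icc_eq_empty_of_lt h]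
  have := continuousOn_primitive_interval' hd left_mem_uIcc
  rw [uIcc_of_le hab] at this
  exact (continuousOn_const.add this).congr hu

/-- The energy equality for a primitive of an integrable function. -/
theorem norm_sq_eq_add_integral {E : Type*} [NormedAddCommGroup E] [InnerProductSpace ℝ E]
    [CompleteSpace E] {u d : ℝ → E} {a b : ℝ} (hab : a ≤ b)
    (hd : IntervalIntegrable d volume a b)
    (hu : ∀ t ∈ Icc a b, u t = u a + ∫ r in a..t, d r) :
    ‖u b‖ ^ 2 = ‖u a‖ ^ 2 + 2 * ∫ r in a..b, inner ℝ (u r) (d r) := by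
  have hc := continuousOn_of_eq_integral hd hu
  obtain ⟨K, hK⟩ := isCompact_Icc.exists_bound_of_continuousOn hc
  have hK0 : 0 ≤ K := (norm_nonneg _).trans (hK a (left_mem_Icc.2 hab))
  -- The square is 2K-Lipschitz on [0, K], so the increments of this function dominate those of
  -- ‖u‖².
  have hG : AbsolutelyContinuousOnInterval (fun t => (2 * K) * ∫ r in a..t, ‖d r‖) a b :=
    (hd.norm.absolutelyContinuousOnInterval_intervalIntegral left_mem_uIcc).const_mul _
  have hsub : ∀ r ∈ Icc a b, ∀ t ∈ Icc a b, IntervalIntegrable d volume r t := by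
    intro r hr t ht
    exact hd.mono_set (by rw [uIcc_of_le hab]; exact uIcc_subset_Icc hr ht)
  have hF : AbsolutelyContinuousOnInterval (fun t => ‖u t‖ ^ 2) a b := by
    refine absolutelyContinuousOnInterval_of_dist_le hG ?_
    rw [uIcc_of_le hab]
    intro r hr t ht
    have ha := left_mem_Icc.2 hab
    have h1 : u r - u t = ∫ q in t..r, d q := by
      rw [hu r hr, hu t ht, add_sub_add_left_eq_sub,
        integral_interval_sub_left (hsub a ha r hr) (hsub a ha t ht)]
    have h2 : (∫ q in a..r, ‖d q‖) - ∫ q in a..t, ‖d q‖ = ∫ q in t..r, ‖d q‖ :=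
      integral_interval_sub_left (hsub a ha r hr).norm (hsub a ha t ht).norm
    rw [Real.dist_eq, Real.dist_eq, ← mul_sub, h2, abs_mul, sq_sub_sq, abs_mul,
      abs_of_nonneg (by positivity : 0 ≤ 2 * K)]
    have h3 : |‖u r‖ - ‖u t‖| ≤ |∫ q in t..r, ‖d q‖| :=
      (abs_norm_sub_norm_le _ _).trans (h1 ▸ norm_integral_le_abs_integral_norm)
    refine mul_le_mul ?_ h3 (abs_nonneg _) (by positivity)
    rw [abs_of_nonneg (by positivity)]
    linarith [hK r hr, hK t ht]
  have hder : ∀ᵐ t, t ∈ uIcc a b → HasDerivAt (fun t => ‖u t‖ ^ 2) (2 * inner ℝ (u t) (d t)) t := by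
    have h₁ : ∀ᵐ t : ℝ, t ≠ a := by simp [ae_iff, measure_singleton]
    have h₂ : ∀ᵐ t : ℝ, t ≠ b := by simp [ae_iff, measure_singleton]
    filter_upwards [hd.ae_hasDerivAt_integral, h₁, h₂] with t ht hta htb hmem
    have h3 := (ht hmem a left_mem_uIcc).const_add (u a)
    rw [uIcc_of_le hab] at hmem
    have h4 : HasDerivAt u (d t) t := h3.congr_of_eventuallyEq <| by
      filter_upwards [Icc_mem_nhds (lt_of_le_of_ne hmem.1 hta.symm) (lt_of_le_of_ne hmem.2 htb)]
        with r hr using hu r hr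
    exact h4.norm_sq
  have := integral_eq_sub_of_ae_hasDerivAt hF hder
  rw [intervalIntegral.integral_const_mul] at this
  linarith

/-- Gronwall's inequality with an integrable coefficient. -/
theorem le_mul_exp_integral_of_le_add_integral {y m : ℝ → ℝ} {a b c : ℝ} (hab : a ≤ b)
    (hy : ContinuousOn y (Icc a b)) (hm : IntervalIntegrable m volume a b) (hm0 : ∀ t, 0 ≤ m t)
    (h : ∀ t ∈ Icc a b, y t ≤ c + ∫ r in a..t, m r * y r) :
    y b ≤ c * Real.exp (∫ r in a..b, m r) := by
  have hy' : ContinuousOn y (uIcc a b) := by rwa [uIcc_of_le hab]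
  have hmy : IntervalIntegrable (fun r => m r * y r) volume a b := hm.mul_continuousOn hy'
  set M : ℝ → ℝ := fun t => ∫ r in a..t, m r with hM
  set R : ℝ → ℝ := fun t => c + ∫ r in a..t, m r * y r with hR
  have hMac : AbsolutelyContinuousOnInterval M a b :=
    hm.absolutelyContinuousOnInterval_intervalIntegral left_mem_uIcc
  have hRac : AbsolutelyContinuousOnInterval R a b := by
    refine absolutelyContinuousOnInterval_of_dist_le
      (hmy.absolutelyContinuousOnInterval_intervalIntegral left_mem_uIcc) ?_
    intro r _ t _
    simp [hR]
  have hM0 : ∀ t ∈ Icc a b, 0 ≤ M t := fun t ht =>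
    integral_nonneg ht.1 fun r _ => hm0 r
  have hEac : AbsolutelyContinuousOnInterval (fun t => Real.exp (-M t)) a b := by
    refine absolutelyContinuousOnInterval_of_dist_le hMac ?_
    rw [uIcc_of_le hab]
    -- The map p ↦ exp (-p) is 1-Lipschitz on [0, ∞), where `M` takes its values; absolute
    -- continuity therefore passes from `M` to exp (-M).
    have key : ∀ p q : ℝ, 0 ≤ p → p ≤ q → |Real.exp (-p) - Real.exp (-q)| ≤ |p - q| := by
      intro p q hp hpq
      have h1 : Real.exp (-q) ≤ Real.exp (-p) := Real.exp_le_exp.2 (by linarith)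
      have h2 : Real.exp (-p) ≤ 1 := Real.exp_le_one_iff.2 (by linarith)
      have h3 : Real.exp (-q) = Real.exp (-p) * Real.exp (-(q - p)) := by
        rw [← Real.exp_add]; ring_nf
      have h4 := Real.add_one_le_exp (-(q - p))
      rw [abs_of_nonneg (by linarith), abs_of_nonpos (by linarith)]
      nlinarith [Real.exp_pos (-p)]
    intro r hr t ht
    rw [Real.dist_eq, Real.dist_eq]
    rcases le_total (M r) (M t) with hle | hle
    · exact key _ _ (hM0 r hr) hle
    · rw [abs_sub_comm, abs_sub_comm (M r)]
      exact key _ _ (hM0 t ht) hle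
  -- Integrating factor: the derivative of R exp (-M) equals -m exp (-M) (R - y), which is
  -- nonpositive by hypothesis.
  have hder : ∀ᵐ t, t ∈ uIcc a b → HasDerivAt (fun t => R t * Real.exp (-M t))
      (m t * y t * Real.exp (-M t) + R t * (Real.exp (-M t) * (-m t))) t := by
    filter_upwards [hm.ae_hasDerivAt_integral, hmy.ae_hasDerivAt_integral] with t h1 h2 ht
    have h3 := (h2 ht a left_mem_uIcc).const_add c
    have h4 := (h1 ht a left_mem_uIcc).neg.exp
    exact h3.mul h4
  have hInt := integral_eq_sub_of_ae_hasDerivAt (hRac.fun_mul hEac) hder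
  have hle : ∫ t in a..b, (m t * y t * Real.exp (-M t) + R t * (Real.exp (-M t) * (-m t))) ≤ 0 := by
    rw [integral_of_le hab]
    refine setIntegral_nonpos measurableSet_Ioc fun t ht => ?_
    have h1 := h t (Ioc_subset_Icc_self ht)
    have h2 : m t * y t * Real.exp (-M t) + R t * (Real.exp (-M t) * (-m t))
        = - (m t * Real.exp (-M t) * (R t - y t)) := by ring
    rw [h2, neg_nonpos]
    exact mul_nonneg (mul_nonneg (hm0 t) (Real.exp_pos _).le) (sub_nonneg.2 h1)
  have hRa : R a * Real.exp (-M a) = c := by simp [hR, hM]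
  rw [hInt, hRa] at hle
  have h5 : R b ≤ c * Real.exp (M b) := by
    have := mul_le_mul_of_nonneg_right (sub_nonpos.1 hle) (Real.exp_pos (M b)).le
    rwa [mul_assoc, ← Real.exp_add, neg_add_cancel, Real.exp_zero, mul_one] at this
  exact (h b (right_mem_Icc.2 hab)).trans h5

/-- The form in which Gronwall is applied below: energy balances hold in integrated form, while the
bound on the integrand holds only almost everywhere. The source `n` is nonnegative, so its full
integral can be absorbed into the initial constant. -/
theorem le_mul_exp_of_ae_le {y ψ m n : ℝ → ℝ} {a b c : ℝ}
    (hy : ContinuousOn y (Icc a b)) (hψ : IntervalIntegrable ψ volume a b)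
    (hm : IntervalIntegrable m volume a b) (hm0 : ∀ t, 0 ≤ m t)
    (hn : IntervalIntegrable n volume a b) (hn0 : ∀ t, 0 ≤ n t) (hc : 0 ≤ c)
    (h : ∀ t ∈ Icc a b, y t ≤ c + ∫ r in a..t, ψ r)
    (hle : ∀ᵐ r ∂volume.restrict (Ioc a b), ψ r ≤ m r * y r + n r) {t : ℝ} (ht : t ∈ Icc a b) :
    y t ≤ (c + ∫ r in a..b, n r) * Real.exp (∫ r in a..b, m r) := by
  have hab : a ≤ b := ht.1.trans ht.2
  have hy' : ContinuousOn y (uIcc a b) := by rwa [uIcc_of_le hab]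
  have hmy : IntervalIntegrable (fun r => m r * y r) volume a b := hm.mul_continuousOn hy'
  have hsub : ∀ r ∈ Icc a b, uIcc a r ⊆ uIcc a b := fun r hr => by
    rw [uIcc_of_le hab]; exact uIcc_subset_Icc (left_mem_Icc.2 hab) hr
  have hmono : ∀ {f : ℝ → ℝ}, IntervalIntegrable f volume a b → (∀ r, 0 ≤ f r) →
      ∀ r ∈ Icc a b, ∫ q in a..r, f q ≤ ∫ q in a..b, f q := by
    intro f hf hf0 r hr
    exact integral_mono_interval le_rfl hr.1 hr.2 (Eventually.of_forall hf0) hf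
  have key : y t ≤ (c + ∫ r in a..b, n r) * Real.exp (∫ r in a..t, m r) := by
    refine le_mul_exp_integral_of_le_add_integral ht.1
      (hy.mono (Icc_subset_Icc_right ht.2)) (hm.mono_set (hsub t ht)) hm0 ?_
    intro r hr
    have hr' : r ∈ Icc a b := ⟨hr.1, hr.2.trans ht.2⟩
    refine (h r hr').trans ?_
    have h1 : ∫ q in a..r, ψ q ≤ ∫ q in a..r, (m q * y q + n q) := by
      refine integral_mono_ae_restrict hr.1 (hψ.mono_set (hsub r hr'))
        ((hmy.add hn).mono_set (hsub r hr')) ?_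
      rw [← restrict_Ioc_eq_restrict_Icc]
      exact ae_restrict_of_ae_restrict_of_subset (Ioc_subset_Ioc_right hr'.2) hle
    rw [integral_add (hmy.mono_set (hsub r hr')) (hn.mono_set (hsub r hr'))] at h1
    linarith [hmono hn hn0 r hr']
  refine key.trans (mul_le_mul_of_nonneg_left (Real.exp_le_exp.2 (hmono hm hm0 t ht)) ?_)
  exact add_nonneg hc (integral_nonneg hab fun r _ => hn0 r)

end Calculus

end SyncNSE

/-! ### Trajectories in an eigenbasis and the linear equation. -/

namespace SyncNSE

open Set Filter Topology intervalIntegral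

/-- A positive operator `A` with a Hilbert basis of eigenvectors, given through the bounded
operator `root = A^{-1/2}`; the eigenvalues of `A^{1/2}` are the numbers `freq i ≥ 1`. -/
structure SpectralData (ι H : Type*) [NormedAddCommGroup H] [InnerProductSpace ℝ H] where
  basis : HilbertBasis ι ℝ H
  freq : ι → ℝ
  one_le_freq : ∀ i, 1 ≤ freq i
  root : H →L[ℝ] H
  inner_root : ∀ i x, inner ℝ (basis i) (root x) = (freq i)⁻¹ * inner ℝ (basis i) x

section Abstract

variable {ι H : Type*} [NormedAddCommGroup H] [InnerProductSpace ℝ H]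

theorem HilbertBasis.ext_inner (b : HilbertBasis ι ℝ H) {x y : H}
    (h : ∀ i, inner ℝ (b i) x = inner ℝ (b i) y) : x = y := by
  apply b.repr.injective
  ext i
  rw [b.repr_apply_apply, b.repr_apply_apply, h i]

theorem HilbertBasis.hasSum_inner_sq (b : HilbertBasis ι ℝ H) (x : H) :
    HasSum (fun i => inner ℝ (b i) x ^ 2) (‖x‖ ^ 2) := by
  have := b.hasSum_inner_mul_inner x x
  rw [real_inner_self_eq_norm_sq] at this
  refine this.congr_fun fun i => ?_
  rw [real_inner_comm (b i) x, sq]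

theorem HilbertBasis.sum_inner_sq_le (b : HilbertBasis ι ℝ H) (x : H) (F : Finset ι) :
    ∑ i ∈ F, inner ℝ (b i) x ^ 2 ≤ ‖x‖ ^ 2 :=
  sum_le_hasSum F (fun _ _ => sq_nonneg _) (HilbertBasis.hasSum_inner_sq b x)

/-- Riesz-Fischer for a real Hilbert basis. -/
theorem HilbertBasis.exists_inner_eq (b : HilbertBasis ι ℝ H) {c : ι → ℝ}
    (hc : Summable fun i => c i ^ 2) :
    ∃ x : H, (∀ i, inner ℝ (b i) x = c i) ∧ HasSum (fun i => c i • b i) x := by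
  have hmem : Memℓp c 2 := by
    rw [memℓp_gen_iff (by norm_num)]
    simpa using hc
  refine ⟨b.repr.symm ⟨c, hmem⟩, fun i => ?_, ?_⟩
  · rw [← b.repr_apply_apply]; simp
  · exact b.hasSum_repr_symm ⟨c, hmem⟩

namespace SpectralData

variable (S : SpectralData ι H)

theorem freq_pos (i : ι) : 0 < S.freq i := zero_lt_one.trans_le (S.one_le_freq i)

theorem inner_root_comm (x y : H) : inner ℝ (S.root x) y = inner ℝ x (S.root y) := by
  refine (S.basis.hasSum_inner_mul_inner (S.root x) y).unique ?_
  refine (S.basis.hasSum_inner_mul_inner x (S.root y)).congr_fun fun i => ?_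
  rw [S.inner_root, real_inner_comm (S.basis i) (S.root x), S.inner_root,
    real_inner_comm (S.basis i) x]
  ring

theorem norm_root_le (x : H) : ‖S.root x‖ ≤ ‖x‖ := by
  refine (sq_le_sq₀ (norm_nonneg _) (norm_nonneg _)).1 ?_
  refine hasSum_le (fun i => ?_) (HilbertBasis.hasSum_inner_sq S.basis (S.root x))
    (HilbertBasis.hasSum_inner_sq S.basis x)
  rw [S.inner_root, mul_pow]
  have h : (S.freq i)⁻¹ ^ 2 ≤ 1 :=
    pow_le_one₀ (inv_nonneg.2 (S.freq_pos i).le) (inv_le_one_of_one_le₀ (S.one_le_freq i))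
  exact mul_le_of_le_one_left (sq_nonneg _) h

end SpectralData

theorem _root_.MeasureTheory.MemLp.intervalIntegrable_of_two {E : Type*} [NormedAddCommGroup E]
    {f : ℝ → E} {s T : ℝ} (hf : MemLp f 2 (volume.restrict (Ioc s T))) {r t : ℝ}
    (hr : r ∈ Icc s T) (ht : t ∈ Icc s T) : IntervalIntegrable f volume r t := by
  have h1 : IntegrableOn f (Ioc s T) volume := hf.integrable (by norm_num)
  have h2 : IntervalIntegrable f volume s T :=
    (intervalIntegrable_iff_integrableOn_Ioc_of_le (hr.1.trans hr.2)).2 h1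
  exact h2.mono_set (by rw [uIcc_of_le (hr.1.trans hr.2)]; exact uIcc_subset_Icc hr ht)

theorem _root_.MeasureTheory.MemLp.integrable_inner_of_two {α E : Type*} [MeasurableSpace α]
    {μ : Measure α} [NormedAddCommGroup E] [InnerProductSpace ℝ E] {f g : α → E}
    (hf : MemLp f 2 μ) (hg : MemLp g 2 μ) : Integrable (fun t => inner ℝ (f t) (g t)) μ := by
  refine Integrable.mono' ((hf.integrable_norm_pow (p := 2) (by norm_num)).add
    (hg.integrable_norm_pow (p := 2) (by norm_num))) (hf.1.inner hg.1)
    (Eventually.of_forall fun t => ?_)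
  refine (norm_inner_le_norm _ _).trans ?_
  simp only [Pi.add_apply]
  nlinarith [sq_nonneg (‖f t‖ - ‖g t‖), norm_nonneg (f t), norm_nonneg (g t)]

theorem _root_.MeasureTheory.Integrable.intervalIntegrable_sub {E : Type*} [NormedAddCommGroup E]
    {f : ℝ → E} {s T : ℝ} (hf : Integrable f (volume.restrict (Ioc s T))) {r t : ℝ}
    (hr : r ∈ Icc s T) (ht : t ∈ Icc s T) : IntervalIntegrable f volume r t := by
  have h2 : IntervalIntegrable f volume s T :=
    (intervalIntegrable_iff_integrableOn_Ioc_of_le (hr.1.trans hr.2)).2 hf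
  exact h2.mono_set (by rw [uIcc_of_le (hr.1.trans hr.2)]; exact uIcc_subset_Icc hr ht)

/-- `u = A^{-1/2} x` is a trajectory in `C([s,T]; V) ∩ L²(s,T; D(A))` with `x = A^{1/2} u`,
`a = A u` and time derivative `d ∈ L²(s,T; H)`. -/
structure SpectralData.Traj (S : SpectralData ι H) (s T : ℝ) (x a d : ℝ → H) : Prop where
  cont : ContinuousOn x (Icc s T)
  memLp_stokes : MemLp a 2 (volume.restrict (Ioc s T))
  memLp_deriv : MemLp d 2 (volume.restrict (Ioc s T))
  ae_eq : ∀ᵐ t ∂volume.restrict (Ioc s T), x t = S.root (a t)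
  eq_integral : ∀ t ∈ Icc s T, S.root (x t) = S.root (x s) + ∫ r in s..t, d r

namespace SpectralData.Traj

variable {S : SpectralData ι H} {s T : ℝ} {x a d x' a' d' : ℝ → H}

theorem sub [CompleteSpace H] (h : S.Traj s T x a d) (h' : S.Traj s T x' a' d') :
    S.Traj s T (fun t => x t - x' t) (fun t => a t - a' t) (fun t => d t - d' t) where
  cont := h.cont.sub h'.cont
  memLp_stokes := h.memLp_stokes.sub h'.memLp_stokes
  memLp_deriv := h.memLp_deriv.sub h'.memLp_deriv
  ae_eq := by
    filter_upwards [h.ae_eq, h'.ae_eq] with t h1 h2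
    rw [h1, h2, map_sub]
  eq_integral := by
    intro t ht
    have hs : s ∈ Icc s T := left_mem_Icc.2 (ht.1.trans ht.2)
    rw [integral_sub (h.memLp_deriv.intervalIntegrable_of_two hs ht)
      (h'.memLp_deriv.intervalIntegrable_of_two hs ht), map_sub, map_sub, h.eq_integral t ht,
      h'.eq_integral t ht]
    abel

theorem mono (h : S.Traj s T x a d) {T' : ℝ} (hT : T' ≤ T) : S.Traj s T' x a d where
  cont := h.cont.mono (Icc_subset_Icc_right hT)
  memLp_stokes := h.memLp_stokes.mono_measure (Measure.restrict_mono (Ioc_subset_Ioc_right hT) le_rfl)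
  memLp_deriv := h.memLp_deriv.mono_measure (Measure.restrict_mono (Ioc_subset_Ioc_right hT) le_rfl)
  ae_eq := ae_restrict_of_ae_restrict_of_subset (Ioc_subset_Ioc_right hT) h.ae_eq
  eq_integral := fun t ht => h.eq_integral t ⟨ht.1, ht.2.trans hT⟩

theorem congr_deriv (h : S.Traj s T x a d) (hd : d =ᵐ[volume.restrict (Ioc s T)] d') :
    S.Traj s T x a d' where
  cont := h.cont
  memLp_stokes := h.memLp_stokes
  memLp_deriv := h.memLp_deriv.ae_eq hd
  ae_eq := h.ae_eq
  eq_integral := by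
    intro t ht
    rw [h.eq_integral t ht]
    congr 1
    refine integral_congr_ae ?_
    rw [uIoc_of_le ht.1]
    exact (ae_restrict_iff' measurableSet_Ioc).1
      (ae_restrict_of_ae_restrict_of_subset (Ioc_subset_Ioc_right ht.2) hd)

/-- The energy equality in `H`, also for a bounded image of the trajectory. -/
theorem norm_map_root_sq [CompleteSpace H] (h : S.Traj s T x a d) (Q : H →L[ℝ] H) {t : ℝ}
    (ht : t ∈ Icc s T) :
    ‖Q (S.root (x t))‖ ^ 2 = ‖Q (S.root (x s))‖ ^ 2
      + ∫ r in s..t, 2 * inner ℝ (Q (S.root (x r))) (Q (d r)) := by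
  have hs : s ∈ Icc s T := left_mem_Icc.2 (ht.1.trans ht.2)
  rw [intervalIntegral.integral_const_mul]
  refine norm_sq_eq_add_integral (u := fun t => Q (S.root (x t))) (d := fun t => Q (d t)) ht.1 ?_ ?_
  · exact (Q.comp_memLp' h.memLp_deriv).intervalIntegrable_of_two hs ht
  · intro r hr
    have hr' : r ∈ Icc s T := ⟨hr.1, hr.2.trans ht.2⟩
    rw [h.eq_integral r hr', map_add,
      Q.intervalIntegral_comp_comm (h.memLp_deriv.intervalIntegrable_of_two hs hr')]

theorem inner_eq_integral [CompleteSpace H] (h : S.Traj s T x a d) (i : ι) {t : ℝ}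
    (ht : t ∈ Icc s T) :
    inner ℝ (S.basis i) (x t) = inner ℝ (S.basis i) (x s)
      + ∫ r in s..t, S.freq i * inner ℝ (S.basis i) (d r) := by
  have hs : s ∈ Icc s T := left_mem_Icc.2 (ht.1.trans ht.2)
  have h1 := congrArg (inner ℝ (S.basis i)) (h.eq_integral t ht)
  have h2 : inner ℝ (S.basis i) (∫ r in s..t, d r) = ∫ r in s..t, inner ℝ (S.basis i) (d r) :=
    ((innerSL ℝ (S.basis i)).intervalIntegral_comp_comm
      (h.memLp_deriv.intervalIntegrable_of_two hs ht)).symm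
  rw [inner_add_right, S.inner_root, S.inner_root, h2] at h1
  rw [intervalIntegral.integral_const_mul]
  have := S.freq_pos i
  field_simp at h1 ⊢
  linarith

theorem integrable_inner (h : S.Traj s T x a d) :
    Integrable (fun t => inner ℝ (a t) (d t)) (volume.restrict (Ioc s T)) :=
  h.memLp_stokes.integrable_inner_of_two h.memLp_deriv

/-- The energy equality in `V`. -/
theorem norm_sq [CompleteSpace H] [Countable ι] (h : S.Traj s T x a d) {t : ℝ}
    (ht : t ∈ Icc s T) :
    ‖x t‖ ^ 2 = ‖x s‖ ^ 2 + ∫ r in s..t, 2 * inner ℝ (a r) (d r) := by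
  have hs : s ∈ Icc s T := left_mem_Icc.2 (ht.1.trans ht.2)
  -- The i-th coordinate of `x` has derivative freq i times that of `d`, and equals that of `a`
  -- divided by freq i. The frequencies cancel in the scalar energy equality, so no regularity
  -- beyond `a, d ∈ L²` is needed.
  have mode : ∀ i, inner ℝ (S.basis i) (x t) ^ 2 = inner ℝ (S.basis i) (x s) ^ 2
      + ∫ r in s..t, 2 * (inner ℝ (S.basis i) (a r) * inner ℝ (S.basis i) (d r)) := by
    intro i
    have hi : IntervalIntegrable (fun r => S.freq i * inner ℝ (S.basis i) (d r)) volume s t :=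
      (((innerSL ℝ (S.basis i)).comp_memLp' h.memLp_deriv).intervalIntegrable_of_two hs
        ht).const_mul _
    have := norm_sq_eq_add_integral (u := fun t => inner ℝ (S.basis i) (x t)) ht.1 hi
      (fun r hr => h.inner_eq_integral i ⟨hr.1, hr.2.trans ht.2⟩)
    simp only [Real.norm_eq_abs, sq_abs] at this
    rw [this, ← intervalIntegral.integral_const_mul]
    congr 1
    refine integral_congr_ae ?_
    rw [uIoc_of_le ht.1]
    refine (ae_restrict_iff' measurableSet_Ioc).1 ?_
    filter_upwards [ae_restrict_of_ae_restrict_of_subset (Ioc_subset_Ioc_right ht.2) h.ae_eq]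
      with r hr
    rw [hr, S.inner_root]
    have := S.freq_pos i
    simp only [RCLike.inner_apply, conj_trivial]
    field_simp
  have hInt : ∀ i, IntervalIntegrable
      (fun r => 2 * (inner ℝ (S.basis i) (a r) * inner ℝ (S.basis i) (d r))) volume s t := by
    intro i
    refine Integrable.intervalIntegrable_sub (Integrable.const_mul ?_ 2) hs ht
    exact MemLp.integrable_mul ((innerSL ℝ (S.basis i)).comp_memLp' h.memLp_stokes)
      ((innerSL ℝ (S.basis i)).comp_memLp' h.memLp_deriv)
  have hfin : ∀ F : Finset ι, ∑ i ∈ F, inner ℝ (S.basis i) (x t) ^ 2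
      = ∑ i ∈ F, inner ℝ (S.basis i) (x s) ^ 2 + ∫ r in s..t,
        ∑ i ∈ F, 2 * (inner ℝ (S.basis i) (a r) * inner ℝ (S.basis i) (d r)) := by
    intro F
    rw [integral_finsetSum fun i _ => hInt i, ← Finset.sum_add_distrib]
    exact Finset.sum_congr rfl fun i _ => mode i
  -- Dominated convergence: |2αβ| ≤ α² + β² and Bessel bound all partial sums by ‖a‖² + ‖d‖².
  have hlim : Tendsto (fun F : Finset ι => ∫ r in s..t,
        ∑ i ∈ F, 2 * (inner ℝ (S.basis i) (a r) * inner ℝ (S.basis i) (d r))) atTop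
      (𝓝 (∫ r in s..t, 2 * inner ℝ (a r) (d r))) := by
    refine tendsto_integral_filter_of_dominated_convergence (fun r => ‖a r‖ ^ 2 + ‖d r‖ ^ 2)
      (Eventually.of_forall fun F => ?_) (Eventually.of_forall fun F => ?_) ?_ ?_
    · simpa only [Finset.sum_fn] using
        (IntervalIntegrable.sum F fun i _ => hInt i).aestronglyMeasurable_restrict_uIoc
    · refine Eventually.of_forall fun r _ => ?_
      refine (Finset.abs_sum_le_sum_abs _ _).trans ?_
      refine le_trans ?_ (add_le_add (HilbertBasis.sum_inner_sq_le S.basis (a r) F)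
        (HilbertBasis.sum_inner_sq_le S.basis (d r) F))
      rw [← Finset.sum_add_distrib]
      refine Finset.sum_le_sum fun i _ => abs_le.2 ⟨?_, ?_⟩
      · nlinarith [sq_nonneg (inner ℝ (S.basis i) (a r) + inner ℝ (S.basis i) (d r))]
      · nlinarith [sq_nonneg (inner ℝ (S.basis i) (a r) - inner ℝ (S.basis i) (d r))]
    · exact Integrable.intervalIntegrable_sub ((h.memLp_stokes.integrable_norm_pow (by norm_num)).add
        (h.memLp_deriv.integrable_norm_pow (by norm_num))) hs ht
    · refine Eventually.of_forall fun r _ => ?_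
      refine HasSum.mul_left 2 ((S.basis.hasSum_inner_mul_inner (a r) (d r)).congr_fun fun i => ?_)
      rw [real_inner_comm]
  refine tendsto_nhds_unique (HilbertBasis.hasSum_inner_sq S.basis (x t)) ?_
  exact (Tendsto.add (HilbertBasis.hasSum_inner_sq S.basis (x s)) hlim).congr fun F => (hfin F).symm

/-- The parabolic estimate for the linear equation `du/dt + ν A u = f`. -/
theorem linear_estimate [CompleteSpace H] [Countable ι] {ν : ℝ} (hν : 0 < ν) {f : ℝ → H}
    (hf : MemLp f 2 (volume.restrict (Ioc s T)))
    (h : S.Traj s T x a (fun t => f t - ν • a t)) {t : ℝ} (ht : t ∈ Icc s T) :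
    ‖x t‖ ^ 2 + ν * ∫ r in s..t, ‖a r‖ ^ 2 ≤ ‖x s‖ ^ 2 + ν⁻¹ * ∫ r in s..t, ‖f r‖ ^ 2 := by
  have hs : s ∈ Icc s T := left_mem_Icc.2 (ht.1.trans ht.2)
  have ha2 : IntervalIntegrable (fun r => ‖a r‖ ^ 2) volume s t :=
    Integrable.intervalIntegrable_sub (h.memLp_stokes.integrable_norm_pow (by norm_num)) hs ht
  have hf2 : IntervalIntegrable (fun r => ‖f r‖ ^ 2) volume s t :=
    Integrable.intervalIntegrable_sub (hf.integrable_norm_pow (by norm_num)) hs ht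
  rw [h.norm_sq ht, ← intervalIntegral.integral_const_mul, ← intervalIntegral.integral_const_mul,
    add_assoc, ← integral_add ((h.integrable_inner.intervalIntegrable_sub hs ht).const_mul 2)
      (ha2.const_mul ν)]
  gcongr
  refine integral_mono_on ht.1
    (((h.integrable_inner.intervalIntegrable_sub hs ht).const_mul 2).add (ha2.const_mul ν))
    (hf2.const_mul _) fun r _ => ?_
  rw [inner_sub_right, inner_smul_right, real_inner_self_eq_norm_sq]
  have h1 := real_inner_le_norm (a r) (f r)
  have h2 : 2 * (‖a r‖ * ‖f r‖) ≤ ν * ‖a r‖ ^ 2 + ν⁻¹ * ‖f r‖ ^ 2 := by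
    have h3 : ν * ‖a r‖ ^ 2 + ν⁻¹ * ‖f r‖ ^ 2 - 2 * (‖a r‖ * ‖f r‖)
        = ν⁻¹ * (ν * ‖a r‖ - ‖f r‖) ^ 2 := by field_simp; ring
    have : 0 ≤ ν⁻¹ * (ν * ‖a r‖ - ‖f r‖) ^ 2 := by positivity
    linarith
  linarith

end SpectralData.Traj

/-- A family of square integrable functions with summable square norms consists of the coordinates
of a square integrable vector-valued function. -/
theorem HilbertBasis.exists_memLp_inner_eq [Countable ι] (b : HilbertBasis ι ℝ H) {α : Type*}
    [MeasurableSpace α] {μ : Measure α} {φ : ι → α → ℝ} (hφ : ∀ i, MemLp (φ i) 2 μ)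
    (hsum : Summable fun i => ∫ t, φ i t ^ 2 ∂μ) :
    ∃ a : α → H, MemLp a 2 μ ∧ ∀ᵐ t ∂μ, ∀ i, inner ℝ (b i) (a t) = φ i t := by
  have hm : ∀ i, AEMeasurable (fun t => ENNReal.ofReal (φ i t ^ 2)) μ := fun i =>
    ((hφ i).1.aemeasurable.pow_const 2).ennreal_ofReal
  -- Tonelli: the sum of squares has finite integral, hence is finite almost everywhere, and the
  -- series of vectors converges there.
  have hlint : ∫⁻ t, ∑' i, ENNReal.ofReal (φ i t ^ 2) ∂μ ≠ ⊤ := by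
    rw [lintegral_tsum hm]
    simp_rw [← ofReal_integral_eq_lintegral_ofReal (hφ _).integrable_sq
      (Eventually.of_forall fun t => sq_nonneg _)]
    exact hsum.tsum_ofReal_ne_top
  have hgood : ∀ᵐ t ∂μ, Summable fun i => φ i t ^ 2 := by
    filter_upwards [ae_lt_top' (AEMeasurable.tsum hm) hlint] with t ht
    simpa [ENNReal.toReal_ofReal, sq_nonneg] using ENNReal.summable_toReal ht.ne
  have hspec : ∀ᵐ t ∂μ, HasSum (fun i => φ i t • b i) (∑' i, φ i t • b i) ∧
      ∀ i, inner ℝ (b i) (∑' i, φ i t • b i) = φ i t := by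
    filter_upwards [hgood] with t ht
    obtain ⟨x, hx, hx'⟩ := HilbertBasis.exists_inner_eq b ht
    rw [hx'.tsum_eq]
    exact ⟨hx', hx⟩
  refine ⟨fun t => ∑' i, φ i t • b i, ?_, hspec.mono fun t ht => ht.2⟩
  have hmeas : AEStronglyMeasurable (fun t => ∑' i, φ i t • b i) μ := by
    refine aestronglyMeasurable_of_tendsto_ae (u := atTop)
      (f := fun (F : Finset ι) t => ∑ i ∈ F, φ i t • b i) (fun F => ?_)
      (hspec.mono fun t ht => ht.1)
    exact Finset.aestronglyMeasurable_fun_sum F fun i _ => (hφ i).1.smul_const _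
  rw [memLp_two_iff_integrable_sq_norm hmeas]
  refine ⟨hmeas.norm.pow 2, ?_⟩
  rw [hasFiniteIntegral_iff_ofReal (Eventually.of_forall fun t => sq_nonneg _)]
  refine lt_of_le_of_lt (lintegral_mono_ae ?_) hlint.lt_top
  filter_upwards [hspec] with t ht
  have h1 := HilbertBasis.hasSum_inner_sq b (∑' i, φ i t • b i)
  simp only [ht.2] at h1
  rw [← h1.tsum_eq, ENNReal.ofReal_tsum_of_nonneg (fun i => sq_nonneg _) h1.summable]

/-- Continuous functions with summable uniform bounds for the squares are the coordinates
of a continuous vector-valued function. -/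
theorem HilbertBasis.exists_continuousOn_inner_eq (b : HilbertBasis ι ℝ H) {α : Type*}
    [TopologicalSpace α] {K : Set α} {y : ι → α → ℝ} {c : ι → ℝ}
    (hy : ∀ i, ContinuousOn (y i) K) (hyc : ∀ i, ∀ t ∈ K, y i t ^ 2 ≤ c i) (hc : Summable c) :
    ∃ x : α → H, ContinuousOn x K ∧ ∀ t ∈ K, ∀ i, inner ℝ (b i) (x t) = y i t := by
  classical
  have hsum : ∀ t ∈ K, Summable fun i => y i t ^ 2 := fun t ht =>
    hc.of_nonneg_of_le (fun i => sq_nonneg _) fun i => hyc i t ht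
  have hspec : ∀ t ∈ K, ∀ i, inner ℝ (b i) (∑' i, y i t • b i) = y i t := by
    intro t ht
    obtain ⟨x, hx, hx'⟩ := HilbertBasis.exists_inner_eq b (hsum t ht)
    rw [hx'.tsum_eq]
    exact hx
  refine ⟨fun t => ∑' i, y i t • b i, ?_, hspec⟩
  -- By Parseval the squared tail at any point is at most the tail of the numerical series `c`,
  -- which does not depend on the point.
  have hunif : TendstoUniformlyOn (fun (F : Finset ι) t => ∑ i ∈ F, y i t • b i)
      (fun t => ∑' i, y i t • b i) atTop K := by
    rw [Metric.tendstoUniformlyOn_iff]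
    intro ε hε
    have h0 := tendsto_tsum_compl_atTop_zero c
    filter_upwards [h0.eventually (gt_mem_nhds (by positivity : 0 < ε ^ 2))] with F hF t ht
    rw [dist_eq_norm]
    refine lt_of_pow_lt_pow_left₀ 2 hε.le (lt_of_le_of_lt ?_ hF)
    have h1 := HilbertBasis.hasSum_inner_sq b ((∑' i, y i t • b i) - ∑ i ∈ F, y i t • b i)
    have h2 : ∀ i, inner ℝ (b i) ((∑' i, y i t • b i) - ∑ i ∈ F, y i t • b i)
        = if i ∈ F then 0 else y i t := by
      intro i
      rw [inner_sub_right, hspec t ht, inner_sum]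
      simp only [inner_smul_right, orthonormal_iff_ite.1 b.orthonormal, mul_ite, mul_one, mul_zero,
        Finset.sum_ite_eq]
      split_ifs <;> simp
    simp only [h2] at h1
    have hc' : Summable fun i : {i // i ∉ F} => c i := hc.subtype _
    rw [← h1.tsum_eq, ← tsum_subtype_eq_of_support_subset (s := {i | i ∉ F})]
    · refine Summable.tsum_le_tsum (fun i => ?_) ?_ hc'
      · rw [if_neg i.2]
        exact hyc _ t ht
      · exact h1.summable.subtype _
    · intro i hi
      simp only [Function.mem_support] at hi
      by_contra hcon
      simp only [mem_ofPred_eq, not_not] at hcon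
      simp [hcon] at hi
  refine hunif.continuousOn (Frequently.of_forall fun F => ?_)
  exact continuousOn_finsetSum F fun i _ => (hy i).smul continuousOn_const

/-- The scalar linear equation `y' + c y = φ`. -/
theorem exists_scalar_linear {s T c y₀ : ℝ} (hsT : s ≤ T) {φ : ℝ → ℝ}
    (hφ : IntervalIntegrable φ volume s T) :
    ∃ y : ℝ → ℝ, y s = y₀ ∧ ContinuousOn y (Icc s T) ∧
      ∀ t ∈ Icc s T, y t = y s + ∫ r in s..t, (φ r - c * y r) := by
  have hexp : IntervalIntegrable (fun r => Real.exp (c * r) * φ r) volume s T :=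
    hφ.continuousOn_mul (by fun_prop)
  -- Variation of constants: the solution is exp (-ct) z(t).
  set z : ℝ → ℝ := fun t => Real.exp (c * s) * y₀ + ∫ r in s..t, Real.exp (c * r) * φ r with hz
  have hac : AbsolutelyContinuousOnInterval (fun t => Real.exp (-(c * t)) * z t) s T := by
    refine AbsolutelyContinuousOnInterval.fun_mul
      (ContDiffOn.absolutelyContinuousOnInterval (by fun_prop)) ?_
    refine absolutelyContinuousOnInterval_of_dist_le
      (hexp.absolutelyContinuousOnInterval_intervalIntegral left_mem_uIcc) fun r _ t _ => ?_
    simp [hz]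
  have hys : Real.exp (-(c * s)) * z s = y₀ := by
    simp [hz, ← mul_assoc, ← Real.exp_add]
  refine ⟨fun t => Real.exp (-(c * t)) * z t, hys, ?_, fun t ht => ?_⟩
  · have := hac.continuousOn
    rwa [uIcc_of_le hsT] at this
  · have hsub : uIcc s t ⊆ uIcc s T := by
      rw [uIcc_of_le hsT, uIcc_of_le ht.1]; exact Icc_subset_Icc_right ht.2
    have := integral_eq_sub_of_ae_hasDerivAt (hac.mono hsub)
      (ψ := fun r => φ r - c * (Real.exp (-(c * r)) * z r)) ?_
    · rw [this]; ring
    · filter_upwards [hexp.ae_hasDerivAt_integral] with r hr hmem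
      have h1 := (hr (hsub hmem) s left_mem_uIcc).const_add (Real.exp (c * s) * y₀)
      have h2 : HasDerivAt (fun r => Real.exp (-(c * r))) (Real.exp (-(c * r)) * (-(c * 1))) r :=
        (((hasDerivAt_id r).const_mul c).neg).exp
      have h3 := h2.mul h1
      refine h3.congr_deriv ?_
      have h4 : Real.exp (-(c * r)) * Real.exp (c * r) = 1 := by simp [← Real.exp_add]
      linear_combination φ r * h4

/-- Energy equality plus completion of a square, one mode of `linear_estimate`. With c = ν freq² and
φ = freq f the right-hand side becomes ν⁻¹ ∫ f², with no trace of the frequency, so the modes can be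
summed. -/
theorem scalar_linear_estimate {s T c : ℝ} (hc : 0 < c) {φ y : ℝ → ℝ}
    (hφ : MemLp φ 2 (volume.restrict (Ioc s T))) (hy : ContinuousOn y (Icc s T))
    (h : ∀ t ∈ Icc s T, y t = y s + ∫ r in s..t, (φ r - c * y r)) {t : ℝ} (ht : t ∈ Icc s T) :
    y t ^ 2 + c * ∫ r in s..t, y r ^ 2 ≤ y s ^ 2 + c⁻¹ * ∫ r in s..t, φ r ^ 2 := by
  have hs : s ∈ Icc s T := left_mem_Icc.2 (ht.1.trans ht.2)
  have hyt : ContinuousOn y (uIcc s t) := by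
    rw [uIcc_of_le ht.1]; exact hy.mono (Icc_subset_Icc_right ht.2)
  have hφi := hφ.intervalIntegrable_of_two hs ht
  have hd : IntervalIntegrable (fun r => φ r - c * y r) volume s t :=
    hφi.sub (hyt.intervalIntegrable.const_mul c)
  have h1 := norm_sq_eq_add_integral ht.1 hd fun r hr => h r ⟨hr.1, hr.2.trans ht.2⟩
  simp only [Real.norm_eq_abs, sq_abs, RCLike.inner_apply, conj_trivial] at h1
  have hy2 : IntervalIntegrable (fun r => y r ^ 2) volume s t :=
    ContinuousOn.intervalIntegrable (hyt.pow 2)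
  have hφ2 : IntervalIntegrable (fun r => φ r ^ 2) volume s t :=
    hφ.integrable_sq.intervalIntegrable_sub hs ht
  rw [h1, ← intervalIntegral.integral_const_mul, ← intervalIntegral.integral_const_mul,
    ← intervalIntegral.integral_const_mul, add_assoc,
    ← integral_add ((hd.mul_continuousOn hyt).const_mul 2) (hy2.const_mul c)]
  gcongr
  refine integral_mono_on ht.1 (((hd.mul_continuousOn hyt).const_mul 2).add (hy2.const_mul c))
    (hφ2.const_mul _) fun r _ => ?_
  have h3 : c⁻¹ * φ r ^ 2 - (2 * ((φ r - c * y r) * y r) + c * y r ^ 2)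
        = c⁻¹ * (c * y r - φ r) ^ 2 := by field_simp; ring
  have : 0 ≤ c⁻¹ * (c * y r - φ r) ^ 2 := by positivity
  linarith

/-- Existence for the linear equation `du/dt + ν A u = f`, `u(s) = A^{-1/2} x₀`. -/
theorem SpectralData.exists_linear [CompleteSpace H] [Countable ι] (S : SpectralData ι H)
    {ν : ℝ} (hν : 0 < ν) {s T : ℝ} (hsT : s ≤ T) (x₀ : H) {f : ℝ → H}
    (hf : MemLp f 2 (volume.restrict (Ioc s T))) :
    ∃ x a : ℝ → H, x s = x₀ ∧ S.Traj s T x a (fun t => f t - ν • a t) := by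
  have hs : s ∈ Icc s T := left_mem_Icc.2 hsT
  have hT : T ∈ Icc s T := right_mem_Icc.2 hsT
  have hfi : ∀ i, MemLp (fun t => inner ℝ (S.basis i) (f t)) 2 (volume.restrict (Ioc s T)) :=
    fun i => (innerSL ℝ (S.basis i)).comp_memLp' hf
  have hφ : ∀ i, MemLp (fun t => S.freq i * inner ℝ (S.basis i) (f t)) 2
      (volume.restrict (Ioc s T)) := fun i => (hfi i).const_mul _
  -- The coordinate y of A^{1/2} u solves y' + ν freq² y = freq ⟨e, f⟩.
  choose y hys hyc hy using fun i => exists_scalar_linear (c := ν * S.freq i ^ 2)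
    (y₀ := inner ℝ (S.basis i) x₀) hsT ((hφ i).intervalIntegrable_of_two hs hT)
  -- This bounds both y_i² uniformly in time and ν freq² ∫ y_i²; it is summable by Parseval for x₀
  -- and Bessel for f.
  set C : ι → ℝ := fun i => inner ℝ (S.basis i) x₀ ^ 2
    + ν⁻¹ * ∫ r in s..T, inner ℝ (S.basis i) (f r) ^ 2 with hC
  have hfi2 : ∀ i, IntervalIntegrable (fun r => inner ℝ (S.basis i) (f r) ^ 2) volume s T :=
    fun i => (hfi i).integrable_sq.intervalIntegrable_sub hs hT
  have hCsum : Summable C := by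
    refine (HilbertBasis.hasSum_inner_sq S.basis x₀).summable.add (Summable.mul_left _ ?_)
    refine summable_of_sum_le (c := ∫ r in s..T, ‖f r‖ ^ 2)
      (fun i => integral_nonneg hsT fun r _ => sq_nonneg _) fun F => ?_
    rw [← integral_finsetSum fun i _ => hfi2 i]
    refine integral_mono_on hsT ?_ ?_ fun r _ => HilbertBasis.sum_inner_sq_le S.basis (f r) F
    · simpa only [Finset.sum_fn] using IntervalIntegrable.sum F fun i _ => hfi2 i
    · exact Integrable.intervalIntegrable_sub (hf.integrable_norm_pow (by norm_num)) hs hT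
  have hest : ∀ i, ∀ t ∈ Icc s T, y i t ^ 2 + ν * S.freq i ^ 2 * ∫ r in s..t, y i r ^ 2 ≤ C i := by
    intro i t ht
    have hμ := S.freq_pos i
    have h1 := scalar_linear_estimate (by positivity) (hφ i) (hyc i) (hy i) ht
    refine h1.trans ?_
    rw [hys i]
    simp only [hC, mul_pow, intervalIntegral.integral_const_mul]
    have h2 : (ν * S.freq i ^ 2)⁻¹ * (S.freq i ^ 2 * ∫ r in s..t, inner ℝ (S.basis i) (f r) ^ 2)
        = ν⁻¹ * ∫ r in s..t, inner ℝ (S.basis i) (f r) ^ 2 := by field_simp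
    rw [h2]
    gcongr
    exact integral_mono_interval le_rfl ht.1 ht.2 (Eventually.of_forall fun r => sq_nonneg _)
      (hfi2 i)
  have hint0 : ∀ i, ∀ t ∈ Icc s T, 0 ≤ ∫ r in s..t, y i r ^ 2 := fun i t ht =>
    integral_nonneg ht.1 fun r _ => sq_nonneg _
  obtain ⟨x, hxc, hx⟩ := HilbertBasis.exists_continuousOn_inner_eq S.basis hyc
    (fun i t ht => by
      have h1 := hest i t ht
      have h2 : 0 ≤ ν * S.freq i ^ 2 * ∫ r in s..t, y i r ^ 2 :=
        mul_nonneg (by positivity) (hint0 i t ht)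
      linarith) hCsum
  have hyL : ∀ i, MemLp (y i) 2 (volume.restrict (Ioc s T)) := by
    intro i
    rw [memLp_two_iff_integrable_sq
      (((hyc i).mono Ioc_subset_Icc_self).aestronglyMeasurable measurableSet_Ioc)]
    exact (((hyc i).pow 2).integrableOn_Icc).mono_set Ioc_subset_Icc_self
  -- The coordinates of A u are freq i * y i; the dissipation term of the mode estimate makes their
  -- square integrals summable.
  obtain ⟨a, ha, hai⟩ := HilbertBasis.exists_memLp_inner_eq S.basis
    (φ := fun i t => S.freq i * y i t) (fun i => (hyL i).const_mul _) (by
      refine (hCsum.mul_left ν⁻¹).of_nonneg_of_le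
        (fun i => MeasureTheory.integral_nonneg fun r => sq_nonneg _) fun i => ?_
      have h1 := hest i T hT
      rw [← integral_of_le hsT]
      simp only [mul_pow, intervalIntegral.integral_const_mul]
      rw [le_inv_mul_iff₀ hν]
      nlinarith [sq_nonneg (y i T)])
  refine ⟨x, a, HilbertBasis.ext_inner S.basis fun i => by rw [hx s hs, hys], hxc, ha,
    hf.sub (ha.const_smul ν), ?_, ?_⟩
  · filter_upwards [hai, ae_restrict_mem measurableSet_Ioc] with t h1 h2
    refine HilbertBasis.ext_inner S.basis fun i => ?_
    have := S.freq_pos i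
    rw [hx t (Ioc_subset_Icc_self h2), S.inner_root, h1 i]
    field_simp
  · intro t ht
    have hd : IntervalIntegrable (fun t => f t - ν • a t) volume s t :=
      (hf.sub (ha.const_smul ν)).intervalIntegrable_of_two hs ht
    refine HilbertBasis.ext_inner S.basis fun i => ?_
    have hμ := S.freq_pos i
    have h2 : inner ℝ (S.basis i) (∫ r in s..t, (f r - ν • a r))
        = ∫ r in s..t, inner ℝ (S.basis i) (f r - ν • a r) :=
      ((innerSL ℝ (S.basis i)).intervalIntegral_comp_comm hd).symm
    rw [inner_add_right, S.inner_root, S.inner_root, hx t ht, hx s hs, h2, hy i t ht, mul_add,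
      ← intervalIntegral.integral_const_mul]
    congr 1
    refine integral_congr_ae ?_
    rw [uIoc_of_le ht.1]
    refine (ae_restrict_iff' measurableSet_Ioc).1 ?_
    filter_upwards [ae_restrict_of_ae_restrict_of_subset (Ioc_subset_Ioc_right ht.2) hai] with r hr
    rw [inner_sub_right, inner_smul_right, hr i]
    field_simp

end Abstract

end SyncNSE

/-! ### Concatenation, the abstract nonlinearity, and its size on short intervals. -/

namespace SyncNSE

open Set Filter Topology intervalIntegral

section Abstract

variable {ι H : Type*} [NormedAddCommGroup H] [InnerProductSpace ℝ H]

namespace SpectralData.Traj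

variable {S : SpectralData ι H} {s m T : ℝ} {x a d x' a' d' : ℝ → H}

theorem _root_.MeasureTheory.MemLp.ite_Ioc {E : Type*} [NormedAddCommGroup E] {f f' : ℝ → E}
    (hf : MemLp f 2 (volume.restrict (Ioc s m))) (hf' : MemLp f' 2 (volume.restrict (Ioc m T))) :
    MemLp (fun t => if t ≤ m then f t else f' t) 2 (volume.restrict (Ioc s T)) := by
  classical
  have := MemLp.piecewise (s := Iic m) (μ := volume.restrict (Ioc s T)) (p := 2) (f := f) (g := f')
    measurableSet_Iic ?_ ?_
  · exact this
  · rw [Measure.restrict_restrict measurableSet_Iic]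
    refine hf.mono_measure (Measure.restrict_mono ?_ le_rfl)
    intro t ht
    exact ⟨ht.2.1, ht.1⟩
  · rw [Measure.restrict_restrict measurableSet_Iic.compl]
    refine hf'.mono_measure (Measure.restrict_mono ?_ le_rfl)
    intro t ht
    exact ⟨not_le.1 ht.1, ht.2.2⟩

/-- Concatenation of two trajectories. -/
theorem glue [CompleteSpace H] (hsm : s ≤ m) (hmT : m ≤ T) (h : S.Traj s m x a d)
    (h' : S.Traj m T x' a' d') (hm : x m = x' m) :
    S.Traj s T (fun t => if t ≤ m then x t else x' t) (fun t => if t ≤ m then a t else a' t)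
      (fun t => if t ≤ m then d t else d' t) where
  cont := by
    rw [← Icc_union_Icc_eq_Icc hsm hmT]
    refine ContinuousOn.union_of_isClosed ?_ ?_ isClosed_Icc isClosed_Icc
    · exact h.cont.congr fun t ht => if_pos ht.2
    · refine h'.cont.congr fun t ht => ?_
      rcases ht.1.eq_or_lt with rfl | hlt
      · simp [hm]
      · exact if_neg (not_le.2 hlt)
  memLp_stokes := h.memLp_stokes.ite_Ioc h'.memLp_stokes
  memLp_deriv := h.memLp_deriv.ite_Ioc h'.memLp_deriv
  ae_eq := by
    have h1 := (ae_restrict_iff' measurableSet_Ioc).1 h.ae_eq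
    have h2 := (ae_restrict_iff' measurableSet_Ioc).1 h'.ae_eq
    refine (ae_restrict_iff' measurableSet_Ioc).2 ?_
    filter_upwards [h1, h2] with t h1 h2 ht
    split_ifs with hle
    · exact h1 ⟨ht.1, hle⟩
    · exact h2 ⟨not_le.1 hle, ht.2⟩
  eq_integral := by
    have hleft : ∀ t ≤ m, s ≤ t → ∫ r in s..t, (if r ≤ m then d r else d' r) = ∫ r in s..t, d r := by
      intro t htm hst
      refine integral_congr_ae (Eventually.of_forall fun r hr => ?_)
      rw [uIoc_of_le hst] at hr
      exact if_pos (hr.2.trans htm)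
    intro t ht
    simp only [if_pos hsm]
    split_ifs with hle
    · rw [hleft t hle ht.1]
      exact h.eq_integral t ⟨ht.1, hle⟩
    · have hlt := not_le.1 hle
      have hright : ∫ r in m..t, (if r ≤ m then d r else d' r) = ∫ r in m..t, d' r := by
        refine integral_congr_ae (Eventually.of_forall fun r hr => ?_)
        rw [uIoc_of_le hlt.le] at hr
        exact if_neg (not_le.2 hr.1)
      have hi := (h.memLp_deriv.ite_Ioc h'.memLp_deriv)
      have hs' : s ∈ Icc s T := left_mem_Icc.2 (hsm.trans hmT)
      rw [← integral_add_adjacent_intervals (hi.intervalIntegrable_of_two hs' ⟨hsm, hmT⟩)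
        (hi.intervalIntegrable_of_two ⟨hsm, hmT⟩ ht), hleft m le_rfl hsm, hright,
        h'.eq_integral t ⟨hlt.le, ht.2⟩, ← hm, h.eq_integral m (right_mem_Icc.2 hsm)]
      abel

end SpectralData.Traj

/-- The structural properties of the Navier-Stokes nonlinearity and of a low mode projection used
in the well-posedness theory; `B a b` stands for `B(A⁻¹a, A⁻¹b)`. -/
structure NonlinearData (S : SpectralData ι H) where
  B : H →L[ℝ] H →L[ℝ] H
  P : H →L[ℝ] H
  C : ℝ
  C_nonneg : 0 ≤ C
  norm_B_le : ∀ a b, ‖B a b‖ ≤ C * (√‖S.root (S.root a)‖ * √‖a‖ * ‖S.root b‖)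
  inner_B_self : ∀ a b, inner ℝ (B a b) (S.root (S.root b)) = 0
  inner_P_comm : ∀ x y, inner ℝ (P x) y = inner ℝ x (P y)
  P_P : ∀ x, P (P x) = P x
  P_root : ∀ x, P (S.root x) = S.root (P x)
  D : ℝ
  D_nonneg : 0 ≤ D
  inner_B_P_le : ∀ a b z, |inner ℝ (B a b) (P z)|
    ≤ D * (‖S.root (S.root a)‖ * ‖S.root (S.root b)‖ * ‖z‖)

variable {S : SpectralData ι H}

namespace NonlinearData

variable (𝔑 : NonlinearData S)

theorem norm_P_le (x : H) : ‖𝔑.P x‖ ≤ ‖x‖ := by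
  have h : ‖𝔑.P x‖ ^ 2 ≤ ‖x‖ * ‖𝔑.P x‖ := by
    rw [← real_inner_self_eq_norm_sq, 𝔑.inner_P_comm, 𝔑.P_P]
    exact real_inner_le_norm _ _
  by_contra hlt
  nlinarith [norm_nonneg x, norm_nonneg (𝔑.P x)]

/-- The right-hand side of the `i`-th equation of `du/dt + ν A u = ...`. -/
noncomputable def force (M : Matrix (Fin 2) (Fin 2) ℝ) (g a : Fin 2 → ℝ → H) (i : Fin 2) (t : ℝ) :
    H :=
  g i t - 𝔑.B (a i t) (a i t) + ∑ j, M i j • 𝔑.P (𝔑.B (a j t) (a j t))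

/-- The pair `u i = A^{-1/2} (x i)` with `A (u i) = a i` solves the intertwined system
on `[s,T]`. -/
def IsSol (ν : ℝ) (M : Matrix (Fin 2) (Fin 2) ℝ) (g : Fin 2 → ℝ → H) (s T : ℝ)
    (x a : Fin 2 → ℝ → H) : Prop :=
  ∀ i, S.Traj s T (x i) (a i) fun t => 𝔑.force M g a i t - ν • a i t

variable {𝔑} in
theorem IsSol.glue [CompleteSpace H] {ν s m T : ℝ} {M : Matrix (Fin 2) (Fin 2) ℝ}
    {g x a x' a' : Fin 2 → ℝ → H} (hsm : s ≤ m) (hmT : m ≤ T)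
    (h : 𝔑.IsSol ν M g s m x a) (h' : 𝔑.IsSol ν M g m T x' a') (hm : ∀ i, x i m = x' i m) :
    𝔑.IsSol ν M g s T (fun i t => if t ≤ m then x i t else x' i t)
      (fun i t => if t ≤ m then a i t else a' i t) := by
  intro i
  convert (h i).glue hsm hmT (h' i) (hm i) using 1
  funext t
  simp only [force]
  split_ifs <;> rfl

/-- The nonlinearity is square integrable in time along trajectories, with a norm that is small
on short intervals. -/
theorem integral_norm_B_sq_le {s T ρ X X' : ℝ} (hsT : s ≤ T) (hρ : 0 < ρ) (hTρ : T - s ≤ ρ ^ 4)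
    {x a d x' a' d' : ℝ → H} (h : S.Traj s T x a d) (h' : S.Traj s T x' a' d')
    (hX0 : 0 ≤ X) (hX : ∀ t ∈ Icc s T, ‖x t‖ ≤ X) (hX' : ∀ t ∈ Icc s T, ‖x' t‖ ≤ X')
    (haX : ∫ t in Ioc s T, ‖a t‖ ^ 2 ≤ X ^ 2) :
    MemLp (fun t => 𝔑.B (a t) (a' t)) 2 (volume.restrict (Ioc s T)) ∧
      ∫ t in Ioc s T, ‖𝔑.B (a t) (a' t)‖ ^ 2 ≤ (𝔑.C * ρ * X * X') ^ 2 := by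
  have hmeas : AEStronglyMeasurable (fun t => 𝔑.B (a t) (a' t)) (volume.restrict (Ioc s T)) :=
    𝔑.B.aestronglyMeasurable_comp₂ h.memLp_stokes.1 h'.memLp_stokes.1
  have ha2 : Integrable (fun t => ‖a t‖ ^ 2) (volume.restrict (Ioc s T)) :=
    h.memLp_stokes.integrable_norm_pow (by norm_num)
  -- Young with weight ρ²: X‖a‖ ≤ (ρ²‖a‖² + X²ρ⁻²)/2. Over a length at most ρ⁴ each of the two terms
  -- integrates to at most ρ²X², which is where the small factor ρ comes from.
  set bd : ℝ → ℝ := fun t => (𝔑.C * X') ^ 2 * ((ρ ^ 2 * ‖a t‖ ^ 2 + X ^ 2 * (ρ ^ 2)⁻¹) / 2) with hbd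
  have hbdi : Integrable bd (volume.restrict (Ioc s T)) :=
    (((ha2.const_mul _).add (integrable_const _)).div_const 2).const_mul _
  have hle : ∀ᵐ t ∂volume.restrict (Ioc s T), ‖𝔑.B (a t) (a' t)‖ ^ 2 ≤ bd t := by
    filter_upwards [h.ae_eq, h'.ae_eq, ae_restrict_mem measurableSet_Ioc] with t h1 h2 ht
    have ht' := Ioc_subset_Icc_self ht
    have hx := hX t ht'
    have hx' := hX' t ht'
    have hC := 𝔑.C_nonneg
    have h3 := 𝔑.norm_B_le (a t) (a' t)
    rw [← h1, ← h2] at h3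
    have h4 : ‖S.root (x t)‖ ≤ X := (S.norm_root_le _).trans hx
    calc ‖𝔑.B (a t) (a' t)‖ ^ 2
        ≤ (𝔑.C * (√‖S.root (x t)‖ * √‖a t‖ * ‖x' t‖)) ^ 2 := by gcongr
      _ = 𝔑.C ^ 2 * (‖S.root (x t)‖ * ‖a t‖ * ‖x' t‖ ^ 2) := by
          rw [mul_pow, mul_pow, mul_pow, Real.sq_sqrt (norm_nonneg _), Real.sq_sqrt (norm_nonneg _)]
      _ ≤ 𝔑.C ^ 2 * (X * ‖a t‖ * X' ^ 2) := by gcongr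
      _ = (𝔑.C * X') ^ 2 * (X * ‖a t‖) := by ring
      _ ≤ bd t := by
          simp only [hbd]
          gcongr
          have h5 : ρ ^ 2 * ‖a t‖ ^ 2 + X ^ 2 * (ρ ^ 2)⁻¹ - 2 * (X * ‖a t‖)
              = (ρ ^ 2)⁻¹ * (ρ ^ 2 * ‖a t‖ - X) ^ 2 := by field_simp; ring
          have : 0 ≤ (ρ ^ 2)⁻¹ * (ρ ^ 2 * ‖a t‖ - X) ^ 2 := by positivity
          linarith
  have hInt : Integrable (fun t => ‖𝔑.B (a t) (a' t)‖ ^ 2) (volume.restrict (Ioc s T)) := by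
    refine hbdi.mono' (hmeas.norm.pow 2) ?_
    filter_upwards [hle] with t ht
    rwa [Real.norm_of_nonneg (sq_nonneg _)]
  refine ⟨(memLp_two_iff_integrable_sq_norm hmeas).2 hInt, ?_⟩
  refine (integral_mono_ae hInt hbdi hle).trans ?_
  simp only [hbd]
  rw [MeasureTheory.integral_const_mul, MeasureTheory.integral_div,
    MeasureTheory.integral_add (ha2.const_mul _) (integrable_const _),
    MeasureTheory.integral_const_mul, MeasureTheory.integral_const]
  have hvol : (volume.restrict (Ioc s T)).real univ = T - s := by simp [hsT]
  rw [hvol, smul_eq_mul]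
  have h6 : (T - s) * (X ^ 2 * (ρ ^ 2)⁻¹) ≤ ρ ^ 2 * X ^ 2 := by
    have : (T - s) * (X ^ 2 * (ρ ^ 2)⁻¹) ≤ ρ ^ 4 * (X ^ 2 * (ρ ^ 2)⁻¹) := by gcongr
    refine this.trans (le_of_eq ?_)
    field_simp
  have h7 : ρ ^ 2 * ∫ t in Ioc s T, ‖a t‖ ^ 2 ≤ ρ ^ 2 * X ^ 2 := by gcongr
  calc _ ≤ (𝔑.C * X') ^ 2 * ((ρ ^ 2 * X ^ 2 + ρ ^ 2 * X ^ 2) / 2) := by gcongr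
    _ = _ := by ring

end NonlinearData

end Abstract

end SyncNSE

/-! ### Local existence by contraction. -/

namespace SyncNSE

open Set Filter Topology intervalIntegral

section Abstract

variable {ι H : Type*} [NormedAddCommGroup H] [InnerProductSpace ℝ H]

theorem norm_toLp_two_sq {α : Type*} [MeasurableSpace α] {μ : Measure α} {f : α → H}
    (hf : MemLp f 2 μ) : ‖hf.toLp f‖ ^ 2 = ∫ t, ‖f t‖ ^ 2 ∂μ := by
  rw [← real_inner_self_eq_norm_sq, L2.inner_def]
  refine MeasureTheory.integral_congr_ae ?_
  filter_upwards [hf.coeFn_toLp] with t ht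
  rw [ht, real_inner_self_eq_norm_sq]

theorem norm_Lp_two_sq {α : Type*} [MeasurableSpace α] {μ : Measure α} (f : Lp H 2 μ) :
    ‖f‖ ^ 2 = ∫ t, ‖f t‖ ^ 2 ∂μ := by
  rw [← norm_toLp_two_sq (Lp.memLp f), Lp.toLp_coeFn]

theorem norm_toLp_two_le {α : Type*} [MeasurableSpace α] {μ : Measure α} {f : α → H}
    (hf : MemLp f 2 μ) {c : ℝ} (hc : 0 ≤ c) (h : ∫ t, ‖f t‖ ^ 2 ∂μ ≤ c ^ 2) :
    ‖hf.toLp f‖ ≤ c := by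
  rw [← norm_toLp_two_sq hf] at h
  exact (sq_le_sq₀ (norm_nonneg _) hc).1 h

variable {S : SpectralData ι H}

/-- A deliberately crude form of the parabolic estimate: one constant bounds both the supremum of
‖x‖ and the `L²` norm of `a`, as `integral_norm_B_sq_le` requires of its number `X`. -/
theorem SpectralData.Traj.linear_norm_le [CompleteSpace H] [Countable ι] {s T ν K φ : ℝ}
    (hν : 0 < ν) (hsT : s ≤ T) {x a f : ℝ → H} (hf : MemLp f 2 (volume.restrict (Ioc s T)))
    (h : S.Traj s T x a (fun t => f t - ν • a t)) (hK : ‖x s‖ ≤ K) (hφ0 : 0 ≤ φ)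
    (hφ : ∫ t in Ioc s T, ‖f t‖ ^ 2 ≤ φ ^ 2) :
    (∀ t ∈ Icc s T, ‖x t‖ ≤ (1 + ν⁻¹) * (K + φ)) ∧
      ∫ t in Ioc s T, ‖a t‖ ^ 2 ≤ ((1 + ν⁻¹) * (K + φ)) ^ 2 := by
  have hK0 : 0 ≤ K := (norm_nonneg _).trans hK
  have hν' : 0 < ν⁻¹ := inv_pos.2 hν
  have hf2 : IntervalIntegrable (fun t => ‖f t‖ ^ 2) volume s T :=
    Integrable.intervalIntegrable_sub (hf.integrable_norm_pow (by norm_num))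
      (left_mem_Icc.2 hsT) (right_mem_Icc.2 hsT)
  have key : ∀ t ∈ Icc s T, ‖x t‖ ^ 2 + ν * ∫ r in s..t, ‖a r‖ ^ 2 ≤ K ^ 2 + ν⁻¹ * φ ^ 2 := by
    intro t ht
    refine (h.linear_estimate hν hf ht).trans ?_
    rw [← integral_of_le hsT] at hφ
    have := integral_mono_interval le_rfl ht.1 ht.2
      (Eventually.of_forall fun r => sq_nonneg (‖f r‖)) hf2
    gcongr
    exact this.trans hφ
  refine ⟨fun t ht => ?_, ?_⟩
  · have h1 := key t ht
    have h2 : 0 ≤ ν * ∫ r in s..t, ‖a r‖ ^ 2 :=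
      mul_nonneg hν.le (integral_nonneg ht.1 fun r _ => sq_nonneg _)
    refine (sq_le_sq₀ (norm_nonneg _) (by positivity)).1 ?_
    have h3 : K ^ 2 + ν⁻¹ * φ ^ 2 ≤ ((1 + ν⁻¹) * (K + φ)) ^ 2 := by
      have : ((1 + ν⁻¹) * (K + φ)) ^ 2 - (K ^ 2 + ν⁻¹ * φ ^ 2) = 2 * K * φ + φ ^ 2
        + 2 * ν⁻¹ * (K ^ 2 + 2 * K * φ) + ν⁻¹ * φ ^ 2 + (ν⁻¹ * (K + φ)) ^ 2 := by ring
      have : 0 ≤ 2 * K * φ + φ ^ 2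
        + 2 * ν⁻¹ * (K ^ 2 + 2 * K * φ) + ν⁻¹ * φ ^ 2 + (ν⁻¹ * (K + φ)) ^ 2 := by positivity
      linarith
    linarith
  · have h1 := key T (right_mem_Icc.2 hsT)
    rw [← integral_of_le hsT]
    have h2 : ∫ r in s..T, ‖a r‖ ^ 2 ≤ ν⁻¹ * (K ^ 2 + ν⁻¹ * φ ^ 2) := by
      rw [le_inv_mul_iff₀ hν]
      nlinarith [sq_nonneg ‖x T‖]
    refine h2.trans ?_
    have : ((1 + ν⁻¹) * (K + φ)) ^ 2 - ν⁻¹ * (K ^ 2 + ν⁻¹ * φ ^ 2) = (K + φ) ^ 2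
      + ν⁻¹ * K ^ 2 + ν⁻¹ * (4 * K * φ + 2 * φ ^ 2) + ν⁻¹ ^ 2 * (K ^ 2 + 2 * K * φ) := by ring
    have : 0 ≤ (K + φ) ^ 2
      + ν⁻¹ * K ^ 2 + ν⁻¹ * (4 * K * φ + 2 * φ ^ 2) + ν⁻¹ ^ 2 * (K ^ 2 + 2 * K * φ) := by
      positivity
    linarith

namespace NonlinearData

variable (𝔑 : NonlinearData S)

/-- The map `f ↦ B(u, u)`, where `u` solves the linear equation with right-hand side `f`. -/
theorem exists_nonlinear_map [CompleteSpace H] [Countable ι] {s T ν ρ K : ℝ} (hν : 0 < ν)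
    (hsT : s ≤ T) (hρ : 0 < ρ) (hTρ : T - s ≤ ρ ^ 4) {x₀ : H} (hx₀ : ‖x₀‖ ≤ K) :
    ∃ (x a : Lp H 2 (volume.restrict (Ioc s T)) → ℝ → H)
      (Φ : Lp H 2 (volume.restrict (Ioc s T)) → Lp H 2 (volume.restrict (Ioc s T))),
      (∀ f, x f s = x₀) ∧ (∀ f, S.Traj s T (x f) (a f) (fun t => f t - ν • a f t)) ∧
      (∀ f, Φ f =ᵐ[volume.restrict (Ioc s T)] fun t => 𝔑.B (a f t) (a f t)) ∧
      (∀ f, ‖Φ f‖ ≤ 𝔑.C * ρ * (1 + ν⁻¹) ^ 2 * (K + ‖f‖) ^ 2) ∧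
      ∀ f f', ‖Φ f - Φ f'‖ ≤ 𝔑.C * ρ * (1 + ν⁻¹) ^ 2 * (2 * K + ‖f‖ + ‖f'‖) * ‖f - f'‖ := by
  have hK0 : 0 ≤ K := (norm_nonneg _).trans hx₀
  have hC := 𝔑.C_nonneg
  choose x a hxs htr using fun f : Lp H 2 (volume.restrict (Ioc s T)) =>
    S.exists_linear hν hsT x₀ (Lp.memLp f)
  have hb := fun f => (htr f).linear_norm_le hν hsT (Lp.memLp f) ((hxs f).symm ▸ hx₀)
    (norm_nonneg f) (norm_Lp_two_sq f).ge
  have hBB := fun f => 𝔑.integral_norm_B_sq_le hsT hρ hTρ (htr f) (htr f) (by positivity)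
    (hb f).1 (hb f).1 (hb f).2
  refine ⟨x, a, fun f => (hBB f).1.toLp _, hxs, htr, fun f => (hBB f).1.coeFn_toLp, ?_, ?_⟩
  · intro f
    refine (norm_toLp_two_le _ (by positivity) (hBB f).2).trans (le_of_eq ?_)
    ring
  · intro f f'
    -- By linearity the difference solves the equation with source f - f' and zero initial value, so
    -- it is estimated with K = 0.
    have hd : S.Traj s T (fun t => x f t - x f' t) (fun t => a f t - a f' t)
        (fun t => (f - f' : Lp H 2 (volume.restrict (Ioc s T))) t - ν • (a f t - a f' t)) := by
      refine ((htr f).sub (htr f')).congr_deriv ?_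
      filter_upwards [Lp.coeFn_sub f f'] with t ht
      rw [ht, Pi.sub_apply, smul_sub]
      abel
    have hdb := hd.linear_norm_le (K := 0) hν hsT (Lp.memLp (f - f')) (by simp [hxs])
      (norm_nonneg _) (norm_Lp_two_sq _).ge
    rw [zero_add] at hdb
    have h1 := 𝔑.integral_norm_B_sq_le hsT hρ hTρ hd (htr f) (by positivity) hdb.1 (hb f).1 hdb.2
    have h2 := 𝔑.integral_norm_B_sq_le hsT hρ hTρ (htr f') hd (by positivity) (hb f').1 hdb.1
      (hb f').2
    -- B(a,a) - B(a',a') = B(a - a', a) + B(a', a - a').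
    have heq : (hBB f).1.toLp _ - (hBB f').1.toLp _ = h1.1.toLp _ + h2.1.toLp _ := by
      rw [← MemLp.toLp_sub, ← MemLp.toLp_add]
      congr 1
      funext t
      simp only [Pi.sub_apply, Pi.add_apply, map_sub, sub_apply]
      abel
    rw [heq]
    refine (norm_add_le _ _).trans ((add_le_add
      (norm_toLp_two_le _ (by positivity) h1.2)
      (norm_toLp_two_le _ (by positivity) h2.2)).trans (le_of_eq ?_))
    ring

/-- Local existence, on time intervals whose length depends only on bounds for the data. -/
theorem exists_local [CompleteSpace H] [Countable ι] {ν : ℝ} (hν : 0 < ν)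
    (M : Matrix (Fin 2) (Fin 2) ℝ) {K Γ : ℝ} (hK : 0 ≤ K) (hΓ : 0 ≤ Γ) :
    ∃ τ > 0, ∀ s T, s ≤ T → T - s ≤ τ → ∀ g : Fin 2 → ℝ → H,
      (∀ i, MemLp (g i) 2 (volume.restrict (Ioc s T))) →
      (∀ i, ∫ t in Ioc s T, ‖g i t‖ ^ 2 ≤ Γ ^ 2) →
      ∀ x₀ : Fin 2 → H, (∀ i, ‖x₀ i‖ ≤ K) →
      ∃ x a : Fin 2 → ℝ → H, (∀ i, x i s = x₀ i) ∧ 𝔑.IsSol ν M g s T x a := by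
  have hC := 𝔑.C_nonneg
  -- In the ball of radius Γ + 1 the forcing uses up Γ, and the nonlinear part is to be at most 1.
  set r : ℝ := Γ + 1 with hr
  set m : ℝ := ∑ i, ∑ j, |M i j| with hm
  have hm0 : 0 ≤ m := Finset.sum_nonneg fun i _ => Finset.sum_nonneg fun j _ => abs_nonneg _
  have hmi : ∀ i, ∑ j, |M i j| ≤ m := fun i => Finset.single_le_sum
    (f := fun i => ∑ j, |M i j|) (fun i _ => Finset.sum_nonneg fun j _ => abs_nonneg _)
    (Finset.mem_univ i)
  have hr0 : 0 < r := by positivity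
  have hκ : 0 < 1 + ν⁻¹ := by positivity
  -- Since ρ q = 1, the summand (K + r)² gives the self-map bound 1 and the summand 4(K + r) the
  -- Lipschitz constant 1/2; the final 1 keeps q positive.
  set q : ℝ := (1 + m) * (𝔑.C * (1 + ν⁻¹) ^ 2) * ((K + r) ^ 2 + 4 * (K + r)) + 1 with hq
  have hq0 : 0 < q := by positivity
  set ρ : ℝ := q⁻¹ with hρdef
  have hρ : 0 < ρ := inv_pos.2 hq0
  have hρq : ρ * q = 1 := inv_mul_cancel₀ hq0.ne'
  refine ⟨ρ ^ 4, by positivity, ?_⟩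
  intro s T hsT hTs g hg hgΓ x₀ hx₀
  choose x a Φ hxs htr hΦ hΦle hΦlip using fun i => 𝔑.exists_nonlinear_map hν hsT hρ hTs (hx₀ i)
  set L := 𝔑.P.compLpL 2 (volume.restrict (Ioc s T)) with hL
  have hLle : ∀ f, ‖L f‖ ≤ ‖f‖ := by
    intro f
    refine Lp.norm_le_norm_of_ae_le ?_
    filter_upwards [𝔑.P.coeFn_compLpL (p := 2) (μ := volume.restrict (Ioc s T)) f] with t ht
    rw [hL, ht]
    exact 𝔑.norm_P_le _
  set G : Fin 2 → Lp H 2 (volume.restrict (Ioc s T)) := fun i => (hg i).toLp _ with hG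
  have hGΓ : ∀ i, ‖G i‖ ≤ Γ := fun i => norm_toLp_two_le _ hΓ (hgΓ i)
  -- The unknown is the pair of right-hand sides `f`: a fixed point says that the linear solutions
  -- driven by `f` generate `f` through the nonlinear terms.
  set Ψ : (Fin 2 → Lp H 2 (volume.restrict (Ioc s T))) →
      (Fin 2 → Lp H 2 (volume.restrict (Ioc s T))) :=
    fun f i => G i - Φ i (f i) + ∑ j, M i j • L (Φ j (f j)) with hΨ
  have hcomb : ∀ (i : Fin 2) (w : Fin 2 → Lp H 2 (volume.restrict (Ioc s T))) (c : ℝ),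
      (∀ j, ‖w j‖ ≤ c) → ‖w i‖ + ‖∑ j, M i j • L (w j)‖ ≤ (1 + m) * c := by
    intro i w c hw
    have hc0 : 0 ≤ c := (norm_nonneg _).trans (hw i)
    have : ‖∑ j, M i j • L (w j)‖ ≤ m * c := by
      refine (norm_sum_le _ _).trans ?_
      refine (Finset.sum_le_sum fun j _ => ?_).trans
        ((Finset.sum_mul _ _ _).symm.le.trans (mul_le_mul_of_nonneg_right (hmi i) hc0))
      rw [norm_smul, Real.norm_eq_abs]
      exact mul_le_mul_of_nonneg_left ((hLle _).trans (hw j)) (abs_nonneg _)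
    linarith [hw i]
  have hmaps : MapsTo Ψ (Metric.closedBall 0 r) (Metric.closedBall 0 r) := by
    intro f hf
    rw [mem_closedBall_zero_iff] at hf ⊢
    refine (pi_norm_le_iff_of_nonneg hr0.le).2 fun i => ?_
    have hfj : ∀ j, ‖f j‖ ≤ r := fun j => (norm_le_pi_norm f j).trans hf
    have h1 := hcomb i (fun j => Φ j (f j)) (𝔑.C * ρ * (1 + ν⁻¹) ^ 2 * (K + r) ^ 2) fun j =>
      (hΦle j (f j)).trans (by gcongr; exact hfj j)
    have h2 : (1 + m) * (𝔑.C * ρ * (1 + ν⁻¹) ^ 2 * (K + r) ^ 2) ≤ 1 := by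
      have h4 : 0 ≤ ρ * ((1 + m) * (𝔑.C * (1 + ν⁻¹) ^ 2) * (4 * (K + r)) + 1) := by positivity
      have h5 : ρ * q = (1 + m) * (𝔑.C * ρ * (1 + ν⁻¹) ^ 2 * (K + r) ^ 2)
          + ρ * ((1 + m) * (𝔑.C * (1 + ν⁻¹) ^ 2) * (4 * (K + r)) + 1) := by rw [hq]; ring
      linarith
    have h3 : ‖Ψ f i‖ ≤ ‖G i‖ + (‖Φ i (f i)‖ + ‖∑ j, M i j • L (Φ j (f j))‖) := by
      rw [← add_assoc]
      exact (norm_add_le _ _).trans (add_le_add_left (norm_sub_le _ _) _)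
    have := hGΓ i
    linarith
  have hcontr : ContractingWith (1 / 2) (hmaps.restrict Ψ _ _) := by
    refine ⟨by norm_num, LipschitzWith.of_dist_le_mul fun f f' => ?_⟩
    obtain ⟨f, hf⟩ := f
    obtain ⟨f', hf'⟩ := f'
    rw [mem_closedBall_zero_iff] at hf hf'
    change dist (Ψ f) (Ψ f') ≤ _ * dist f f'
    rw [dist_eq_norm, dist_eq_norm]
    refine (pi_norm_le_iff_of_nonneg (by positivity)).2 fun i => ?_
    have hfj : ∀ j, ‖f j‖ ≤ r := fun j => (norm_le_pi_norm f j).trans hf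
    have hfj' : ∀ j, ‖f' j‖ ≤ r := fun j => (norm_le_pi_norm f' j).trans hf'
    have h1 := hcomb i (fun j => Φ j (f j) - Φ j (f' j))
      (𝔑.C * ρ * (1 + ν⁻¹) ^ 2 * (2 * K + r + r) * ‖f - f'‖) fun j =>
      (hΦlip j (f j) (f' j)).trans (by
        gcongr
        · exact hfj j
        · exact hfj' j
        · exact norm_le_pi_norm (f - f') j)
    have h2 : (1 + m) * (𝔑.C * ρ * (1 + ν⁻¹) ^ 2 * (2 * K + r + r)) ≤ 1 / 2 := by
      have h4 : 0 ≤ ρ * ((1 + m) * (𝔑.C * (1 + ν⁻¹) ^ 2) * (K + r) ^ 2 + 1) := by positivity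
      have h5 : ρ * q = 2 * ((1 + m) * (𝔑.C * ρ * (1 + ν⁻¹) ^ 2 * (2 * K + r + r)))
          + ρ * ((1 + m) * (𝔑.C * (1 + ν⁻¹) ^ 2) * (K + r) ^ 2 + 1) := by rw [hq]; ring
      linarith
    have h3 : (Ψ f - Ψ f') i = -(Φ i (f i) - Φ i (f' i))
        + ∑ j, M i j • L (Φ j (f j) - Φ j (f' j)) := by
      simp only [hΨ, Pi.sub_apply, map_sub, smul_sub, Finset.sum_sub_distrib]
      abel
    rw [h3]
    refine (norm_add_le _ _).trans ?_
    rw [norm_neg]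
    refine h1.trans ?_
    have h6 := mul_le_mul_of_nonneg_right h2 (norm_nonneg (f - f'))
    push_cast
    linarith
  obtain ⟨f, -, hfix, -⟩ := hcontr.exists_fixedPoint' Metric.isClosed_closedBall.isComplete hmaps
    (Metric.mem_closedBall_self hr0.le) (edist_ne_top _ _)
  refine ⟨fun i => x i (f i), fun i => a i (f i), fun i => hxs i _, fun i => ?_⟩
  refine (htr i (f i)).congr_deriv ?_
  have hfi : f i = G i - Φ i (f i) + ∑ j, M i j • L (Φ j (f j)) := (congrFun hfix i).symm
  have hΦ' : ∀ᵐ t ∂volume.restrict (Ioc s T), ∀ j, Φ j (f j) t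
      = 𝔑.B (a j (f j) t) (a j (f j) t) := ae_all_iff.2 fun j => hΦ j (f j)
  have hLΦ : ∀ᵐ t ∂volume.restrict (Ioc s T), ∀ j, L (Φ j (f j)) t = 𝔑.P (Φ j (f j) t) :=
    ae_all_iff.2 fun j => 𝔑.P.coeFn_compLpL (p := 2) (Φ j (f j))
  have hsum : ∀ᵐ t ∂volume.restrict (Ioc s T), f i t = G i t - Φ i (f i) t
      + (M i 0 • L (Φ 0 (f 0)) t + M i 1 • L (Φ 1 (f 1)) t) := by
    rw [Fin.sum_univ_two] at hfi
    filter_upwards [Lp.coeFn_add (G i - Φ i (f i)) (M i 0 • L (Φ 0 (f 0)) + M i 1 • L (Φ 1 (f 1))),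
      Lp.coeFn_sub (G i) (Φ i (f i)),
      Lp.coeFn_add (M i 0 • L (Φ 0 (f 0))) (M i 1 • L (Φ 1 (f 1))),
      Lp.coeFn_smul (M i 0) (L (Φ 0 (f 0))), Lp.coeFn_smul (M i 1) (L (Φ 1 (f 1)))]
      with t h1 h2 h3 h4 h5
    rw [← hfi] at h1
    rw [h1, Pi.add_apply, h2, h3, Pi.add_apply, h4, h5]
    rfl
  filter_upwards [hΦ', hLΦ, hsum, (hg i).coeFn_toLp] with t h1 h2 h3 h4
  rw [h3, h2, h2, h1, h1, hG]
  simp only [h4, force, Fin.sum_univ_two, h1]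

end NonlinearData

end Abstract

end SyncNSE

/-! ### Instantaneous energy and enstrophy inequalities. -/

namespace SyncNSE

open Set Filter Topology intervalIntegral

section Abstract

variable {ι H : Type*} [NormedAddCommGroup H] [InnerProductSpace ℝ H] {S : SpectralData ι H}

theorem SpectralData.inner_root_root_self (S : SpectralData ι H) (a : H) :
    inner ℝ (S.root (S.root a)) a = ‖S.root a‖ ^ 2 := by
  rw [S.inner_root_comm, real_inner_self_eq_norm_sq]

theorem two_mul_inner_le (x y : H) : 2 * inner ℝ x y ≤ ‖x‖ ^ 2 + ‖y‖ ^ 2 := by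
  have := real_inner_le_norm x y
  nlinarith [sq_nonneg (‖x‖ - ‖y‖)]

theorem norm_sub_sq_le_two_mul {E : Type*} [NormedAddCommGroup E] (x y : E) :
    ‖x - y‖ ^ 2 ≤ 2 * (‖x‖ ^ 2 + ‖y‖ ^ 2) := by
  have := norm_sub_le x y
  have h : ‖x - y‖ ^ 2 ≤ (‖x‖ + ‖y‖) ^ 2 := by gcongr
  nlinarith [sq_nonneg (‖x‖ - ‖y‖)]

namespace NonlinearData

variable (𝔑 : NonlinearData S) {θ₁ θ₂ : ℝ}

theorem force_zero (g a : Fin 2 → ℝ → H) (t : ℝ) :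
    𝔑.force (mutualMatrix θ₁ θ₂) g a 0 t
      = g 0 t - 𝔑.B (a 0 t) (a 0 t) + θ₁ • 𝔑.P (𝔑.B (a 0 t) (a 0 t) - 𝔑.B (a 1 t) (a 1 t)) := by
  simp [force, mutualMatrix, Fin.sum_univ_two, sub_eq_add_neg]

theorem force_one (g a : Fin 2 → ℝ → H) (t : ℝ) :
    𝔑.force (mutualMatrix θ₁ θ₂) g a 1 t
      = g 1 t - 𝔑.B (a 1 t) (a 1 t) + θ₂ • 𝔑.P (𝔑.B (a 1 t) (a 1 t) - 𝔑.B (a 0 t) (a 0 t)) := by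
  simp [force, mutualMatrix, Fin.sum_univ_two, sub_eq_add_neg]
  abel

/-- The low modes of the difference obey a linear equation. -/
theorem energy_low_diff (hθ : θ₁ + θ₂ = 1) {ν : ℝ} (hν : 0 < ν) (a₀ a₁ g₀ g₁ b₀ b₁ : H) :
    2 * inner ℝ (𝔑.P (S.root (S.root a₀) - S.root (S.root a₁)))
        (𝔑.P ((g₀ - b₀ + θ₁ • 𝔑.P (b₀ - b₁) - ν • a₀) - (g₁ - b₁ + θ₂ • 𝔑.P (b₁ - b₀) - ν • a₁)))
      ≤ ‖𝔑.P (S.root (S.root a₀) - S.root (S.root a₁))‖ ^ 2 + 2 * (‖g₀‖ ^ 2 + ‖g₁‖ ^ 2) := by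
  -- After `P`, the difference b₀ - b₁ has coefficient -1 + θ₁ + θ₂ = 0. Nothing about the b's is
  -- used.
  have h1 : 𝔑.P ((g₀ - b₀ + θ₁ • 𝔑.P (b₀ - b₁) - ν • a₀) - (g₁ - b₁ + θ₂ • 𝔑.P (b₁ - b₀) - ν • a₁))
      = 𝔑.P (g₀ - g₁) - ν • 𝔑.P (a₀ - a₁) := by
    have hθ₂ : θ₂ = 1 - θ₁ := by linarith
    subst hθ₂
    simp only [map_sub, map_add, map_smul, 𝔑.P_P]
    module
  have h2 : inner ℝ (𝔑.P (S.root (S.root a₀) - S.root (S.root a₁))) (𝔑.P (a₀ - a₁))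
      = ‖𝔑.P (S.root (a₀ - a₁))‖ ^ 2 := by
    rw [← map_sub, ← map_sub, 𝔑.P_root, S.inner_root_comm, ← 𝔑.P_root, real_inner_self_eq_norm_sq]
  rw [h1, inner_sub_right, inner_smul_right, h2]
  have h3 := two_mul_inner_le (𝔑.P (S.root (S.root a₀) - S.root (S.root a₁))) (𝔑.P (g₀ - g₁))
  have h4 : ‖𝔑.P (g₀ - g₁)‖ ^ 2 ≤ ‖g₀ - g₁‖ ^ 2 := by
    gcongr
    exact 𝔑.norm_P_le _
  have h5 := norm_sub_sq_le_two_mul g₀ g₁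
  have h6 : 0 ≤ ν * ‖𝔑.P (S.root (a₀ - a₁))‖ ^ 2 := by positivity
  linarith

/-- The low-mode pairing costs no gradient of u: it is quadratic in the `L²` norm, with a factor
linear in the low-mode size Δ. This keeps the energy inequalities within reach of linear Gronwall.
-/
theorem inner_P_B_le (a z : H) {Δ : ℝ} (hz : ‖𝔑.P z‖ ≤ Δ) :
    |inner ℝ (𝔑.P z) (𝔑.B a a)| ≤ 𝔑.D * Δ * ‖S.root (S.root a)‖ ^ 2 := by
  have hD := 𝔑.D_nonneg
  have h := 𝔑.inner_B_P_le a a (𝔑.P z)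
  rw [𝔑.P_P, real_inner_comm] at h
  refine h.trans ?_
  calc _ = 𝔑.D * ‖𝔑.P z‖ * ‖S.root (S.root a)‖ ^ 2 := by ring
    _ ≤ _ := by gcongr

/-- Antisymmetry removes the unprojected convection, and symmetry of `P` puts the projection on u.
The vector `b` is the nonlinearity of the other component. -/
theorem inner_self_force (a b g : H) (θ ν : ℝ) :
    inner ℝ (S.root (S.root a)) (g - 𝔑.B a a + θ • 𝔑.P (𝔑.B a a - b) - ν • a)
      = inner ℝ (S.root (S.root a)) g
        + θ * (inner ℝ (𝔑.P (S.root (S.root a))) (𝔑.B a a) - inner ℝ (𝔑.P (S.root (S.root a))) b)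
        - ν * ‖S.root a‖ ^ 2 := by
  have h1 : inner ℝ (S.root (S.root a)) (𝔑.B a a) = 0 := by
    rw [real_inner_comm]; exact 𝔑.inner_B_self a a
  rw [inner_sub_right, inner_add_right, inner_sub_right, inner_smul_right, inner_smul_right,
    ← 𝔑.inner_P_comm, inner_sub_right, S.inner_root_root_self, h1]
  ring

/-- The balance of the weighted energy, in which the nonlinear terms nearly cancel. -/
theorem energy_weighted (hθ₁ : 0 ≤ θ₁) (hθ₂ : 0 ≤ θ₂) (hθ : θ₁ + θ₂ = 1) {ν : ℝ} (hν : 0 < ν)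
    (a₀ a₁ g₀ g₁ : H) {Δ : ℝ} (hΔ : ‖𝔑.P (S.root (S.root a₀) - S.root (S.root a₁))‖ ≤ Δ) :
    θ₂ * (2 * inner ℝ (S.root (S.root a₀))
        (g₀ - 𝔑.B a₀ a₀ + θ₁ • 𝔑.P (𝔑.B a₀ a₀ - 𝔑.B a₁ a₁) - ν • a₀))
      + θ₁ * (2 * inner ℝ (S.root (S.root a₁))
        (g₁ - 𝔑.B a₁ a₁ + θ₂ • 𝔑.P (𝔑.B a₁ a₁ - 𝔑.B a₀ a₀) - ν • a₁))
      ≤ (1 + 2 * 𝔑.D * Δ) * (θ₂ * ‖S.root (S.root a₀)‖ ^ 2 + θ₁ * ‖S.root (S.root a₁)‖ ^ 2)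
        + (‖g₀‖ ^ 2 + ‖g₁‖ ^ 2) := by
  have hD := 𝔑.D_nonneg
  have hΔ0 : 0 ≤ Δ := (norm_nonneg _).trans hΔ
  rw [𝔑.inner_self_force, 𝔑.inner_self_force]
  -- With these weights the four coupling terms combine to θ₁θ₂ ⟨P(u₀ - u₁), B₀ - B₁⟩, so only the
  -- low modes of the difference need to be bounded.
  have h0 := (abs_le.1 (𝔑.inner_P_B_le a₀ _ hΔ)).2
  have h1 := (abs_le.1 (𝔑.inner_P_B_le a₁ _ hΔ)).1
  rw [map_sub, inner_sub_left] at h0 h1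
  have e0 := two_mul_inner_le (S.root (S.root a₀)) g₀
  have e1 := two_mul_inner_le (S.root (S.root a₁)) g₁
  set u₀ := S.root (S.root a₀)
  set u₁ := S.root (S.root a₁)
  have hθ12 : 0 ≤ θ₁ * θ₂ := mul_nonneg hθ₁ hθ₂
  -- As θ₁, θ₂ ≤ 1, the factor θ₁θ₂ is dominated by either weight; no weight is divided by, so the
  -- endpoint cases are included.
  have k1 : θ₁ * θ₂ * ‖u₀‖ ^ 2 ≤ θ₂ * ‖u₀‖ ^ 2 := by
    gcongr; nlinarith
  have k2 : θ₁ * θ₂ * ‖u₁‖ ^ 2 ≤ θ₁ * ‖u₁‖ ^ 2 := by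
    gcongr; nlinarith
  have k3 : θ₂ * ‖g₀‖ ^ 2 ≤ ‖g₀‖ ^ 2 := mul_le_of_le_one_left (sq_nonneg _) (by linarith)
  have k4 : θ₁ * ‖g₁‖ ^ 2 ≤ ‖g₁‖ ^ 2 := mul_le_of_le_one_left (sq_nonneg _) (by linarith)
  have k5 := mul_le_mul_of_nonneg_left h0 hθ12
  have k6 := mul_le_mul_of_nonneg_left h1 hθ12
  have k7 := mul_le_mul_of_nonneg_left e0 hθ₂
  have k8 := mul_le_mul_of_nonneg_left e1 hθ₁
  have k9 : 0 ≤ θ₂ * (ν * ‖S.root a₀‖ ^ 2) + θ₁ * (ν * ‖S.root a₁‖ ^ 2) := by positivity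
  have k10 := mul_le_mul_of_nonneg_left k1 (mul_nonneg hD hΔ0)
  have k11 := mul_le_mul_of_nonneg_left k2 (mul_nonneg hD hΔ0)
  linarith

/-- Without weights the coupling terms do not combine, but each is harmless once the low modes of
both components are bounded by Δ. The dissipation is kept, since its time integral is needed for the
enstrophy. -/
theorem energy_total (hθ₁ : 0 ≤ θ₁) (hθ₂ : 0 ≤ θ₂) (hθ : θ₁ + θ₂ = 1) (ν : ℝ)
    (a₀ a₁ g₀ g₁ : H) {Δ : ℝ} (hΔ₀ : ‖𝔑.P (S.root (S.root a₀))‖ ≤ Δ)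
    (hΔ₁ : ‖𝔑.P (S.root (S.root a₁))‖ ≤ Δ) :
    2 * inner ℝ (S.root (S.root a₀))
        (g₀ - 𝔑.B a₀ a₀ + θ₁ • 𝔑.P (𝔑.B a₀ a₀ - 𝔑.B a₁ a₁) - ν • a₀)
      + 2 * inner ℝ (S.root (S.root a₁))
        (g₁ - 𝔑.B a₁ a₁ + θ₂ • 𝔑.P (𝔑.B a₁ a₁ - 𝔑.B a₀ a₀) - ν • a₁)
      ≤ (1 + 2 * 𝔑.D * Δ) * (‖S.root (S.root a₀)‖ ^ 2 + ‖S.root (S.root a₁)‖ ^ 2)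
        + (‖g₀‖ ^ 2 + ‖g₁‖ ^ 2) - 2 * ν * (‖S.root a₀‖ ^ 2 + ‖S.root a₁‖ ^ 2) := by
  have hD := 𝔑.D_nonneg
  rw [𝔑.inner_self_force, 𝔑.inner_self_force]
  have e0 := two_mul_inner_le (S.root (S.root a₀)) g₀
  have e1 := two_mul_inner_le (S.root (S.root a₁)) g₁
  have h00 := (abs_le.1 (𝔑.inner_P_B_le a₀ _ hΔ₀)).2
  have h01 := (abs_le.1 (𝔑.inner_P_B_le a₁ _ hΔ₀)).1
  have h11 := (abs_le.1 (𝔑.inner_P_B_le a₁ _ hΔ₁)).2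
  have h10 := (abs_le.1 (𝔑.inner_P_B_le a₀ _ hΔ₁)).1
  set u₀ := S.root (S.root a₀)
  set u₁ := S.root (S.root a₁)
  have k0 := mul_le_mul_of_nonneg_left (sub_le_sub h00 h01) hθ₁
  have k1 := mul_le_mul_of_nonneg_left (sub_le_sub h11 h10) hθ₂
  have hθ₂' : θ₂ = 1 - θ₁ := by linarith
  subst hθ₂'
  linarith

/-- Young with exponents 4/3 and 4, obtained from two completed squares through the intermediate
product p²w². It is applied with p = ‖Au‖^{1/2}. -/
theorem young_three_halves {ν : ℝ} (hν : 0 < ν) (c p w : ℝ) :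
    2 * c * p ^ 3 * w ≤ ν * p ^ 4 + 2 * c ^ 4 * ν⁻¹ ^ 3 * w ^ 4 := by
  have h1 : ν / 2 * p ^ 4 + 2 * c ^ 2 * ν⁻¹ * (p ^ 2 * w ^ 2) - 2 * c * p ^ 3 * w
      = ν / 2 * (p ^ 2 - 2 * ν⁻¹ * c * p * w) ^ 2 := by field_simp; ring
  have h2 : ν / 2 * p ^ 4 + 2 * c ^ 4 * ν⁻¹ ^ 3 * w ^ 4 - 2 * c ^ 2 * ν⁻¹ * (p ^ 2 * w ^ 2)
      = ν / 2 * (p ^ 2 - 2 * c ^ 2 * ν⁻¹ ^ 2 * w ^ 2) ^ 2 := by field_simp; ring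
  have h3 : 0 ≤ ν / 2 * (p ^ 2 - 2 * ν⁻¹ * c * p * w) ^ 2 := by positivity
  have h4 : 0 ≤ ν / 2 * (p ^ 2 - 2 * c ^ 2 * ν⁻¹ ^ 2 * w ^ 2) ^ 2 := by positivity
  linarith

/-- Testing with Au yields the dissipation 2ν‖a‖²: one half absorbs the convection term, of order
‖a‖^{3/2}, the other the forcing and the projected terms, which are linear in ‖a‖ once the energy is
at most k. The first term is left as a product to be read as a Gronwall coefficient k‖A^{1/2}u‖²
times the enstrophy. -/
theorem enstrophy_component {θ ν k : ℝ} (hθ₀ : 0 ≤ θ) (hθ₁ : θ ≤ 1) (hν : 0 < ν) (a a' g : H)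
    (hk : ‖S.root (S.root a)‖ ^ 2 + ‖S.root (S.root a')‖ ^ 2 ≤ k) :
    2 * inner ℝ a (g - 𝔑.B a a + θ • 𝔑.P (𝔑.B a a - 𝔑.B a' a') - ν • a)
      ≤ 2 * 𝔑.C ^ 4 * ν⁻¹ ^ 3 * k * ‖S.root a‖ ^ 2 * ‖S.root a‖ ^ 2
        + 2 * ν⁻¹ * (‖g‖ ^ 2 + 𝔑.D ^ 2 * k ^ 2) := by
  have hD := 𝔑.D_nonneg
  have hC := 𝔑.C_nonneg
  have hν' : 0 < ν⁻¹ := inv_pos.2 hν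
  have hP : |inner ℝ a (𝔑.P (𝔑.B a a - 𝔑.B a' a'))| ≤ 𝔑.D * k * ‖a‖ := by
    rw [← 𝔑.inner_P_comm, real_inner_comm, inner_sub_left]
    have h1 := 𝔑.inner_B_P_le a a a
    have h2 := 𝔑.inner_B_P_le a' a' a
    have h3 := mul_le_mul_of_nonneg_left hk (mul_nonneg hD (norm_nonneg a))
    refine (abs_sub _ _).trans ?_
    linarith
  have hB : |inner ℝ a (𝔑.B a a)| ≤ 𝔑.C * (√‖S.root (S.root a)‖ * √‖a‖ * ‖S.root a‖) * ‖a‖ := by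
    rw [mul_comm _ ‖a‖]
    exact (abs_real_inner_le_norm _ _).trans (by gcongr; exact 𝔑.norm_B_le a a)
  have hy := young_three_halves hν 𝔑.C (√‖a‖) (√‖S.root (S.root a)‖ * ‖S.root a‖)
  have hp2 : √‖a‖ ^ 2 = ‖a‖ := Real.sq_sqrt (norm_nonneg _)
  have hp3 : √‖a‖ ^ 3 = ‖a‖ * √‖a‖ := by rw [pow_succ, hp2]
  have hp4 : √‖a‖ ^ 4 = ‖a‖ ^ 2 := by rw [show 4 = 2 * 2 from rfl, pow_mul, hp2]
  have hw4 : (√‖S.root (S.root a)‖ * ‖S.root a‖) ^ 4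
      = ‖S.root (S.root a)‖ ^ 2 * ‖S.root a‖ ^ 2 * ‖S.root a‖ ^ 2 := by
    rw [mul_pow, show 4 = 2 * 2 from rfl, pow_mul, Real.sq_sqrt (norm_nonneg _)]; ring
  rw [hp3, hp4, hw4] at hy
  have hk' : ‖S.root (S.root a)‖ ^ 2 ≤ k := le_trans (by linarith [sq_nonneg ‖S.root (S.root a')‖]) hk
  have hkk : 2 * 𝔑.C ^ 4 * ν⁻¹ ^ 3 * (‖S.root (S.root a)‖ ^ 2 * ‖S.root a‖ ^ 2 * ‖S.root a‖ ^ 2)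
      ≤ 2 * 𝔑.C ^ 4 * ν⁻¹ ^ 3 * (k * ‖S.root a‖ ^ 2 * ‖S.root a‖ ^ 2) := by gcongr
  have hg := real_inner_le_norm a g
  have hθP : θ * inner ℝ a (𝔑.P (𝔑.B a a - 𝔑.B a' a')) ≤ 𝔑.D * k * ‖a‖ := by
    refine (mul_le_mul_of_nonneg_left (le_abs_self _) hθ₀).trans ?_
    exact (mul_le_of_le_one_left (abs_nonneg _) hθ₁).trans hP
  have hB' := (abs_le.1 hB).1
  have hy2 : 2 * ‖a‖ * (‖g‖ + 𝔑.D * k) ≤ ν * ‖a‖ ^ 2 + 2 * ν⁻¹ * (‖g‖ ^ 2 + 𝔑.D ^ 2 * k ^ 2) := by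
    have h1 : ν * ‖a‖ ^ 2 + 2 * ν⁻¹ * (‖g‖ ^ 2 + 𝔑.D ^ 2 * k ^ 2) - 2 * ‖a‖ * (‖g‖ + 𝔑.D * k)
        = ν⁻¹ * ((ν * ‖a‖ - (‖g‖ + 𝔑.D * k)) ^ 2 + (‖g‖ - 𝔑.D * k) ^ 2) := by field_simp; ring
    have : 0 ≤ ν⁻¹ * ((ν * ‖a‖ - (‖g‖ + 𝔑.D * k)) ^ 2 + (‖g‖ - 𝔑.D * k) ^ 2) := by positivity
    linarith
  rw [inner_sub_right, inner_add_right, inner_sub_right, inner_smul_right, inner_smul_right,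
    real_inner_self_eq_norm_sq]
  linarith

end NonlinearData

end Abstract

end SyncNSE

/-! ### A priori bounds on a finite time interval. -/

namespace SyncNSE

open Set Filter Topology intervalIntegral

section Abstract

variable {ι H : Type*} [NormedAddCommGroup H] [InnerProductSpace ℝ H] {S : SpectralData ι H}

theorem _root_.ContinuousOn.memLp_two_Ioc {E : Type*} [NormedAddCommGroup E] {x : ℝ → E} {s T : ℝ}
    (hx : ContinuousOn x (Icc s T)) : MemLp x 2 (volume.restrict (Ioc s T)) := by
  rw [memLp_two_iff_integrable_sq_norm
    ((hx.mono Ioc_subset_Icc_self).aestronglyMeasurable measurableSet_Ioc)]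
  exact ((hx.norm.pow 2).integrableOn_Icc).mono_set Ioc_subset_Icc_self

theorem SpectralData.Traj.integrable_inner_map_root {x a d : ℝ → H} {s T : ℝ}
    (h : S.Traj s T x a d) (Q : H →L[ℝ] H) :
    Integrable (fun r => 2 * inner ℝ (Q (S.root (x r))) (Q (d r))) (volume.restrict (Ioc s T)) :=
  ((Q.comp_memLp' (S.root.comp_memLp' h.cont.memLp_two_Ioc)).integrable_inner_of_two
    (Q.comp_memLp' h.memLp_deriv)).const_mul 2

theorem SpectralData.Traj.norm_root_sq [CompleteSpace H] {x a d : ℝ → H} {s T : ℝ}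
    (h : S.Traj s T x a d) {t : ℝ} (ht : t ∈ Icc s T) :
    ‖S.root (x t)‖ ^ 2 = ‖S.root (x s)‖ ^ 2 + ∫ r in s..t, 2 * inner ℝ (S.root (x r)) (d r) :=
  h.norm_map_root_sq (ContinuousLinearMap.id ℝ H) ht

theorem SpectralData.Traj.integrable_inner_root {x a d : ℝ → H} {s T : ℝ}
    (h : S.Traj s T x a d) :
    Integrable (fun r => 2 * inner ℝ (S.root (x r)) (d r)) (volume.restrict (Ioc s T)) :=
  h.integrable_inner_map_root (ContinuousLinearMap.id ℝ H)

namespace NonlinearData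

variable {𝔑 : NonlinearData S} {θ₁ θ₂ ν T Γ : ℝ} {g x a : Fin 2 → ℝ → H}

theorem intervalIntegrable_norm_sq_add {E : Type*} [NormedAddCommGroup E] {g : Fin 2 → ℝ → E}
    (hT : 0 ≤ T)
    (hg : ∀ i, MemLp (g i) 2 (volume.restrict (Ioc 0 T))) :
    IntervalIntegrable (fun t => ‖g 0 t‖ ^ 2 + ‖g 1 t‖ ^ 2) volume 0 T :=
  Integrable.intervalIntegrable_sub (((hg 0).integrable_norm_pow (by norm_num)).add
    ((hg 1).integrable_norm_pow (by norm_num))) (left_mem_Icc.2 hT) (right_mem_Icc.2 hT)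

section APriori

variable [CompleteSpace H]

theorem IsSol.low_diff_bound (hν : 0 < ν) (hθ : θ₁ + θ₂ = 1)
    (h : 𝔑.IsSol ν (mutualMatrix θ₁ θ₂) g 0 T x a)
    (hg : ∀ i, MemLp (g i) 2 (volume.restrict (Ioc 0 T)))
    (hΓ : ∫ t in (0 : ℝ)..T, (‖g 0 t‖ ^ 2 + ‖g 1 t‖ ^ 2) ≤ Γ) {t : ℝ} (ht : t ∈ Icc 0 T) :
    ‖𝔑.P (S.root (x 0 t) - S.root (x 1 t))‖ ^ 2
      ≤ (‖𝔑.P (S.root (x 0 0) - S.root (x 1 0))‖ ^ 2 + 2 * Γ) * Real.exp T := by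
  have hT : 0 ≤ T := ht.1.trans ht.2
  have htr := (h 0).sub (h 1)
  have hn := intervalIntegrable_norm_sq_add hT hg
  have hΓ0 : 0 ≤ Γ := le_trans (integral_nonneg hT fun r _ => by positivity) hΓ
  have key := le_mul_exp_of_ae_le
    (y := fun t => ‖𝔑.P (S.root (x 0 t - x 1 t))‖ ^ 2) (m := fun _ => 1)
    (n := fun t => 2 * (‖g 0 t‖ ^ 2 + ‖g 1 t‖ ^ 2))
    ((𝔑.P.continuous.comp S.root.continuous).norm.pow 2 |>.comp_continuousOn htr.cont)
    ((htr.integrable_inner_map_root 𝔑.P).intervalIntegrable_sub (left_mem_Icc.2 hT)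
      (right_mem_Icc.2 hT)) intervalIntegrable_const (fun _ => zero_le_one) (hn.const_mul 2)
    (fun t => by positivity) (sq_nonneg _) (fun r hr => (htr.norm_map_root_sq 𝔑.P hr).le) ?_ ht
  · simp only [intervalIntegral.integral_const_mul, map_sub] at key ⊢
    refine key.trans ?_
    simp only [intervalIntegral.integral_const, sub_zero, smul_eq_mul, mul_one]
    gcongr
  · filter_upwards [(h 0).ae_eq, (h 1).ae_eq] with r h0 h1
    rw [𝔑.force_zero, 𝔑.force_one, h0, h1]
    have := 𝔑.energy_low_diff hθ hν (a 0 r) (a 1 r) (g 0 r) (g 1 r) (𝔑.B (a 0 r) (a 0 r))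
      (𝔑.B (a 1 r) (a 1 r))
    simp only [map_sub S.root, one_mul] at this ⊢
    exact this

theorem IsSol.weighted_bound (hν : 0 < ν) (hθ₁ : 0 ≤ θ₁) (hθ₂ : 0 ≤ θ₂) (hθ : θ₁ + θ₂ = 1)
    (h : 𝔑.IsSol ν (mutualMatrix θ₁ θ₂) g 0 T x a)
    (hg : ∀ i, MemLp (g i) 2 (volume.restrict (Ioc 0 T)))
    (hΓ : ∫ t in (0 : ℝ)..T, (‖g 0 t‖ ^ 2 + ‖g 1 t‖ ^ 2) ≤ Γ) {Δ : ℝ}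
    (hΔ : ∀ t ∈ Icc 0 T, ‖𝔑.P (S.root (x 0 t) - S.root (x 1 t))‖ ≤ Δ) {t : ℝ} (ht : t ∈ Icc 0 T) :
    θ₂ * ‖S.root (x 0 t)‖ ^ 2 + θ₁ * ‖S.root (x 1 t)‖ ^ 2
      ≤ (θ₂ * ‖S.root (x 0 0)‖ ^ 2 + θ₁ * ‖S.root (x 1 0)‖ ^ 2 + Γ)
        * Real.exp (T * (1 + 2 * 𝔑.D * Δ)) := by
  have hT : 0 ≤ T := ht.1.trans ht.2
  have hD := 𝔑.D_nonneg
  have hΔ0 : 0 ≤ Δ := (norm_nonneg _).trans (hΔ t ht)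
  have hn := intervalIntegrable_norm_sq_add hT hg
  have hΓ0 : 0 ≤ Γ := le_trans (integral_nonneg hT fun r _ => by positivity) hΓ
  have hc : ∀ i, ContinuousOn (fun t => ‖S.root (x i t)‖ ^ 2) (Icc 0 T) := fun i =>
    (S.root.continuous.norm.pow 2).comp_continuousOn (h i).cont
  have hi : ∀ i, ∀ r ∈ Icc 0 T, IntervalIntegrable (fun r => 2 * inner ℝ (S.root (x i r))
      (𝔑.force (mutualMatrix θ₁ θ₂) g a i r - ν • a i r)) volume 0 r := fun i r hr =>
    (h i).integrable_inner_root.intervalIntegrable_sub (left_mem_Icc.2 hT) hr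
  have key := le_mul_exp_of_ae_le
    (y := fun t => θ₂ * ‖S.root (x 0 t)‖ ^ 2 + θ₁ * ‖S.root (x 1 t)‖ ^ 2)
    (c := θ₂ * ‖S.root (x 0 0)‖ ^ 2 + θ₁ * ‖S.root (x 1 0)‖ ^ 2)
    (m := fun _ => 1 + 2 * 𝔑.D * Δ)
    (n := fun t => ‖g 0 t‖ ^ 2 + ‖g 1 t‖ ^ 2)
    ((continuousOn_const.mul (hc 0)).add (continuousOn_const.mul (hc 1)))
    (((hi 0 T (right_mem_Icc.2 hT)).const_mul θ₂).add ((hi 1 T (right_mem_Icc.2 hT)).const_mul θ₁))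
    intervalIntegrable_const (fun _ => by positivity) hn
    (fun t => by positivity) (by positivity) (fun r hr => ?_) ?_ ht
  · refine key.trans ?_
    simp only [intervalIntegral.integral_const, sub_zero, smul_eq_mul]
    gcongr
  · rw [(h 0).norm_root_sq hr, (h 1).norm_root_sq hr,
      integral_add ((hi 0 r hr).const_mul θ₂) ((hi 1 r hr).const_mul θ₁),
      intervalIntegral.integral_const_mul θ₂, intervalIntegral.integral_const_mul θ₁]
    linarith
  · filter_upwards [(h 0).ae_eq, (h 1).ae_eq, ae_restrict_mem measurableSet_Ioc] with r h0 h1 hr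
    have hΔr := hΔ r (Ioc_subset_Icc_self hr)
    rw [h0, h1] at hΔr
    rw [𝔑.force_zero, 𝔑.force_one, h0, h1]
    exact 𝔑.energy_weighted hθ₁ hθ₂ hθ hν (a 0 r) (a 1 r) (g 0 r) (g 1 r) hΔr

theorem IsSol.energy_bound (hν : 0 < ν) (hθ₁ : 0 ≤ θ₁) (hθ₂ : 0 ≤ θ₂) (hθ : θ₁ + θ₂ = 1)
    (hT : 0 ≤ T) (h : 𝔑.IsSol ν (mutualMatrix θ₁ θ₂) g 0 T x a)
    (hg : ∀ i, MemLp (g i) 2 (volume.restrict (Ioc 0 T)))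
    (hΓ : ∫ t in (0 : ℝ)..T, (‖g 0 t‖ ^ 2 + ‖g 1 t‖ ^ 2) ≤ Γ) {Δ : ℝ}
    (hΔ : ∀ i, ∀ t ∈ Icc 0 T, ‖𝔑.P (S.root (x i t))‖ ≤ Δ) {k : ℝ}
    (hk : k = (‖S.root (x 0 0)‖ ^ 2 + ‖S.root (x 1 0)‖ ^ 2 + Γ)
        * Real.exp (T * (1 + 2 * 𝔑.D * Δ))) :
    (∀ t ∈ Icc 0 T, ‖S.root (x 0 t)‖ ^ 2 + ‖S.root (x 1 t)‖ ^ 2 ≤ k) ∧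
      2 * ν * ∫ t in (0 : ℝ)..T, (‖x 0 t‖ ^ 2 + ‖x 1 t‖ ^ 2)
        ≤ ‖S.root (x 0 0)‖ ^ 2 + ‖S.root (x 1 0)‖ ^ 2 + Γ + T * ((1 + 2 * 𝔑.D * Δ) * k) := by
  have hD := 𝔑.D_nonneg
  have h0T := left_mem_Icc.2 hT
  have hTT := right_mem_Icc.2 hT
  have hΔ0 : 0 ≤ Δ := (norm_nonneg _).trans (hΔ 0 0 h0T)
  have hn := intervalIntegrable_norm_sq_add hT hg
  have hΓ0 : 0 ≤ Γ := le_trans (integral_nonneg hT fun r _ => by positivity) hΓ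
  have hc : ∀ i, ContinuousOn (fun t => ‖S.root (x i t)‖ ^ 2) (Icc 0 T) := fun i =>
    (S.root.continuous.norm.pow 2).comp_continuousOn (h i).cont
  have hi : ∀ i, ∀ r ∈ Icc 0 T, IntervalIntegrable (fun r => 2 * inner ℝ (S.root (x i r))
      (𝔑.force (mutualMatrix θ₁ θ₂) g a i r - ν • a i r)) volume 0 r := fun i r hr =>
    (h i).integrable_inner_root.intervalIntegrable_sub h0T hr
  have hx2 : IntervalIntegrable (fun t => ‖x 0 t‖ ^ 2 + ‖x 1 t‖ ^ 2) volume 0 T := by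
    refine ContinuousOn.intervalIntegrable ?_
    rw [uIcc_of_le hT]
    exact ((h 0).cont.norm.pow 2).add ((h 1).cont.norm.pow 2)
  have hsum : ∀ r ∈ Icc 0 T, ‖S.root (x 0 r)‖ ^ 2 + ‖S.root (x 1 r)‖ ^ 2
      = ‖S.root (x 0 0)‖ ^ 2 + ‖S.root (x 1 0)‖ ^ 2 + ∫ q in (0 : ℝ)..r,
        (2 * inner ℝ (S.root (x 0 q)) (𝔑.force (mutualMatrix θ₁ θ₂) g a 0 q - ν • a 0 q)
        + 2 * inner ℝ (S.root (x 1 q)) (𝔑.force (mutualMatrix θ₁ θ₂) g a 1 q - ν • a 1 q)) := by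
    intro r hr
    rw [(h 0).norm_root_sq hr, (h 1).norm_root_sq hr, integral_add (hi 0 r hr) (hi 1 r hr)]
    ring
  have hle : ∀ᵐ r ∂volume.restrict (Ioc 0 T),
      2 * inner ℝ (S.root (x 0 r)) (𝔑.force (mutualMatrix θ₁ θ₂) g a 0 r - ν • a 0 r)
        + 2 * inner ℝ (S.root (x 1 r)) (𝔑.force (mutualMatrix θ₁ θ₂) g a 1 r - ν • a 1 r)
      ≤ (1 + 2 * 𝔑.D * Δ) * (‖S.root (x 0 r)‖ ^ 2 + ‖S.root (x 1 r)‖ ^ 2)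
        + (‖g 0 r‖ ^ 2 + ‖g 1 r‖ ^ 2) - 2 * ν * (‖x 0 r‖ ^ 2 + ‖x 1 r‖ ^ 2) := by
    filter_upwards [(h 0).ae_eq, (h 1).ae_eq, ae_restrict_mem measurableSet_Ioc] with r h0 h1 hr
    have hΔ₀ := hΔ 0 r (Ioc_subset_Icc_self hr)
    have hΔ₁ := hΔ 1 r (Ioc_subset_Icc_self hr)
    rw [h0] at hΔ₀
    rw [h1] at hΔ₁
    rw [𝔑.force_zero, 𝔑.force_one, h0, h1]
    exact 𝔑.energy_total hθ₁ hθ₂ hθ ν (a 0 r) (a 1 r) (g 0 r) (g 1 r) hΔ₀ hΔ₁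
  have hψ := (hi 0 T hTT).add (hi 1 T hTT)
  have hbound : ∀ t ∈ Icc 0 T, ‖S.root (x 0 t)‖ ^ 2 + ‖S.root (x 1 t)‖ ^ 2 ≤ k := by
    intro t ht
    have key := le_mul_exp_of_ae_le
      (y := fun t => ‖S.root (x 0 t)‖ ^ 2 + ‖S.root (x 1 t)‖ ^ 2)
      (c := ‖S.root (x 0 0)‖ ^ 2 + ‖S.root (x 1 0)‖ ^ 2)
      (m := fun _ => 1 + 2 * 𝔑.D * Δ)
      (n := fun t => ‖g 0 t‖ ^ 2 + ‖g 1 t‖ ^ 2)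
      ((hc 0).add (hc 1)) hψ intervalIntegrable_const (fun _ => by positivity) hn
      (fun t => by positivity) (by positivity) (fun r hr => (hsum r hr).le) ?_ ht
    · refine key.trans ?_
      simp only [intervalIntegral.integral_const, sub_zero, smul_eq_mul, hk]
      gcongr
    · filter_upwards [hle] with r hr
      have : 0 ≤ 2 * ν * (‖x 0 r‖ ^ 2 + ‖x 1 r‖ ^ 2) := by positivity
      linarith
  refine ⟨hbound, ?_⟩
  -- With the energy now bounded by k, the same inequality is integrated again, this time without
  -- discarding the dissipation.
  have hmono : ∫ q in (0 : ℝ)..T,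
        (2 * inner ℝ (S.root (x 0 q)) (𝔑.force (mutualMatrix θ₁ θ₂) g a 0 q - ν • a 0 q)
        + 2 * inner ℝ (S.root (x 1 q)) (𝔑.force (mutualMatrix θ₁ θ₂) g a 1 q - ν • a 1 q))
      ≤ ∫ q in (0 : ℝ)..T, ((1 + 2 * 𝔑.D * Δ) * k + (‖g 0 q‖ ^ 2 + ‖g 1 q‖ ^ 2)
        - 2 * ν * (‖x 0 q‖ ^ 2 + ‖x 1 q‖ ^ 2)) := by
    refine integral_mono_ae_restrict hT hψ
      ((intervalIntegrable_const.add hn).sub (hx2.const_mul _)) ?_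
    rw [← restrict_Ioc_eq_restrict_Icc]
    filter_upwards [hle, ae_restrict_mem measurableSet_Ioc] with r hr hrm
    refine hr.trans ?_
    have := hbound r (Ioc_subset_Icc_self hrm)
    gcongr
  rw [integral_sub (intervalIntegrable_const.add hn) (hx2.const_mul _),
    integral_add intervalIntegrable_const hn, intervalIntegral.integral_const_mul (2 * ν),
    intervalIntegral.integral_const, sub_zero, smul_eq_mul] at hmono
  have h1 := hsum T hTT
  have h2 : 0 ≤ ‖S.root (x 0 T)‖ ^ 2 + ‖S.root (x 1 T)‖ ^ 2 := by positivity
  linarith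

/-- The Gronwall coefficient is proportional to the enstrophy itself; its integral is finite by the
dissipation bound k', which closes the planar argument. -/
theorem IsSol.enstrophy_bound [Countable ι] (hν : 0 < ν) (hθ₁ : 0 ≤ θ₁) (hθ₂ : 0 ≤ θ₂)
    (hθ : θ₁ + θ₂ = 1) (hT : 0 ≤ T) (h : 𝔑.IsSol ν (mutualMatrix θ₁ θ₂) g 0 T x a)
    (hg : ∀ i, MemLp (g i) 2 (volume.restrict (Ioc 0 T)))
    (hΓ : ∫ t in (0 : ℝ)..T, (‖g 0 t‖ ^ 2 + ‖g 1 t‖ ^ 2) ≤ Γ) {k k' : ℝ}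
    (hk : ∀ t ∈ Icc 0 T, ‖S.root (x 0 t)‖ ^ 2 + ‖S.root (x 1 t)‖ ^ 2 ≤ k)
    (hk' : ∫ t in (0 : ℝ)..T, (‖x 0 t‖ ^ 2 + ‖x 1 t‖ ^ 2) ≤ k') {t : ℝ} (ht : t ∈ Icc 0 T) :
    ‖x 0 t‖ ^ 2 + ‖x 1 t‖ ^ 2 ≤ (‖x 0 0‖ ^ 2 + ‖x 1 0‖ ^ 2
      + (2 * ν⁻¹ * Γ + T * (4 * ν⁻¹ * (𝔑.D ^ 2 * k ^ 2))))
      * Real.exp (2 * 𝔑.C ^ 4 * ν⁻¹ ^ 3 * k * k') := by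
  have hD := 𝔑.D_nonneg
  have hC := 𝔑.C_nonneg
  have h0T := left_mem_Icc.2 hT
  have hTT := right_mem_Icc.2 hT
  have hk0 : 0 ≤ k := le_trans (by positivity) (hk 0 h0T)
  have hν' : 0 < ν⁻¹ := inv_pos.2 hν
  have hn := intervalIntegrable_norm_sq_add hT hg
  have hΓ0 : 0 ≤ Γ := le_trans (integral_nonneg hT fun r _ => by positivity) hΓ
  have hi : ∀ i, ∀ r ∈ Icc 0 T, IntervalIntegrable (fun r => 2 * inner ℝ (a i r)
      (𝔑.force (mutualMatrix θ₁ θ₂) g a i r - ν • a i r)) volume 0 r := fun i r hr =>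
    ((h i).integrable_inner.const_mul 2).intervalIntegrable_sub h0T hr
  have hxc : ContinuousOn (fun t => ‖x 0 t‖ ^ 2 + ‖x 1 t‖ ^ 2) (Icc 0 T) :=
    ((h 0).cont.norm.pow 2).add ((h 1).cont.norm.pow 2)
  have hx2 : IntervalIntegrable (fun t => ‖x 0 t‖ ^ 2 + ‖x 1 t‖ ^ 2) volume 0 T := by
    refine ContinuousOn.intervalIntegrable ?_
    rwa [uIcc_of_le hT]
  have key := le_mul_exp_of_ae_le
    (y := fun t => ‖x 0 t‖ ^ 2 + ‖x 1 t‖ ^ 2) (c := ‖x 0 0‖ ^ 2 + ‖x 1 0‖ ^ 2)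
    (m := fun r => 2 * 𝔑.C ^ 4 * ν⁻¹ ^ 3 * k * (‖x 0 r‖ ^ 2 + ‖x 1 r‖ ^ 2))
    (n := fun t => 2 * ν⁻¹ * (‖g 0 t‖ ^ 2 + ‖g 1 t‖ ^ 2) + 4 * ν⁻¹ * (𝔑.D ^ 2 * k ^ 2))
    hxc ((hi 0 T hTT).add (hi 1 T hTT)) (hx2.const_mul _) (fun _ => by positivity)
    ((hn.const_mul _).add intervalIntegrable_const) (fun t => by positivity) (by positivity)
    (fun r hr => ?_) ?_ ht
  · refine key.trans ?_
    rw [integral_add (hn.const_mul _) intervalIntegrable_const,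
      intervalIntegral.integral_const_mul (2 * ν⁻¹),
      intervalIntegral.integral_const_mul (2 * 𝔑.C ^ 4 * ν⁻¹ ^ 3 * k), intervalIntegral.integral_const, sub_zero, smul_eq_mul]
    gcongr
  · rw [(h 0).norm_sq hr, (h 1).norm_sq hr, integral_add (hi 0 r hr) (hi 1 r hr)]
    linarith
  · filter_upwards [(h 0).ae_eq, (h 1).ae_eq, ae_restrict_mem measurableSet_Ioc] with r h0 h1 hr
    have hkr := hk r (Ioc_subset_Icc_self hr)
    rw [h0, h1] at hkr
    rw [𝔑.force_zero, 𝔑.force_one, h0, h1]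
    have e0 := 𝔑.enstrophy_component hθ₁ (by linarith) hν (a 0 r) (a 1 r) (g 0 r) hkr
    have e1 := 𝔑.enstrophy_component hθ₂ (by linarith) hν (a 1 r) (a 0 r) (g 1 r)
      (k := k) (by rwa [add_comm])
    -- The mixed term completes the sum of the two squared enstrophies to the square of the total.
    have e2 : 0 ≤ 2 * 𝔑.C ^ 4 * ν⁻¹ ^ 3 * k * (2 * (‖S.root (a 0 r)‖ ^ 2 * ‖S.root (a 1 r)‖ ^ 2)) := by
      positivity
    linarith

/-- The a priori bound in `V`: the constant depends only on the data and on the final time. -/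
theorem exists_apriori_bound [Countable ι] (𝔑 : NonlinearData S) (hν : 0 < ν) (hθ₁ : 0 ≤ θ₁)
    (hθ₂ : 0 ≤ θ₂) (hθ : θ₁ + θ₂ = 1) (hT : 0 ≤ T)
    (hg : ∀ i, MemLp (g i) 2 (volume.restrict (Ioc 0 T))) (x₀ : Fin 2 → H) :
    ∃ K, 0 ≤ K ∧ ∀ T' ∈ Icc 0 T, ∀ x a : Fin 2 → ℝ → H, (∀ i, x i 0 = x₀ i) →
      𝔑.IsSol ν (mutualMatrix θ₁ θ₂) g 0 T' x a → ∀ i, ∀ t ∈ Icc 0 T', ‖x i t‖ ≤ K := by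
  have hD := 𝔑.D_nonneg
  have hC := 𝔑.C_nonneg
  have hν' : 0 < ν⁻¹ := inv_pos.2 hν
  set Γ : ℝ := ∫ t in (0 : ℝ)..T, (‖g 0 t‖ ^ 2 + ‖g 1 t‖ ^ 2) with hΓ
  have hΓ0 : 0 ≤ Γ := integral_nonneg hT fun r _ => by positivity
  -- All constants are formed at the final time T. They are monotone in time, so they serve every T'
  -- ≤ T, as the continuation argument requires.
  set Δ : ℝ := √((‖𝔑.P (S.root (x₀ 0) - S.root (x₀ 1))‖ ^ 2 + 2 * Γ) * Real.exp T) with hΔ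
  set E : ℝ := (θ₂ * ‖S.root (x₀ 0)‖ ^ 2 + θ₁ * ‖S.root (x₀ 1)‖ ^ 2 + Γ)
        * Real.exp (T * (1 + 2 * 𝔑.D * Δ)) with hE
  have hΔ0 : 0 ≤ Δ := Real.sqrt_nonneg _
  set Δ' : ℝ := √E + Δ with hΔ'
  have hΔ'0 : 0 ≤ Δ' := by positivity
  set Y₀ : ℝ := ‖S.root (x₀ 0)‖ ^ 2 + ‖S.root (x₀ 1)‖ ^ 2 with hY₀
  set k : ℝ := (Y₀ + Γ) * Real.exp (T * (1 + 2 * 𝔑.D * Δ')) with hk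
  set k' : ℝ := (2 * ν)⁻¹ * (Y₀ + Γ + T * ((1 + 2 * 𝔑.D * Δ') * k)) with hk'
  have hk0 : 0 ≤ k := by positivity
  refine ⟨√((‖x₀ 0‖ ^ 2 + ‖x₀ 1‖ ^ 2 + (2 * ν⁻¹ * Γ + T * (4 * ν⁻¹ * (𝔑.D ^ 2 * k ^ 2))))
      * Real.exp (2 * 𝔑.C ^ 4 * ν⁻¹ ^ 3 * k * k')), Real.sqrt_nonneg _, ?_⟩
  intro T' hT' x a hx h i t ht
  have hgT : ∀ i, MemLp (g i) 2 (volume.restrict (Ioc 0 T')) := fun i =>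
    (hg i).mono_measure (Measure.restrict_mono (Ioc_subset_Ioc_right hT'.2) le_rfl)
  have hΓT : ∫ t in (0 : ℝ)..T', (‖g 0 t‖ ^ 2 + ‖g 1 t‖ ^ 2) ≤ Γ :=
    integral_mono_interval le_rfl hT'.1 hT'.2 (Eventually.of_forall fun r => by positivity)
      (intervalIntegrable_norm_sq_add hT hg)
  have hlow : ∀ t ∈ Icc 0 T', ‖𝔑.P (S.root (x 0 t) - S.root (x 1 t))‖ ≤ Δ := by
    intro t ht
    refine Real.le_sqrt_of_sq_le ((h.low_diff_bound hν hθ hgT hΓT ht).trans ?_)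
    rw [hx, hx]
    gcongr
    exact hT'.2
  have hwt : ∀ t ∈ Icc 0 T', θ₂ * ‖S.root (x 0 t)‖ ^ 2 + θ₁ * ‖S.root (x 1 t)‖ ^ 2 ≤ E := by
    intro t ht
    refine (h.weighted_bound hν hθ₁ hθ₂ hθ hgT hΓT hlow ht).trans ?_
    rw [hx, hx, hE]
    gcongr
    exact hT'.2
  have hPx : ∀ i, ∀ t ∈ Icc 0 T', ‖𝔑.P (S.root (x i t))‖ ≤ Δ' := by
    intro i t ht
    -- Convexity of the square: the weighted mean is controlled by the weighted energy.
    have h1 : ‖𝔑.P (θ₂ • S.root (x 0 t) + θ₁ • S.root (x 1 t))‖ ≤ √E := by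
      refine (𝔑.norm_P_le _).trans (Real.le_sqrt_of_sq_le ((?_ : _ ≤ _).trans (hwt t ht)))
      have h2 : ‖θ₂ • S.root (x 0 t) + θ₁ • S.root (x 1 t)‖
          ≤ θ₂ * ‖S.root (x 0 t)‖ + θ₁ * ‖S.root (x 1 t)‖ := by
        refine (norm_add_le _ _).trans ?_
        rw [norm_smul, norm_smul, Real.norm_of_nonneg hθ₁, Real.norm_of_nonneg hθ₂]
      have h3 : ‖θ₂ • S.root (x 0 t) + θ₁ • S.root (x 1 t)‖ ^ 2
          ≤ (θ₂ * ‖S.root (x 0 t)‖ + θ₁ * ‖S.root (x 1 t)‖) ^ 2 := by gcongr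
      have h4 : θ₂ * ‖S.root (x 0 t)‖ ^ 2 + θ₁ * ‖S.root (x 1 t)‖ ^ 2
          - (θ₂ * ‖S.root (x 0 t)‖ + θ₁ * ‖S.root (x 1 t)‖) ^ 2
          = θ₁ * θ₂ * (‖S.root (x 0 t)‖ - ‖S.root (x 1 t)‖) ^ 2 := by
        have : θ₂ = 1 - θ₁ := by linarith
        subst this
        ring
      have h5 : 0 ≤ θ₁ * θ₂ * (‖S.root (x 0 t)‖ - ‖S.root (x 1 t)‖) ^ 2 := by positivity
      linarith
    have hd := hlow t ht
    -- With w = θ₂u₀ + θ₁u₁, one has u₀ = w + θ₁(u₀ - u₁) and u₁ = w - θ₂(u₀ - u₁). This bounds the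
    -- low modes of both components, even when a weight is zero.
    have hcase : ∃ c : ℝ, |c| ≤ 1 ∧ 𝔑.P (S.root (x i t))
        = 𝔑.P (θ₂ • S.root (x 0 t) + θ₁ • S.root (x 1 t))
          + c • 𝔑.P (S.root (x 0 t) - S.root (x 1 t)) := by
      have hθ₂' : θ₂ = 1 - θ₁ := by linarith
      fin_cases i
      · refine ⟨θ₁, abs_le.2 ⟨by linarith, by linarith⟩, ?_⟩
        simp only [hθ₂', map_add, map_smul, map_sub, Fin.zero_eta]
        module
      · refine ⟨-θ₂, abs_le.2 ⟨by linarith, by linarith⟩, ?_⟩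
        simp only [hθ₂', map_add, map_smul, map_sub, Fin.mk_one]
        module
    obtain ⟨c, hc, hceq⟩ := hcase
    rw [hceq]
    refine (norm_add_le _ _).trans (add_le_add h1 ?_)
    rw [norm_smul, Real.norm_eq_abs]
    exact (mul_le_of_le_one_left (norm_nonneg _) hc).trans hd
  obtain ⟨hY, hI⟩ := h.energy_bound hν hθ₁ hθ₂ hθ hT'.1 hgT hΓT hPx rfl
  rw [hx, hx, ← hY₀] at hY hI
  have hkT : (Y₀ + Γ) * Real.exp (T' * (1 + 2 * 𝔑.D * Δ')) ≤ k := by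
    rw [hk]; gcongr; exact hT'.2
  have hYk : ∀ t ∈ Icc 0 T', ‖S.root (x 0 t)‖ ^ 2 + ‖S.root (x 1 t)‖ ^ 2 ≤ k := fun t ht =>
    (hY t ht).trans hkT
  have hIk : ∫ t in (0 : ℝ)..T', (‖x 0 t‖ ^ 2 + ‖x 1 t‖ ^ 2) ≤ k' := by
    rw [hk', le_inv_mul_iff₀ (by positivity)]
    refine hI.trans ?_
    have hT'0 := hT'.1
    have hT'2 := hT'.2
    gcongr
  have hV := h.enstrophy_bound hν hθ₁ hθ₂ hθ hT'.1 hgT hΓT hYk hIk ht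
  rw [hx, hx] at hV
  refine Real.le_sqrt_of_sq_le (le_trans ?_ (hV.trans ?_))
  · fin_cases i
    · simp only [Fin.zero_eta]; linarith [sq_nonneg ‖x 1 t‖]
    · simp only [Fin.mk_one]; linarith [sq_nonneg ‖x 0 t‖]
  · have hT'2 := hT'.2
    gcongr

end APriori

end NonlinearData

end Abstract

end SyncNSE

/-! ### Uniqueness and existence on an arbitrary time interval. -/

namespace SyncNSE

open Set Filter Topology intervalIntegral

section Abstract

variable {ι H : Type*} [NormedAddCommGroup H] [InnerProductSpace ℝ H] {S : SpectralData ι H}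

namespace NonlinearData

variable {ν s T : ℝ} {M : Matrix (Fin 2) (Fin 2) ℝ} {g x a x' a' : Fin 2 → ℝ → H}

/-- When the difference is the transporting field, half a power of A(u - u') enters, which the
dissipation absorbs later. When it is transported, only its `V` norm enters, against ‖a'‖, which is
integrable in time. -/
theorem norm_B_sub_sq_le (𝔑 : NonlinearData S) (a a' : H) {R : ℝ} (hR : ‖S.root a‖ ≤ R)
    (hR' : ‖S.root a'‖ ≤ R) :
    ‖𝔑.B a a - 𝔑.B a' a'‖ ^ 2 ≤ 2 * 𝔑.C ^ 2 * (R ^ 2 * ‖S.root (a - a')‖ * ‖a - a'‖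
      + R * ‖a'‖ * ‖S.root (a - a')‖ ^ 2) := by
  have hC := 𝔑.C_nonneg
  have hR0 : 0 ≤ R := (norm_nonneg _).trans hR
  have h1 : 𝔑.B a a - 𝔑.B a' a' = 𝔑.B (a - a') a + 𝔑.B a' (a - a') := by
    simp only [map_sub, sub_apply]; abel
  have h2 : ‖𝔑.B (a - a') a‖ ^ 2 ≤ 𝔑.C ^ 2 * (R ^ 2 * ‖S.root (a - a')‖ * ‖a - a'‖) := by
    calc ‖𝔑.B (a - a') a‖ ^ 2
        ≤ (𝔑.C * (√‖S.root (S.root (a - a'))‖ * √‖a - a'‖ * ‖S.root a‖)) ^ 2 := by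
          gcongr; exact 𝔑.norm_B_le _ _
      _ = 𝔑.C ^ 2 * (‖S.root a‖ ^ 2 * ‖S.root (S.root (a - a'))‖ * ‖a - a'‖) := by
          rw [mul_pow, mul_pow, mul_pow, Real.sq_sqrt (norm_nonneg _),
            Real.sq_sqrt (norm_nonneg _)]; ring
      _ ≤ _ := by gcongr; exact S.norm_root_le _
  have h3 : ‖𝔑.B a' (a - a')‖ ^ 2 ≤ 𝔑.C ^ 2 * (R * ‖a'‖ * ‖S.root (a - a')‖ ^ 2) := by
    calc ‖𝔑.B a' (a - a')‖ ^ 2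
        ≤ (𝔑.C * (√‖S.root (S.root a')‖ * √‖a'‖ * ‖S.root (a - a')‖)) ^ 2 := by
          gcongr; exact 𝔑.norm_B_le _ _
      _ = 𝔑.C ^ 2 * (‖S.root (S.root a')‖ * ‖a'‖ * ‖S.root (a - a')‖ ^ 2) := by
          rw [mul_pow, mul_pow, mul_pow, Real.sq_sqrt (norm_nonneg _),
            Real.sq_sqrt (norm_nonneg _)]
      _ ≤ _ := by gcongr; exact (S.norm_root_le _).trans hR'
  have h4 : ‖𝔑.B (a - a') a + 𝔑.B a' (a - a')‖ ^ 2
      ≤ 2 * (‖𝔑.B (a - a') a‖ ^ 2 + ‖𝔑.B a' (a - a')‖ ^ 2) := by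
    have := norm_sub_sq_le_two_mul (𝔑.B (a - a') a) (-𝔑.B a' (a - a'))
    rwa [sub_neg_eq_add, norm_neg] at this
  rw [h1]
  linarith

/-- The differential inequality for the difference of two solutions. -/
theorem diff_estimate (𝔑 : NonlinearData S) (hν : 0 < ν) (g a a' : Fin 2 → ℝ → H) (t : ℝ)
    {R m c : ℝ} (hm : ∀ i, ∑ j, |M i j| ≤ m) (hm0 : 0 ≤ m) (hR : ∀ i, ‖S.root (a i t)‖ ≤ R)
    (hR' : ∀ i, ‖S.root (a' i t)‖ ≤ R) (hc : c = 8 * (1 + m) ^ 2 * 𝔑.C ^ 2 * ν⁻¹) :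
    ∑ i, 2 * inner ℝ (a i t - a' i t) ((𝔑.force M g a i t - ν • a i t)
        - (𝔑.force M g a' i t - ν • a' i t))
      ≤ (c ^ 2 * R ^ 4 * ν⁻¹ + c * R * (‖a' 0 t‖ + ‖a' 1 t‖))
        * (‖S.root (a 0 t - a' 0 t)‖ ^ 2 + ‖S.root (a 1 t - a' 1 t)‖ ^ 2) := by
  have hC := 𝔑.C_nonneg
  have hν' : 0 < ν⁻¹ := inv_pos.2 hν
  have hR0 : 0 ≤ R := (norm_nonneg _).trans (hR 0)
  have hc0 : 0 ≤ c := by rw [hc]; positivity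
  set w : Fin 2 → H := fun j => 𝔑.B (a j t) (a j t) - 𝔑.B (a' j t) (a' j t) with hw
  set β : ℝ := ‖w 0‖ + ‖w 1‖ with hβ
  have hwβ : ∀ j, ‖w j‖ ≤ β := by
    intro j
    fin_cases j
    · exact le_add_of_nonneg_right (norm_nonneg _)
    · exact le_add_of_nonneg_left (norm_nonneg _)
  have hβ0 : 0 ≤ β := by positivity
  have hforce : ∀ i, (𝔑.force M g a i t - ν • a i t) - (𝔑.force M g a' i t - ν • a' i t)
      = (-w i + ∑ j, M i j • 𝔑.P (w j)) - ν • (a i t - a' i t) := by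
    intro i
    simp only [force, hw, map_sub, smul_sub, Finset.sum_sub_distrib]
    abel
  have hnorm : ∀ i, ‖-w i + ∑ j, M i j • 𝔑.P (w j)‖ ≤ (1 + m) * β := by
    intro i
    have : ‖∑ j, M i j • 𝔑.P (w j)‖ ≤ m * β := by
      refine (norm_sum_le _ _).trans ?_
      refine (Finset.sum_le_sum fun j _ => ?_).trans
        ((Finset.sum_mul _ _ _).symm.le.trans (mul_le_mul_of_nonneg_right (hm i) hβ0))
      rw [norm_smul, Real.norm_eq_abs]
      exact mul_le_mul_of_nonneg_left ((𝔑.norm_P_le _).trans (hwβ j)) (abs_nonneg _)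
    refine (norm_add_le _ _).trans ?_
    rw [norm_neg]
    linarith [hwβ i]
  have hcomp : ∀ i, 2 * inner ℝ (a i t - a' i t) ((𝔑.force M g a i t - ν • a i t)
        - (𝔑.force M g a' i t - ν • a' i t))
      ≤ -ν * ‖a i t - a' i t‖ ^ 2 + ν⁻¹ * ((1 + m) * β) ^ 2 := by
    intro i
    rw [hforce, inner_sub_right, inner_smul_right, real_inner_self_eq_norm_sq]
    have h1 := (real_inner_le_norm (a i t - a' i t) (-w i + ∑ j, M i j • 𝔑.P (w j))).trans
      (mul_le_mul_of_nonneg_left (hnorm i) (norm_nonneg _))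
    have h2 : ν * ‖a i t - a' i t‖ ^ 2 + ν⁻¹ * ((1 + m) * β) ^ 2
        - 2 * (‖a i t - a' i t‖ * ((1 + m) * β))
        = ν⁻¹ * (ν * ‖a i t - a' i t‖ - (1 + m) * β) ^ 2 := by field_simp; ring
    have h3 : 0 ≤ ν⁻¹ * (ν * ‖a i t - a' i t‖ - (1 + m) * β) ^ 2 := by positivity
    linarith
  have hβ2 : β ^ 2 ≤ 2 * (‖w 0‖ ^ 2 + ‖w 1‖ ^ 2) := by
    nlinarith [sq_nonneg (‖w 0‖ - ‖w 1‖)]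
  have hw0 := 𝔑.norm_B_sub_sq_le (a 0 t) (a' 0 t) (hR 0) (hR' 0)
  have hw1 := 𝔑.norm_B_sub_sq_le (a 1 t) (a' 1 t) (hR 1) (hR' 1)
  rw [Fin.sum_univ_two]
  set y₀ := ‖S.root (a 0 t - a' 0 t)‖
  set y₁ := ‖S.root (a 1 t - a' 1 t)‖
  set b₀ := ‖a 0 t - a' 0 t‖
  set b₁ := ‖a 1 t - a' 1 t‖
  have hy₀ : 0 ≤ y₀ := norm_nonneg _
  have hy₁ : 0 ≤ y₁ := norm_nonneg _
  have hb₀ : 0 ≤ b₀ := norm_nonneg _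
  have hb₁ : 0 ≤ b₁ := norm_nonneg _
  have hsum : 2 * (ν⁻¹ * ((1 + m) * β) ^ 2)
      ≤ c * ((R ^ 2 * y₀ * b₀ + R * ‖a' 0 t‖ * y₀ ^ 2) + (R ^ 2 * y₁ * b₁ + R * ‖a' 1 t‖ * y₁ ^ 2)) := by
    have h1 : β ^ 2 ≤ 4 * 𝔑.C ^ 2 * ((R ^ 2 * y₀ * b₀ + R * ‖a' 0 t‖ * y₀ ^ 2)
        + (R ^ 2 * y₁ * b₁ + R * ‖a' 1 t‖ * y₁ ^ 2)) := by linarith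
    have h2 := mul_le_mul_of_nonneg_left h1 (by positivity : 0 ≤ 2 * ν⁻¹ * (1 + m) ^ 2)
    rw [hc]
    linarith
  -- Here b stands for ‖A(u - u')‖ in one component; the dissipation left over in `hcomp` is exactly
  -- νb².
  have hyoung : ∀ y b : ℝ, c * (R ^ 2 * y * b) ≤ ν * b ^ 2 + c ^ 2 * R ^ 4 * ν⁻¹ * y ^ 2 := by
    intro y b
    have h1 : ν * b ^ 2 + c ^ 2 * R ^ 4 * ν⁻¹ * y ^ 2 - c * (R ^ 2 * y * b)
        = ν⁻¹ * ((ν * b - c * R ^ 2 * y / 2) ^ 2 + 3 / 4 * (c * R ^ 2 * y) ^ 2) := by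
      field_simp; ring
    have : 0 ≤ ν⁻¹ * ((ν * b - c * R ^ 2 * y / 2) ^ 2 + 3 / 4 * (c * R ^ 2 * y) ^ 2) := by positivity
    linarith
  have e0 := hyoung y₀ b₀
  have e1 := hyoung y₁ b₁
  have e2 : 0 ≤ c * R * (‖a' 0 t‖ * y₁ ^ 2 + ‖a' 1 t‖ * y₀ ^ 2) := by positivity
  linarith [hcomp 0, hcomp 1]

/-- Uniqueness of solutions. -/
theorem IsSol.unique [CompleteSpace H] [Countable ι] {𝔑 : NonlinearData S} (hν : 0 < ν)
    (h : 𝔑.IsSol ν M g s T x a) (h' : 𝔑.IsSol ν M g s T x' a') (hs : ∀ i, x i s = x' i s)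
    (i : Fin 2) {t : ℝ} (ht : t ∈ Icc s T) : x i t = x' i t := by
  have hC := 𝔑.C_nonneg
  have hν' : 0 < ν⁻¹ := inv_pos.2 hν
  have hsT : s ≤ T := ht.1.trans ht.2
  have hsm := left_mem_Icc.2 hsT
  have hTm := right_mem_Icc.2 hsT
  obtain ⟨R, hR⟩ : ∃ R, ∀ i, ∀ t ∈ Icc s T, ‖x i t‖ ≤ R ∧ ‖x' i t‖ ≤ R := by
    choose C1 hC1 using fun i => isCompact_Icc.exists_bound_of_continuousOn (h i).cont
    choose C2 hC2 using fun i => isCompact_Icc.exists_bound_of_continuousOn (h' i).cont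
    refine ⟨max (max (C1 0) (C1 1)) (max (C2 0) (C2 1)), fun i t ht => ?_⟩
    have h1 := hC1 i t ht
    have h2 := hC2 i t ht
    fin_cases i
    · exact ⟨h1.trans (le_max_of_le_left (le_max_left _ _)),
        h2.trans (le_max_of_le_right (le_max_left _ _))⟩
    · exact ⟨h1.trans (le_max_of_le_left (le_max_right _ _)),
        h2.trans (le_max_of_le_right (le_max_right _ _))⟩
  have hR0 : 0 ≤ R := (norm_nonneg _).trans (hR 0 s hsm).1
  set m : ℝ := ∑ i, ∑ j, |M i j| with hm
  have hm0 : 0 ≤ m := Finset.sum_nonneg fun i _ => Finset.sum_nonneg fun j _ => abs_nonneg _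
  have hmi : ∀ i, ∑ j, |M i j| ≤ m := fun i => Finset.single_le_sum
    (f := fun i => ∑ j, |M i j|) (fun i _ => Finset.sum_nonneg fun j _ => abs_nonneg _)
    (Finset.mem_univ i)
  set c : ℝ := 8 * (1 + m) ^ 2 * 𝔑.C ^ 2 * ν⁻¹ with hc
  have hc0 : 0 ≤ c := by positivity
  have htr := fun i => (h i).sub (h' i)
  have hi : ∀ i, ∀ r ∈ Icc s T, IntervalIntegrable (fun r => 2 * inner ℝ (a i r - a' i r)
      ((𝔑.force M g a i r - ν • a i r) - (𝔑.force M g a' i r - ν • a' i r))) volume s r :=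
    fun i r hr => ((htr i).integrable_inner.const_mul 2).intervalIntegrable_sub hsm hr
  have hai : ∀ i, IntervalIntegrable (fun r => ‖a' i r‖) volume s T := fun i =>
    ((h' i).memLp_stokes.intervalIntegrable_of_two hsm hTm).norm
  -- Zero initial difference and no source: Gronwall forces the difference to vanish. The
  -- coefficient is integrable because ‖a'‖ is square integrable on a bounded interval.
  have key := le_mul_exp_of_ae_le
    (y := fun t => ‖x 0 t - x' 0 t‖ ^ 2 + ‖x 1 t - x' 1 t‖ ^ 2) (c := 0)
    (m := fun r => c ^ 2 * R ^ 4 * ν⁻¹ + c * R * (‖a' 0 r‖ + ‖a' 1 r‖)) (n := fun _ => 0)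
    (((htr 0).cont.norm.pow 2).add ((htr 1).cont.norm.pow 2))
    ((hi 0 T hTm).add (hi 1 T hTm))
    (intervalIntegrable_const.add (((hai 0).add (hai 1)).const_mul _)) (fun _ => by positivity)
    intervalIntegrable_const (fun t => le_rfl) le_rfl (fun r hr => ?_) ?_ ht
  · simp only [intervalIntegral.integral_const, smul_zero, add_zero, zero_mul] at key
    have h0 : ‖x i t - x' i t‖ ^ 2 ≤ 0 := by
      fin_cases i
      · simp only [Fin.zero_eta]; linarith [sq_nonneg ‖x 1 t - x' 1 t‖]
      · simp only [Fin.mk_one]; linarith [sq_nonneg ‖x 0 t - x' 0 t‖]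
    exact sub_eq_zero.1 (norm_eq_zero.1 (pow_eq_zero_iff two_ne_zero |>.1
      (le_antisymm h0 (sq_nonneg _))))
  · rw [(htr 0).norm_sq hr, (htr 1).norm_sq hr, integral_add (hi 0 r hr) (hi 1 r hr), hs, hs]
    simp
  · filter_upwards [(h 0).ae_eq, (h 1).ae_eq, (h' 0).ae_eq, (h' 1).ae_eq,
      ae_restrict_mem measurableSet_Ioc] with r h0 h1 h0' h1' hr
    have hr' := Ioc_subset_Icc_self hr
    have e := 𝔑.diff_estimate (M := M) hν g a a' r (R := R) hmi hm0
      (fun i => by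
        fin_cases i
        · exact h0 ▸ (hR 0 r hr').1
        · exact h1 ▸ (hR 1 r hr').1)
      (fun i => by
        fin_cases i
        · exact h0' ▸ (hR 0 r hr').2
        · exact h1' ▸ (hR 1 r hr').2) hc
    rw [Fin.sum_univ_two] at e
    rw [h0, h1, h0', h1', ← map_sub, ← map_sub, add_zero]
    exact e

/-- Existence of a solution of the mutual synchronization system on a given time interval. -/
theorem exists_isSol [CompleteSpace H] [Countable ι] (𝔑 : NonlinearData S) {θ₁ θ₂ : ℝ}
    (hν : 0 < ν) (hθ₁ : 0 ≤ θ₁) (hθ₂ : 0 ≤ θ₂) (hθ : θ₁ + θ₂ = 1) (hT : 0 < T)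
    (hg : ∀ i, MemLp (g i) 2 (volume.restrict (Ioc 0 T))) (x₀ : Fin 2 → H) :
    ∃ x a : Fin 2 → ℝ → H, (∀ i, x i 0 = x₀ i) ∧
      𝔑.IsSol ν (mutualMatrix θ₁ θ₂) g 0 T x a := by
  obtain ⟨K, hK0, hK⟩ := 𝔑.exists_apriori_bound hν hθ₁ hθ₂ hθ hT.le hg x₀
  set Γ : ℝ := √(∑ i, ∫ t in Ioc 0 T, ‖g i t‖ ^ 2) with hΓ
  have hΓ0 : 0 ≤ Γ := Real.sqrt_nonneg _
  have hgi : ∀ i, IntegrableOn (fun t => ‖g i t‖ ^ 2) (Ioc 0 T) := fun i =>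
    (hg i).integrable_norm_pow (by norm_num)
  have hn0 : ∀ i (A : Set ℝ), 0 ≤ ∫ t in A, ‖g i t‖ ^ 2 := fun i A =>
    MeasureTheory.integral_nonneg fun t => sq_nonneg _
  have hgΓ : ∀ r q, 0 ≤ r → q ≤ T → ∀ i, ∫ t in Ioc r q, ‖g i t‖ ^ 2 ≤ Γ ^ 2 := by
    intro r q hr hq i
    rw [hΓ, Real.sq_sqrt (Finset.sum_nonneg fun i _ => hn0 i _)]
    refine le_trans ?_ (Finset.single_le_sum (f := fun i => ∫ t in Ioc 0 T, ‖g i t‖ ^ 2)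
      (fun i _ => hn0 i _) (Finset.mem_univ i))
    exact setIntegral_mono_set (hgi i) (Eventually.of_forall fun t => sq_nonneg _)
      (Ioc_subset_Ioc hr hq).eventuallyLE
  have hgm : ∀ r q, 0 ≤ r → q ≤ T → ∀ i, MemLp (g i) 2 (volume.restrict (Ioc r q)) :=
    fun r q hr hq i => (hg i).mono_measure (Measure.restrict_mono (Ioc_subset_Ioc hr hq) le_rfl)
  -- K bounds solutions that already exist; the norms of the initial data are added for the first
  -- step. The same τ then works at every restart.
  obtain ⟨τ, hτ, hloc⟩ := 𝔑.exists_local hν (mutualMatrix θ₁ θ₂)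
    (K := max K (max ‖x₀ 0‖ ‖x₀ 1‖)) (le_max_of_le_left hK0) hΓ0
  obtain ⟨n, hn⟩ := exists_nat_gt (T / τ)
  have hn0' : (0 : ℝ) < n := (div_pos hT hτ).trans hn
  have hstep : T / n ≤ τ := by
    rw [div_lt_iff₀ hτ] at hn
    rw [div_le_iff₀ hn0']
    linarith
  have hstep0 : 0 < T / n := div_pos hT hn0'
  have main : ∀ k : ℕ, k ≤ n → ∃ x a : Fin 2 → ℝ → H, (∀ i, x i 0 = x₀ i) ∧
      𝔑.IsSol ν (mutualMatrix θ₁ θ₂) g 0 (k * (T / n)) x a := by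
    intro k
    induction k with
    | zero =>
      intro _
      rw [Nat.cast_zero, zero_mul]
      refine hloc 0 0 le_rfl (by simpa using hτ.le) g (hgm 0 0 le_rfl hT.le)
        (hgΓ 0 0 le_rfl hT.le) x₀ fun i => ?_
      fin_cases i
      · exact le_max_of_le_right (le_max_left _ _)
      · exact le_max_of_le_right (le_max_right _ _)
    | succ k ih =>
      intro hk
      obtain ⟨x, a, hx, hsol⟩ := ih (by omega)
      have hcast : ((k + 1 : ℕ) : ℝ) * (T / n) = k * (T / n) + T / n := by push_cast; ring
      have h0k : 0 ≤ k * (T / n) := by positivity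
      have hkT : ((k + 1 : ℕ) : ℝ) * (T / n) ≤ T := by
        have : ((k + 1 : ℕ) : ℝ) ≤ n := by exact_mod_cast hk
        calc ((k + 1 : ℕ) : ℝ) * (T / n) ≤ n * (T / n) := by gcongr
          _ = T := by field_simp
      have hkk : k * (T / n) ≤ ((k + 1 : ℕ) : ℝ) * (T / n) := by rw [hcast]; linarith
      obtain ⟨x', a', hx', hsol'⟩ := hloc (k * (T / n)) (((k + 1 : ℕ) : ℝ) * (T / n)) hkk
        (by rw [hcast]; linarith) g (hgm _ _ h0k hkT) (hgΓ _ _ h0k hkT)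
        (fun i => x i (k * (T / n)))
        (fun i => (hK _ ⟨h0k, hkk.trans hkT⟩ x a hx hsol i _ (right_mem_Icc.2 h0k)).trans
          (le_max_left _ _))
      refine ⟨_, _, fun i => ?_, hsol.glue h0k hkk hsol' fun i => (hx' i).symm⟩
      simp only [if_pos h0k, hx]
  obtain ⟨x, a, hx, hsol⟩ := main n le_rfl
  rw [mul_div_cancel₀ _ hn0'.ne'] at hsol
  exact ⟨x, a, hx, hsol⟩

end NonlinearData

end Abstract

end SyncNSE

/-! ### A real eigenbasis of divergence-free fields on the torus. -/

namespace SyncNSE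

open Set Filter Topology

section Torus

open UnitAddTorus

/-- The function `cos (k·x) + sin (k·x)`. -/
noncomputable def cas (k : Fin 2 → ℤ) : C(Torus, ℝ) where
  toFun x := (mFourier k x).re + (mFourier k x).im
  continuous_toFun := by fun_prop

theorem cas_apply (k : Fin 2 → ℤ) (x : Torus) :
    cas k x = (mFourier k x).re + (mFourier k x).im := rfl

theorem cas_neg_apply (k : Fin 2 → ℤ) (x : Torus) :
    cas (-k) x = (mFourier k x).re - (mFourier k x).im := by
  rw [cas_apply, mFourier_neg]
  simp [sub_eq_add_neg]

theorem ofReal_cas (k : Fin 2 → ℤ) (x : Torus) :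
    (cas k x : ℂ) = (1 - Complex.I) / 2 * mFourier k x + (1 + Complex.I) / 2 * mFourier (-k) x := by
  rw [cas_apply, mFourier_neg]
  apply Complex.ext <;> simp <;> ring

theorem norm_mFourier_apply (k : Fin 2 → ℤ) (x : Torus) : ‖mFourier k x‖ = 1 := by
  simp only [mFourier, fourier_apply, ContinuousMap.coe_mk, norm_prod, Circle.norm_coe,
    Finset.prod_const_one]

theorem cas_mul_cas (k l : Fin 2 → ℤ) (x : Torus) :
    cas k x * cas l x = (mFourier (k - l) x).re + (mFourier (k + l) x).im := by
  rw [sub_eq_add_neg, mFourier_add, mFourier_add, mFourier_neg, cas_apply, cas_apply]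
  simp
  ring

theorem cas_sq_le (k : Fin 2 → ℤ) (x : Torus) : cas k x ^ 2 ≤ 2 := by
  have h1 := Complex.sq_norm (mFourier k x)
  rw [norm_mFourier_apply, Complex.normSq_apply] at h1
  rw [cas_apply]
  nlinarith [sq_nonneg ((mFourier k x).re - (mFourier k x).im)]

theorem integral_mFourier (k : Fin 2 → ℤ) :
    ∫ x, mFourier k x ∂torusMeasure = if k = 0 then 1 else 0 := by
  have h := orthonormal_iff_ite.1 (orthonormal_mFourier (d := Fin 2)) 0 k
  rw [ContinuousMap.inner_toLp] at h
  simp only [mFourier_zero, ContinuousMap.one_apply, map_one, mul_one] at h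
  simp only [eq_comm (a := k)]
  exact h

theorem integrable_torus {E : Type*} [NormedAddCommGroup E] (f : C(Torus, E)) :
    Integrable f torusMeasure := by
  refine Integrable.of_bound f.continuous.aestronglyMeasurable ‖f‖ ?_
  exact Eventually.of_forall fun x => f.norm_coe_le_norm x

/-- The Fourier coefficients of `cas`. -/
noncomputable def casCoef (k m : Fin 2 → ℤ) : ℂ :=
  (1 - Complex.I) / 2 * (if m = k then 1 else 0) + (1 + Complex.I) / 2 * (if m = -k then 1 else 0)

theorem integral_mFourier_mul_cas (k m : Fin 2 → ℤ) :
    ∫ x, mFourier (-m) x * (cas k x : ℂ) ∂torusMeasure = casCoef k m := by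
  have h : ∀ x, mFourier (-m) x * (cas k x : ℂ) = (1 - Complex.I) / 2 * mFourier (-m + k) x
      + (1 + Complex.I) / 2 * mFourier (-m + -k) x := by
    intro x
    rw [ofReal_cas, mFourier_add, mFourier_add]
    ring
  simp_rw [h]
  rw [integral_add ((integrable_torus _).const_mul _) ((integrable_torus _).const_mul _),
    integral_const_mul, integral_const_mul, integral_mFourier, integral_mFourier, casCoef]
  congr 3
  · exact propext ⟨fun h => (neg_add_eq_zero.1 h), fun h => neg_add_eq_zero.2 h⟩
  · exact propext ⟨fun h => (neg_add_eq_zero.1 h), fun h => neg_add_eq_zero.2 h⟩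

/-- Since `cas k` is the real part minus the imaginary part of exp (-ik·x), this is orthonormality
of the functions `cas`, read off from their Fourier coefficients. -/
theorem casCoef_re_sub_im (k m : Fin 2 → ℤ) :
    (casCoef k m).re - (casCoef k m).im = if m = k then 1 else 0 := by
  unfold casCoef
  split_ifs <;> norm_num

theorem integral_cas_mul {f : Torus → ℝ} (hf : Integrable f torusMeasure) (k : Fin 2 → ℤ) :
    Integrable (fun x => mFourier (-k) x * (f x : ℂ)) torusMeasure ∧
    ∫ x, cas k x * f x ∂torusMeasure = (∫ x, mFourier (-k) x * (f x : ℂ) ∂torusMeasure).re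
      - (∫ x, mFourier (-k) x * (f x : ℂ) ∂torusMeasure).im := by
  have hi : Integrable (fun x => mFourier (-k) x * (f x : ℂ)) torusMeasure := by
    refine Integrable.bdd_mul (c := 1) hf.ofReal ?_ ?_
    · exact (mFourier (-k)).continuous.aestronglyMeasurable
    · exact Eventually.of_forall fun x => (norm_mFourier_apply _ _).le
  refine ⟨hi, ?_⟩
  have h := (Complex.reCLM - Complex.imCLM).integral_comp_comm hi
  simp only [sub_apply, Complex.reCLM_apply, Complex.imCLM_apply] at h
  rw [← h]
  refine integral_congr_ae (Eventually.of_forall fun x => ?_)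
  simp only [cas_apply, mFourier_neg]
  simp
  ring

theorem integral_cas_mul_cas (k l : Fin 2 → ℤ) :
    ∫ x, cas k x * cas l x ∂torusMeasure = if k = l then 1 else 0 := by
  rw [(integral_cas_mul (integrable_torus (cas l)) k).2, integral_mFourier_mul_cas,
    casCoef_re_sub_im]

/-- The unit vector `k^⊥ / |k|`. -/
noncomputable def perp (k : Fin 2 → ℤ) : Vec := !₂[-(k 1 : ℝ) / waveNorm k, (k 0 : ℝ) / waveNorm k]

theorem perp_zero (k : Fin 2 → ℤ) : perp k 0 = -(k 1 : ℝ) / waveNorm k := rfl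

theorem perp_one (k : Fin 2 → ℤ) : perp k 1 = (k 0 : ℝ) / waveNorm k := rfl

theorem waveNorm_sq (k : Fin 2 → ℤ) : waveNorm k ^ 2 = (k 0 : ℝ) ^ 2 + (k 1 : ℝ) ^ 2 := by
  rw [waveNorm, Real.sq_sqrt (by positivity), Fin.sum_univ_two]

theorem waveNorm_neg (k : Fin 2 → ℤ) : waveNorm (-k) = waveNorm k := by
  simp [waveNorm]

theorem one_le_waveNorm {k : Fin 2 → ℤ} (hk : k ≠ 0) : 1 ≤ waveNorm k := by
  have h0 : 0 ≤ waveNorm k := Real.sqrt_nonneg _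
  have h1 : 1 ≤ waveNorm k ^ 2 := by
    rw [waveNorm_sq]
    have : 1 ≤ k 0 ^ 2 + k 1 ^ 2 := by
      by_contra hlt
      have e0 : k 0 = 0 := by nlinarith [sq_nonneg (k 0), sq_nonneg (k 1)]
      have e1 : k 1 = 0 := by nlinarith [sq_nonneg (k 0), sq_nonneg (k 1)]
      exact hk (funext fun i => by fin_cases i <;> assumption)
    exact_mod_cast this
  nlinarith

theorem waveNorm_pos {k : Fin 2 → ℤ} (hk : k ≠ 0) : 0 < waveNorm k :=
  zero_lt_one.trans_le (one_le_waveNorm hk)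

theorem perp_neg (k : Fin 2 → ℤ) : perp (-k) = -perp k := by
  ext i
  fin_cases i <;> simp [perp, waveNorm_neg, neg_div]

theorem perp_sq {k : Fin 2 → ℤ} (hk : k ≠ 0) : perp k 0 ^ 2 + perp k 1 ^ 2 = 1 := by
  have := waveNorm_pos hk
  rw [perp_zero, perp_one]
  field_simp
  rw [waveNorm_sq]
  ring

theorem norm_perp {k : Fin 2 → ℤ} (hk : k ≠ 0) : ‖perp k‖ = 1 := by
  rw [EuclideanSpace.norm_eq, Fin.sum_univ_two]
  simp only [Real.norm_eq_abs, sq_abs]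
  rw [perp_sq hk, Real.sqrt_one]

theorem sum_mul_perp (k : Fin 2 → ℤ) : ∑ i, (k i : ℝ) * perp k i = 0 := by
  rw [Fin.sum_univ_two, perp_zero, perp_one]
  ring

/-- The divergence-free field `k^⊥ / |k| (cos (k·x) + sin (k·x))`. -/
noncomputable def casField (k : Fin 2 → ℤ) : C(Torus, Vec) where
  toFun x := cas k x • perp k
  continuous_toFun := by fun_prop

theorem casField_apply (k : Fin 2 → ℤ) (x : Torus) : casField k x = cas k x • perp k := rfl

theorem norm_casField_le {k : Fin 2 → ℤ} (hk : k ≠ 0) (x : Torus) : ‖casField k x‖ ≤ 2 := by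
  rw [casField_apply, norm_smul, norm_perp hk, mul_one, Real.norm_eq_abs]
  have := cas_sq_le k x
  exact abs_le.2 ⟨by nlinarith, by nlinarith⟩

/-- The field `casField` in `L²`. -/
noncomputable def casFieldLp (k : Fin 2 → ℤ) : L2Field :=
  ContinuousMap.toLp (E := Vec) 2 torusMeasure ℝ (casField k)

theorem coeFn_casFieldLp (k : Fin 2 → ℤ) : casFieldLp k =ᵐ[torusMeasure] casField k :=
  ContinuousMap.coeFn_toLp torusMeasure (casField k)

theorem coef_casFieldLp (k m : Fin 2 → ℤ) (i : Fin 2) :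
    coef (casFieldLp k) m i = casCoef k m * perp k i := by
  rw [← integral_mFourier_mul_cas, ← integral_mul_const]
  unfold coef mFourierCoeff
  refine integral_congr_ae ?_
  filter_upwards [coeFn_casFieldLp k] with x hx
  rw [hx, casField_apply]
  simp [mul_assoc]

theorem casFieldLp_mem (k : Fin 2 → ℤ) (hk : k ≠ 0) : casFieldLp k ∈ H := by
  refine ⟨fun i => ?_, fun m => ?_⟩
  · rw [coef_casFieldLp, casCoef, if_neg hk.symm, if_neg (by simpa using hk)]
    simp
  · simp only [coef_casFieldLp]
    have h0 : ∑ i, (k i : ℂ) * (perp k i : ℂ) = 0 := by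
      exact_mod_cast congrArg ((↑) : ℝ → ℂ) (sum_mul_perp k)
    by_cases h1 : m = k
    · subst h1
      calc _ = casCoef m m * ∑ i, (m i : ℂ) * (perp m i : ℂ) := by
            rw [Finset.mul_sum]; exact Finset.sum_congr rfl fun i _ => by ring
        _ = 0 := by rw [h0, mul_zero]
    · by_cases h2 : m = -k
      · subst h2
        calc _ = -casCoef k (-k) * ∑ i, (k i : ℂ) * (perp k i : ℂ) := by
              rw [Finset.mul_sum]
              exact Finset.sum_congr rfl fun i _ => by simp only [Pi.neg_apply]; push_cast; ring
          _ = 0 := by rw [h0, mul_zero]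
      · simp [casCoef, h1, h2]

theorem integrable_component (u : L2Field) (i : Fin 2) :
    Integrable (fun x => u x i) torusMeasure :=
  ((EuclideanSpace.proj i : Vec →L[ℝ] ℝ).comp_memLp' (Lp.memLp u)).integrable (by norm_num)

theorem inner_casFieldLp (k : Fin 2 → ℤ) (u : L2Field) :
    inner ℝ (casFieldLp k) u = ∑ i, perp k i * ((coef u k i).re - (coef u k i).im) := by
  have h1 : ∀ i, (coef u k i).re - (coef u k i).im = ∫ x, cas k x * u x i ∂torusMeasure := by
    intro i
    rw [(integral_cas_mul (integrable_component u i) k).2]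
    rfl
  simp only [h1, ← integral_const_mul]
  rw [L2.inner_def, ← integral_finsetSum]
  · refine integral_congr_ae ?_
    filter_upwards [coeFn_casFieldLp k] with x hx
    rw [hx, casField_apply, PiLp.inner_apply]
    refine Finset.sum_congr rfl fun i _ => ?_
    simp
    ring
  · intro i _
    refine Integrable.const_mul ?_ _
    refine Integrable.bdd_mul (c := ‖cas k‖) (integrable_component u i)
      (cas k).continuous.aestronglyMeasurable ?_
    exact Eventually.of_forall fun x => (cas k).norm_coe_le_norm x

theorem coef_neg (u : L2Field) (k : Fin 2 → ℤ) (i : Fin 2) :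
    coef u (-k) i = (starRingEnd ℂ) (coef u k i) := by
  unfold coef mFourierCoeff
  rw [← integral_conj]
  refine integral_congr_ae (Eventually.of_forall fun x => ?_)
  simp only [smul_eq_mul, map_mul, Complex.conj_ofReal, mFourier_neg, Complex.conj_conj]

/-- A square integrable field is determined by its Fourier coefficients. -/
theorem ext_coef {u w : L2Field} (h : ∀ k i, coef u k i = coef w k i) : u = w := by
  have key : ∀ i, (Complex.ofRealCLM.comp (EuclideanSpace.proj i : Vec →L[ℝ] ℝ)).compLpL 2
      torusMeasure u = (Complex.ofRealCLM.comp (EuclideanSpace.proj i : Vec →L[ℝ] ℝ)).compLpL 2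
      torusMeasure w := by
    intro i
    apply (mFourierBasis (d := Fin 2)).repr.injective
    ext k
    have h1 := h k i
    rw [coef_eq_coefL, coef_eq_coefL] at h1
    rw [HilbertBasis.repr_apply_apply, HilbertBasis.repr_apply_apply, coe_mFourierBasis]
    exact h1
  have hae : ∀ i, ∀ᵐ x ∂torusMeasure, u x i = w x i := by
    intro i
    filter_upwards [(Complex.ofRealCLM.comp (EuclideanSpace.proj i : Vec →L[ℝ] ℝ)).coeFn_compLpL
      (p := 2) u, (Complex.ofRealCLM.comp (EuclideanSpace.proj i : Vec →L[ℝ] ℝ)).coeFn_compLpL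
      (p := 2) w] with x h1 h2
    rw [key i, h2] at h1
    simpa using h1.symm
  refine Lp.ext ?_
  filter_upwards [ae_all_iff.2 hae] with x hx
  ext i
  exact hx i

/-- Nonzero wavenumbers. -/
abbrev Wave : Type := {k : Fin 2 → ℤ // k ≠ 0}

instance : Neg Wave := ⟨fun k => ⟨-k.1, neg_ne_zero.2 k.2⟩⟩

theorem Wave.coe_neg (k : Wave) : ((-k : Wave) : Fin 2 → ℤ) = -k.1 := rfl

/-- The eigenfields of the Stokes operator. -/
noncomputable def eigenfield (k : Wave) : H := ⟨casFieldLp k.1, casFieldLp_mem k.1 k.2⟩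

theorem inner_eigenfield (k : Wave) (u : H) :
    inner ℝ (eigenfield k) u
      = ∑ i, perp k.1 i * ((coef u k.1 i).re - (coef u k.1 i).im) :=
  inner_casFieldLp k.1 u

theorem orthonormal_eigenfield : Orthonormal ℝ eigenfield := by
  classical
  rw [orthonormal_iff_ite]
  intro k l
  rw [inner_eigenfield]
  change ∑ i, perp k.1 i * ((coef (casFieldLp l.1) k.1 i).re - (coef (casFieldLp l.1) k.1 i).im) = _
  have h : ∀ i, (coef (casFieldLp l.1) k.1 i).re - (coef (casFieldLp l.1) k.1 i).im
      = (if k.1 = l.1 then 1 else 0) * perp l.1 i := by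
    intro i
    rw [coef_casFieldLp, Complex.re_mul_ofReal, Complex.im_mul_ofReal, ← sub_mul, casCoef_re_sub_im]
  simp only [h]
  by_cases hkl : k = l
  · subst hkl
    simp only [if_true, one_mul, Fin.sum_univ_two]
    rw [← perp_sq k.2]
    ring
  · have : k.1 ≠ l.1 := fun h => hkl (Subtype.ext h)
    simp [hkl, this]

/-- The Fourier coefficients of a field in `H` in terms of its coordinates. -/
theorem coef_eq_inner (u : H) (k : Wave) (i : Fin 2) :
    coef u k.1 i = perp k.1 i *
      ⟨(inner ℝ (eigenfield k) u - inner ℝ (eigenfield (-k)) u) / 2,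
        -(inner ℝ (eigenfield k) u + inner ℝ (eigenfield (-k)) u) / 2⟩ := by
  have hk := waveNorm_pos k.2
  have hdiv := u.2.2 k.1
  have h1 := inner_eigenfield k u
  have h2 := inner_eigenfield (-k) u
  rw [Wave.coe_neg, perp_neg] at h2
  simp only [coef_neg, Fin.sum_univ_two, Complex.conj_re, Complex.conj_im, PiLp.neg_apply] at h1 h2 hdiv
  have hre := congrArg Complex.re hdiv
  have him := congrArg Complex.im hdiv
  simp only [Complex.add_re, Complex.add_im, Complex.mul_re, Complex.mul_im, Complex.intCast_re,
    Complex.intCast_im, zero_mul, sub_zero, add_zero, Complex.zero_re, Complex.zero_im] at hre him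
  set r := inner ℝ (eigenfield k) u
  set r' := inner ℝ (eigenfield (-k)) u
  have hs := perp_sq k.2
  have hc0 : ((k.1 0 : ℤ) : ℝ) = waveNorm k.1 * perp k.1 1 := by rw [perp_one]; field_simp
  have hc1 : ((k.1 1 : ℤ) : ℝ) = -(waveNorm k.1 * perp k.1 0) := by rw [perp_zero]; field_simp
  rw [hc0, hc1] at hre him
  set p := perp k.1 0
  set q := perp k.1 1
  -- The divergence condition: û_k is parallel to k^⊥, hence equals its projection onto `perp k`.
  have hre' : q * (coef u k.1 0).re = p * (coef u k.1 1).re := by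
    have := mul_left_cancel₀ hk.ne' (show waveNorm k.1 * (q * (coef u k.1 0).re)
      = waveNorm k.1 * (p * (coef u k.1 1).re) by linarith)
    exact this
  have him' : q * (coef u k.1 0).im = p * (coef u k.1 1).im := by
    have := mul_left_cancel₀ hk.ne' (show waveNorm k.1 * (q * (coef u k.1 0).im)
      = waveNorm k.1 * (p * (coef u k.1 1).im) by linarith)
    exact this
  -- The coordinates at k and -k are perp·(Re û - Im û) and -perp·(Re û + Im û), because û_{-k} is
  -- the conjugate of û_k and `perp` is odd.
  have e1 : (r - r') / 2 = p * (coef u k.1 0).re + q * (coef u k.1 1).re := by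
    rw [h1, h2]; ring
  have e2 : -(r + r') / 2 = p * (coef u k.1 0).im + q * (coef u k.1 1).im := by
    rw [h1, h2]; ring
  rw [e1, e2]
  fin_cases i
  · apply Complex.ext
    · simp only [Fin.zero_eta, Complex.re_ofReal_mul]
      linear_combination (-(coef u k.1 0).re) * hs + q * hre'
    · simp only [Fin.zero_eta, Complex.im_ofReal_mul]
      linear_combination (-(coef u k.1 0).im) * hs + q * him'
  · apply Complex.ext
    · simp only [Fin.mk_one, Complex.re_ofReal_mul]
      linear_combination (-(coef u k.1 1).re) * hs - p * hre'
    · simp only [Fin.mk_one, Complex.im_ofReal_mul]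
      linear_combination (-(coef u k.1 1).im) * hs - p * him'

theorem coef_zero_wave (u : H) (i : Fin 2) : coef u 0 i = 0 := u.2.1 i

/-- The Hilbert basis of eigenfields of the Stokes operator. -/
noncomputable def eigenbasis : HilbertBasis Wave ℝ H :=
  HilbertBasis.mkOfOrthogonalEqBot orthonormal_eigenfield <| by
    rw [Submodule.eq_bot_iff]
    intro u hu
    have h0 : ∀ k, inner ℝ (eigenfield k) u = 0 := fun k =>
      (Submodule.mem_orthogonal _ _).1 hu _ (Submodule.subset_span ⟨k, rfl⟩)
    refine Subtype.ext (ext_coef fun k i => ?_)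
    rw [Submodule.coe_zero, coef_zero]
    by_cases hk : k = 0
    · rw [hk, coef_zero_wave]
    · rw [coef_eq_inner u ⟨k, hk⟩ i, h0, h0]
      apply Complex.ext <;> simp

theorem eigenbasis_apply (k : Wave) : eigenbasis k = eigenfield k :=
  congrFun (HilbertBasis.coe_mkOfOrthogonalEqBot _ _) k

end Torus

end SyncNSE

/-! ### Multipliers, derivatives and projections in the eigenbasis. -/

namespace SyncNSE

open Set Filter Topology

section PermDiag

variable {ι E : Type*} [NormedAddCommGroup E] [InnerProductSpace ℝ E]

/-- Permuted coordinates with bounded factors stay square summable, so Riesz-Fischer defines the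
image. The permutation is needed for derivatives: ∂_j cas(k·x) = k_j cas(-k·x) exchanges k and -k.
-/
theorem exists_permDiag (b : HilbertBasis ι ℝ E) (σ : ι ≃ ι) (m : ι → ℝ) (C : ℝ) (hC : 0 ≤ C)
    (hm : ∀ i, |m i| ≤ C) : ∃ A : E →L[ℝ] E,
      (∀ i x, inner ℝ (b i) (A x) = m i * inner ℝ (b (σ i)) x) ∧ ∀ x, ‖A x‖ ≤ C * ‖x‖ := by
  have hle : ∀ x i, (m i * inner ℝ (b (σ i)) x) ^ 2 ≤ C ^ 2 * inner ℝ (b (σ i)) x ^ 2 := by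
    intro x i
    rw [mul_pow]
    refine mul_le_mul_of_nonneg_right ?_ (sq_nonneg _)
    rw [← sq_abs]
    exact pow_le_pow_left₀ (abs_nonneg _) (hm i) 2
  have hsum : ∀ x, HasSum (fun i => C ^ 2 * inner ℝ (b (σ i)) x ^ 2) (C ^ 2 * ‖x‖ ^ 2) :=
    fun x => (σ.hasSum_iff.2 (HilbertBasis.hasSum_inner_sq b x)).mul_left _
  have hex : ∀ x, ∃ y, ∀ i, inner ℝ (b i) y = m i * inner ℝ (b (σ i)) x := fun x =>
    (HilbertBasis.exists_inner_eq b
      ((hsum x).summable.of_nonneg_of_le (fun i => sq_nonneg _) (hle x))).imp fun y h => h.1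
  choose A hA using hex
  have hnorm : ∀ x, ‖A x‖ ≤ C * ‖x‖ := by
    intro x
    refine (sq_le_sq₀ (norm_nonneg _) (by positivity)).1 ?_
    rw [mul_pow]
    refine hasSum_le (fun i => ?_) (HilbertBasis.hasSum_inner_sq b (A x)) (hsum x)
    rw [hA]
    exact hle x i
  refine ⟨LinearMap.mkContinuous
    { toFun := A
      map_add' := fun x y => HilbertBasis.ext_inner b fun i => by
        rw [inner_add_right, hA, hA, hA, inner_add_right, mul_add]
      map_smul' := fun c x => HilbertBasis.ext_inner b fun i => by
        rw [RingHom.id_apply, inner_smul_right, hA, hA, inner_smul_right, mul_left_comm] }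
    C hnorm, fun i x => hA x i, hnorm⟩

/-- The bounded operator that permutes the coordinates in a Hilbert basis and multiplies them by
bounded factors. -/
noncomputable def permDiag (b : HilbertBasis ι ℝ E) (σ : ι ≃ ι) (m : ι → ℝ) (C : ℝ) (hC : 0 ≤ C)
    (hm : ∀ i, |m i| ≤ C) : E →L[ℝ] E := (exists_permDiag b σ m C hC hm).choose

variable {b : HilbertBasis ι ℝ E} {σ : ι ≃ ι} {m : ι → ℝ} {C : ℝ} {hC : 0 ≤ C}
  {hm : ∀ i, |m i| ≤ C}

theorem inner_permDiag (i : ι) (x : E) :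
    inner ℝ (b i) (permDiag b σ m C hC hm x) = m i * inner ℝ (b (σ i)) x :=
  (exists_permDiag b σ m C hC hm).choose_spec.1 i x

theorem norm_permDiag_le (x : E) : ‖permDiag b σ m C hC hm x‖ ≤ C * ‖x‖ :=
  (exists_permDiag b σ m C hC hm).choose_spec.2 x

theorem permDiag_basis (i : ι) :
    permDiag b σ m C hC hm (b (σ i)) = m i • b i := by
  classical
  refine HilbertBasis.ext_inner b fun k => ?_
  rw [inner_permDiag, inner_smul_right, orthonormal_iff_ite.1 b.orthonormal,
    orthonormal_iff_ite.1 b.orthonormal]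
  by_cases h : k = i
  · simp [h]
  · rw [if_neg h, if_neg (fun h' => h (σ.injective h'))]
    simp

end PermDiag

section Operators

/-- The square root `A^{-1/2}` of the inverse Stokes operator. -/
noncomputable def invRoot : H →L[ℝ] H :=
  permDiag eigenbasis (Equiv.refl Wave) (fun k => (waveNorm k.1)⁻¹) 1 zero_le_one fun k => by
    rw [abs_of_nonneg (inv_nonneg.2 (waveNorm_pos k.2).le)]
    exact inv_le_one_of_one_le₀ (one_le_waveNorm k.2)

theorem inner_invRoot (k : Wave) (x : H) :
    inner ℝ (eigenbasis k) (invRoot x) = (waveNorm k.1)⁻¹ * inner ℝ (eigenbasis k) x :=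
  inner_permDiag k x

/-- The spectral data of the Stokes operator. -/
noncomputable def stokesData : SpectralData Wave H where
  basis := eigenbasis
  freq k := waveNorm k.1
  one_le_freq k := one_le_waveNorm k.2
  root := invRoot
  inner_root := inner_invRoot

/-- The multiplier |k|ⁿ is real and even. It therefore acts by the same factor on the coordinates at
k and at -k, which together determine û_k. -/
theorem isStokesPow_iff {n : ℕ} {u w : H} : IsStokesPow n u w ↔
    ∀ k : Wave, inner ℝ (eigenbasis k) w = waveNorm k.1 ^ n * inner ℝ (eigenbasis k) u := by
  simp only [eigenbasis_apply]
  constructor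
  · intro h k
    have hc : ∀ i, coef w k.1 i = ((waveNorm k.1 ^ n : ℝ) : ℂ) * coef u k.1 i := fun i => by
      rw [h k.1 i]; push_cast; rfl
    rw [inner_eigenfield, inner_eigenfield, Finset.mul_sum]
    refine Finset.sum_congr rfl fun i _ => ?_
    rw [hc, Complex.re_ofReal_mul, Complex.im_ofReal_mul]
    ring
  · intro h k i
    by_cases hk : k = 0
    · rw [hk, coef_zero_wave, coef_zero_wave, mul_zero]
    · have h1 := h ⟨k, hk⟩
      have h2 := h (-⟨k, hk⟩)
      rw [Wave.coe_neg, waveNorm_neg] at h2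
      rw [coef_eq_inner w ⟨k, hk⟩ i, coef_eq_inner u ⟨k, hk⟩ i, h1, h2, ← Complex.ofReal_pow]
      apply Complex.ext
      · simp only [Complex.re_ofReal_mul]; ring
      · simp only [Complex.im_ofReal_mul]; ring

theorem IsStokesPow.stokesPow_eq {n : ℕ} {u w : H} (h : IsStokesPow n u w) :
    stokesPow n u = w := by
  have hex : ∃ w, IsStokesPow n u w := ⟨w, h⟩
  rw [stokesPow, dif_pos hex]
  refine HilbertBasis.ext_inner eigenbasis fun k => ?_
  rw [isStokesPow_iff.1 hex.choose_spec, isStokesPow_iff.1 h]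

theorem isStokesPow_invRoot (x : H) : IsStokesPow 1 (invRoot x) x := by
  refine isStokesPow_iff.2 fun k => ?_
  have := waveNorm_pos k.2
  rw [inner_invRoot]
  field_simp

theorem isStokesPow_invRoot_invRoot (x : H) : IsStokesPow 2 (invRoot (invRoot x)) x := by
  refine isStokesPow_iff.2 fun k => ?_
  have := waveNorm_pos k.2
  rw [inner_invRoot, inner_invRoot]
  field_simp

theorem stokesPow_one_invRoot (x : H) : stokesPow 1 (invRoot x) = x :=
  (isStokesPow_invRoot x).stokesPow_eq

theorem stokes_invRoot_invRoot (x : H) : stokes (invRoot (invRoot x)) = x :=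
  (isStokesPow_invRoot_invRoot x).stokesPow_eq

theorem invRoot_stokesPow_one {u : H} (hu : u ∈ V) : invRoot (stokesPow 1 u) = u := by
  obtain ⟨w, hw⟩ := hu
  rw [hw.stokesPow_eq]
  refine HilbertBasis.ext_inner eigenbasis fun k => ?_
  have := waveNorm_pos k.2
  rw [inner_invRoot, isStokesPow_iff.1 hw]
  field_simp

theorem invRoot_invRoot_stokes {u : H} (hu : u ∈ DA) : invRoot (invRoot (stokes u)) = u := by
  obtain ⟨w, hw⟩ := hu
  rw [stokes, hw.stokesPow_eq]
  refine HilbertBasis.ext_inner eigenbasis fun k => ?_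
  have := waveNorm_pos k.2
  rw [inner_invRoot, inner_invRoot, isStokesPow_iff.1 hw]
  field_simp

theorem mem_lowModes_iff {N : ℝ} {u : H} :
    u ∈ lowModes N ↔ ∀ k : Wave, N < waveNorm k.1 → inner ℝ (eigenbasis k) u = 0 := by
  simp only [eigenbasis_apply]
  constructor
  · intro h k hk
    rw [inner_eigenfield]
    refine Finset.sum_eq_zero fun i _ => ?_
    rw [h k.1 hk i]
    simp
  · intro h k hk i
    by_cases h0 : k = 0
    · rw [h0, coef_zero_wave]
    · rw [coef_eq_inner u ⟨k, h0⟩ i, h ⟨k, h0⟩ hk, h (-⟨k, h0⟩) (by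
        rwa [Wave.coe_neg, waveNorm_neg])]
      apply Complex.ext <;> simp

open Classical in
-- The truncation `Q` of coordinates maps into the low modes and leaves a remainder orthogonal to
-- them; this characterises the orthogonal projection.
theorem inner_PN (N : ℝ) (k : Wave) (u : H) : inner ℝ (eigenbasis k) (PN N u)
    = (if waveNorm k.1 ≤ N then 1 else 0) * inner ℝ (eigenbasis k) u := by
  have hm : ∀ k : Wave, |if waveNorm k.1 ≤ N then (1 : ℝ) else 0| ≤ 1 := by
    intro k
    split_ifs <;> simp
  set Q := permDiag eigenbasis (Equiv.refl Wave) _ 1 zero_le_one hm with hQ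
  have hQk : ∀ k x, inner ℝ (eigenbasis k) (Q x)
      = (if waveNorm k.1 ≤ N then 1 else 0) * inner ℝ (eigenbasis k) x := fun k x =>
    inner_permDiag k x
  have hPQ : PN N u = Q u := by
    refine Submodule.eq_starProjection_of_mem_of_inner_eq_zero ?_ ?_
    · refine mem_lowModes_iff.2 fun k hk => ?_
      rw [hQk, if_neg (not_le.2 hk), zero_mul]
    · intro w hw
      rw [← HilbertBasis.tsum_inner_mul_inner eigenbasis]
      refine (tsum_congr fun k => ?_).trans tsum_zero
      by_cases hk : waveNorm k.1 ≤ N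
      · rw [real_inner_comm, inner_sub_right, hQk, if_pos hk, one_mul, sub_self, zero_mul]
      · rw [mem_lowModes_iff.1 hw k (not_le.1 hk), mul_zero]
  rw [hPQ, hQk]

theorem inner_PN_comm (N : ℝ) (x y : H) : inner ℝ (PN N x) y = inner ℝ x (PN N y) :=
  Submodule.inner_starProjection_left_eq_right _ _ _

theorem PN_PN (N : ℝ) (x : H) : PN N (PN N x) = PN N x := by
  classical
  refine HilbertBasis.ext_inner eigenbasis fun k => ?_
  rw [inner_PN, inner_PN]
  split_ifs <;> simp

theorem PN_invRoot (N : ℝ) (x : H) : PN N (invRoot x) = invRoot (PN N x) := by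
  classical
  refine HilbertBasis.ext_inner eigenbasis fun k => ?_
  rw [inner_PN, inner_invRoot, inner_invRoot, inner_PN]
  ring

theorem abs_coord_le_waveNorm (k : Fin 2 → ℤ) (j : Fin 2) : |(k j : ℝ)| ≤ waveNorm k := by
  refine Real.abs_le_sqrt ?_
  exact Finset.single_le_sum (f := fun i => (k i : ℝ) ^ 2) (fun i _ => sq_nonneg _)
    (Finset.mem_univ j)

/-- The reflection of wavenumbers. -/
def Wave.negEquiv : Wave ≃ Wave where
  toFun k := -k
  invFun k := -k
  left_inv k := Subtype.ext (neg_neg k.1)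
  right_inv k := Subtype.ext (neg_neg k.1)

/-- The Riesz-type transform `∂_j A^{-1/2}`. -/
noncomputable def riesz (j : Fin 2) : H →L[ℝ] H :=
  permDiag eigenbasis Wave.negEquiv (fun k => (k.1 j : ℝ) / waveNorm k.1) 1 zero_le_one fun k => by
    rw [abs_div, abs_of_pos (waveNorm_pos k.2)]
    exact div_le_one_of_le₀ (abs_coord_le_waveNorm _ _) (waveNorm_pos k.2).le

theorem inner_riesz (j : Fin 2) (k : Wave) (x : H) : inner ℝ (eigenbasis k) (riesz j x)
    = (k.1 j : ℝ) / waveNorm k.1 * inner ℝ (eigenbasis (-k)) x :=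
  inner_permDiag k x

theorem norm_riesz_le (j : Fin 2) (x : H) : ‖riesz j x‖ ≤ ‖x‖ :=
  (norm_permDiag_le x).trans_eq (one_mul _)

/-- The sign comes from `perp` being odd: the derivative of cas(k·x) k^⊥ is a multiple of cas(-k·x)
k^⊥, and k^⊥ = -(-k)^⊥. -/
theorem riesz_basis (j : Fin 2) (k : Wave) : riesz j (eigenbasis k)
    = -((k.1 j : ℝ) / waveNorm k.1) • eigenbasis (-k) := by
  have h : riesz j (eigenbasis (Wave.negEquiv (-k))) = _ := permDiag_basis (-k)
  have h2 : Wave.negEquiv (-k) = k := Wave.negEquiv.left_inv k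
  rw [h2] at h
  rw [h, Wave.coe_neg, waveNorm_neg]
  congr 1
  simp [neg_div]

theorem riesz_invRoot (j : Fin 2) (x : H) : riesz j (invRoot x) = invRoot (riesz j x) := by
  refine HilbertBasis.ext_inner eigenbasis fun k => ?_
  rw [inner_riesz, inner_invRoot, inner_invRoot, inner_riesz, Wave.coe_neg, waveNorm_neg]
  ring

theorem partialDeriv_invRoot (j : Fin 2) (x : H) :
    partialDeriv j (invRoot x : H) = (riesz j x : H) := by
  have h : ∀ k i, coef (riesz j x : H) k i
      = Complex.I * (k j : ℂ) * coef (invRoot x : H) k i := by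
    intro k i
    by_cases hk : k = 0
    · rw [hk, coef_zero_wave, coef_zero_wave, mul_zero]
    · have h1 := inner_riesz j ⟨k, hk⟩ x
      have h2 := inner_riesz j (-⟨k, hk⟩) x
      have h3 := inner_invRoot ⟨k, hk⟩ x
      have h4 := inner_invRoot (-⟨k, hk⟩) x
      have h5 : -(-⟨k, hk⟩ : Wave) = ⟨k, hk⟩ := Wave.negEquiv.left_inv _
      rw [Wave.coe_neg, waveNorm_neg, h5] at h2
      rw [Wave.coe_neg, waveNorm_neg] at h4
      simp only [eigenbasis_apply] at h1 h2 h3 h4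
      rw [coef_eq_inner (riesz j x) ⟨k, hk⟩ i, coef_eq_inner (invRoot x) ⟨k, hk⟩ i, h1, h2, h3, h4]
      apply Complex.ext
      · simp
        ring
      · simp
        ring
  have hex : ∃ w : L2Field, ∀ k i, coef w k i
      = Complex.I * (k j : ℂ) * coef (invRoot x : H) k i := ⟨_, h⟩
  rw [partialDeriv, dif_pos hex]
  exact ext_coef fun k i => by rw [hex.choose_spec, h]

/-- The operator `A^{3/2}` on the wavenumbers `|k| ≤ N`. -/
noncomputable def lowStokes (N : ℝ) : H →L[ℝ] H :=
  permDiag eigenbasis (Equiv.refl Wave)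
    (fun k => if waveNorm k.1 ≤ N then waveNorm k.1 ^ 3 else 0) (|N| ^ 3) (by positivity) fun k => by
    have hk := waveNorm_pos k.2
    split_ifs with h
    · rw [abs_of_pos (by positivity)]
      exact pow_le_pow_left₀ hk.le (h.trans (le_abs_self N)) 3
    · simp

/-- The power 3/2 is chosen so that the derivatives of `P_N x` are `A⁻¹` of `L²` fields (`riesz j`
applied to `lowStokes N x`), and hence bounded by Agmon's inequality. -/
theorem invRoot_lowStokes (N : ℝ) (x : H) :
    invRoot (invRoot (invRoot (lowStokes N x))) = PN N x := by
  classical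
  refine HilbertBasis.ext_inner eigenbasis fun k => ?_
  have hk := waveNorm_pos k.2
  have h : inner ℝ (eigenbasis k) (lowStokes N x)
    = (if waveNorm k.1 ≤ N then waveNorm k.1 ^ 3 else 0) * inner ℝ (eigenbasis k) x :=
    inner_permDiag k x
  rw [inner_invRoot, inner_invRoot, inner_invRoot, h, inner_PN]
  split_ifs
  · field_simp
  · simp

theorem norm_lowStokes_le (N : ℝ) (x : H) : ‖lowStokes N x‖ ≤ |N| ^ 3 * ‖x‖ :=
  norm_permDiag_le x

end Operators

end SyncNSE

/-! ### Agmon's inequality through a lattice sum. -/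

namespace SyncNSE

open Set Filter Topology

section Agmon

/-- Telescoping: (R + m - 1)(R + m) ≤ 2(R² + m²) bounds each term with m ≥ 1 by 2R²/(R + m - 1) -
2R²/(R + m), and -m contributes the same. The subtracted fraction carries the induction; the
remaining bound does not depend on n. -/
theorem sum_Icc_resolvent_le {R : ℝ} (hR : 1 ≤ R) (n : ℕ) :
    ∑ m ∈ Finset.Icc (-(n : ℤ)) n, R ^ 2 / (R ^ 2 + (m : ℝ) ^ 2)
      ≤ 1 + 4 * R - 4 * R ^ 2 / (R + n) := by
  have hR0 : 0 < R := zero_lt_one.trans_le hR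
  induction n with
  | zero =>
    simp only [CharP.cast_eq_zero, neg_zero, Finset.Icc_self, Finset.sum_singleton, Int.cast_zero]
    apply le_of_eq
    field_simp
    ring
  | succ n ih =>
    have hn : (0 : ℝ) ≤ n := n.cast_nonneg
    have h := Finset.sum_Icc_succ_eq_add_endpoints
      (fun m : ℤ => R ^ 2 / (R ^ 2 + (m : ℝ) ^ 2)) (N := n)
    push_cast at h ⊢
    rw [h, neg_sq]
    have hstep : R ^ 2 / (R ^ 2 + ((n : ℝ) + 1) ^ 2)
        ≤ 2 * R ^ 2 / (R + n) - 2 * R ^ 2 / (R + (n + 1)) := by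
      rw [div_sub_div _ _ (by positivity) (by positivity),
        div_le_div_iff₀ (by positivity) (by positivity)]
      have e : (2 * R ^ 2 * (R + (n + 1)) - (R + n) * (2 * R ^ 2)) = 2 * R ^ 2 := by ring
      rw [e]
      have : (R + n) * (R + (n + 1)) ≤ 2 * (R ^ 2 + ((n : ℝ) + 1) ^ 2) := by
        nlinarith [sq_nonneg (R - (n + 1))]
      nlinarith [sq_nonneg R]
    have e4 : ∀ y : ℝ, 4 * R ^ 2 / y = 2 * (2 * R ^ 2 / y) := fun y => by ring
    rw [e4] at ih ⊢
    linarith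

/-- Since (R² + |k|²)² ≥ (R² + k₀²)(R² + k₁²), the sum is at most a product of two one-dimensional
sums, each at most 1 + 4R ≤ 5R. -/
theorem sum_lattice_le {R : ℝ} (hR : 1 ≤ R) (F : Finset (Fin 2 → ℤ)) :
    ∑ k ∈ F, (R ^ 2 / (R ^ 2 + waveNorm k ^ 2)) ^ 2 ≤ (5 * R) ^ 2 := by
  have hR0 : 0 < R := zero_lt_one.trans_le hR
  obtain ⟨n, hn⟩ : ∃ n : ℕ, ∀ k ∈ F, ∀ i, |k i| ≤ n := by
    refine ⟨∑ k ∈ F, ∑ i, (k i).natAbs, fun k hk i => ?_⟩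
    rw [Int.abs_eq_natAbs]
    refine Int.ofNat_le.2 ?_
    exact (Finset.single_le_sum (f := fun i => (k i).natAbs) (fun i _ => Nat.zero_le _)
      (Finset.mem_univ i)).trans (Finset.single_le_sum
        (f := fun k : Fin 2 → ℤ => ∑ i, (k i).natAbs) (fun i _ => Nat.zero_le _) hk)
  calc ∑ k ∈ F, (R ^ 2 / (R ^ 2 + waveNorm k ^ 2)) ^ 2
      ≤ ∑ k ∈ F, ∏ i, R ^ 2 / (R ^ 2 + (k i : ℝ) ^ 2) := by
        refine Finset.sum_le_sum fun k _ => ?_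
        rw [Fin.prod_univ_two, waveNorm_sq, div_mul_div_comm, div_pow,
          div_le_div_iff₀ (by positivity) (by positivity)]
        have hR2 : 0 < R ^ 2 := by positivity
        have : (R ^ 2 + (k 0 : ℝ) ^ 2) * (R ^ 2 + (k 1 : ℝ) ^ 2)
            ≤ (R ^ 2 + ((k 0 : ℝ) ^ 2 + (k 1 : ℝ) ^ 2)) ^ 2 := by
          nlinarith [sq_nonneg (k 0 : ℝ), sq_nonneg (k 1 : ℝ),
            mul_nonneg (sq_nonneg (k 0 : ℝ)) (sq_nonneg (k 1 : ℝ)),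
            mul_nonneg hR2.le (sq_nonneg (k 0 : ℝ)), mul_nonneg hR2.le (sq_nonneg (k 1 : ℝ))]
        calc _ = (R ^ 2 * R ^ 2) * ((R ^ 2 + (k 0 : ℝ) ^ 2) * (R ^ 2 + (k 1 : ℝ) ^ 2)) := by ring
          _ ≤ _ := mul_le_mul_of_nonneg_left this (by positivity)
    _ ≤ ∑ k ∈ Fintype.piFinset fun _ : Fin 2 => Finset.Icc (-(n : ℤ)) n,
          ∏ i, R ^ 2 / (R ^ 2 + (k i : ℝ) ^ 2) := by
        refine Finset.sum_le_sum_of_subset_of_nonneg (fun k hk => ?_) fun k _ _ => ?_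
        · exact Fintype.mem_piFinset.2 fun i => Finset.mem_Icc.2 (abs_le.1 (hn k hk i))
        · exact Finset.prod_nonneg fun i _ => by positivity
    _ = (∑ m ∈ Finset.Icc (-(n : ℤ)) n, R ^ 2 / (R ^ 2 + (m : ℝ) ^ 2)) ^ 2 := by
        rw [← Finset.prod_univ_sum (t := fun _ : Fin 2 => Finset.Icc (-(n : ℤ)) n)
          (f := fun _ m => R ^ 2 / (R ^ 2 + (m : ℝ) ^ 2)), Fin.prod_univ_two]
        exact (pow_two _).symm
    _ ≤ (5 * R) ^ 2 := by
        refine pow_le_pow_left₀ (Finset.sum_nonneg fun m _ => by positivity) ?_ 2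
        refine (sum_Icc_resolvent_le hR n).trans ?_
        have : 0 ≤ 4 * R ^ 2 / (R + n) := by positivity
        linarith

/-- Agmon's inequality for the absolutely summable Fourier coefficients. -/
theorem sum_abs_inner_le (a : H) (F : Finset Wave) :
    ∑ k ∈ F, |inner ℝ (eigenbasis k) (invRoot (invRoot a))|
      ≤ 10 * (√‖invRoot (invRoot a)‖ * √‖a‖) := by
  set u := invRoot (invRoot a) with hu
  rcases (norm_nonneg u).eq_or_lt with h0 | hpos
  · rw [norm_eq_zero.1 h0.symm]
    simp
  have hle : ‖u‖ ≤ ‖a‖ := (stokesData.norm_root_le _).trans (stokesData.norm_root_le _)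
  -- The wavenumber that balances low and high modes in Cauchy-Schwarz with weight 1 + |k|²/R². The
  -- factors are at most 2‖u‖ and 5R, and ‖u‖R = ‖u‖^{1/2}‖a‖^{1/2}.
  set R := √(‖a‖ / ‖u‖) with hRdef
  have hR2 : R ^ 2 = ‖a‖ / ‖u‖ := Real.sq_sqrt (by positivity)
  have hR : 1 ≤ R := Real.one_le_sqrt.2 ((one_le_div hpos).2 hle)
  have hR0 : 0 < R := zero_lt_one.trans_le hR
  have ha : ∀ k : Wave, inner ℝ (eigenbasis k) a = waveNorm k.1 ^ 2 * inner ℝ (eigenbasis k) u :=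
    isStokesPow_iff.1 (isStokesPow_invRoot_invRoot a)
  have hcs := Finset.sum_mul_sq_le_sq_mul_sq F
    (fun k : Wave => |inner ℝ (eigenbasis k) u| * ((R ^ 2 + waveNorm k.1 ^ 2) / R ^ 2))
    (fun k : Wave => R ^ 2 / (R ^ 2 + waveNorm k.1 ^ 2))
  have e1 : ∑ k ∈ F, |inner ℝ (eigenbasis k) u| * ((R ^ 2 + waveNorm k.1 ^ 2) / R ^ 2)
      * (R ^ 2 / (R ^ 2 + waveNorm k.1 ^ 2)) = ∑ k ∈ F, |inner ℝ (eigenbasis k) u| := by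
    refine Finset.sum_congr rfl fun k _ => ?_
    have : 0 < R ^ 2 + waveNorm k.1 ^ 2 := by positivity
    field_simp
  have e2 : ∑ k ∈ F, (R ^ 2 / (R ^ 2 + waveNorm k.1 ^ 2)) ^ 2 ≤ (5 * R) ^ 2 := by
    have := sum_lattice_le hR (F.map (Function.Embedding.subtype _))
    rwa [Finset.sum_map] at this
  have e3 : ∑ k ∈ F, (|inner ℝ (eigenbasis k) u| * ((R ^ 2 + waveNorm k.1 ^ 2) / R ^ 2)) ^ 2
      ≤ (2 * ‖u‖) ^ 2 := by
    calc _ ≤ ∑ k ∈ F, (2 * inner ℝ (eigenbasis k) u ^ 2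
          + 2 / R ^ 4 * inner ℝ (eigenbasis k) a ^ 2) := by
          refine Finset.sum_le_sum fun k _ => ?_
          rw [ha, mul_pow, sq_abs]
          have e : (R ^ 2 + waveNorm k.1 ^ 2) / R ^ 2 = 1 + waveNorm k.1 ^ 2 / R ^ 2 := by
            field_simp
          have e' : 2 / R ^ 4 * (waveNorm k.1 ^ 2 * inner ℝ (eigenbasis k) u) ^ 2
              = 2 * (inner ℝ (eigenbasis k) u ^ 2 * (waveNorm k.1 ^ 2 / R ^ 2) ^ 2) := by
            field_simp
          rw [e, e']
          nlinarith [mul_nonneg (sq_nonneg (inner ℝ (eigenbasis k) u))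
            (sq_nonneg (1 - waveNorm k.1 ^ 2 / R ^ 2))]
      _ = 2 * ∑ k ∈ F, inner ℝ (eigenbasis k) u ^ 2
          + 2 / R ^ 4 * ∑ k ∈ F, inner ℝ (eigenbasis k) a ^ 2 := by
          rw [Finset.sum_add_distrib, Finset.mul_sum, Finset.mul_sum]
      _ ≤ 2 * ‖u‖ ^ 2 + 2 / R ^ 4 * ‖a‖ ^ 2 :=
          add_le_add (mul_le_mul_of_nonneg_left (HilbertBasis.sum_inner_sq_le eigenbasis u F)
            (by norm_num)) (mul_le_mul_of_nonneg_left
            (HilbertBasis.sum_inner_sq_le eigenbasis a F) (by positivity))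
      _ = (2 * ‖u‖) ^ 2 := by
          have h4 : R ^ 4 = (‖a‖ / ‖u‖) ^ 2 := by rw [← hR2]; ring
          have hapos : 0 < ‖a‖ := hpos.trans_le hle
          rw [h4]
          field_simp
          ring
  rw [e1] at hcs
  have hfin : (∑ k ∈ F, |inner ℝ (eigenbasis k) u|) ^ 2 ≤ (2 * ‖u‖ * (5 * R)) ^ 2 := by
    rw [mul_pow]
    exact hcs.trans (mul_le_mul e3 e2 (Finset.sum_nonneg fun _ _ => sq_nonneg _) (sq_nonneg _))
  have := (sq_le_sq₀ (Finset.sum_nonneg fun _ _ => abs_nonneg _) (by positivity)).1 hfin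
  refine this.trans_eq ?_
  rw [hRdef, Real.sqrt_div (norm_nonneg a)]
  have hs : √‖u‖ ≠ 0 := (Real.sqrt_pos.2 hpos).ne'
  field_simp
  linear_combination (-10) * √‖a‖ * Real.sq_sqrt (norm_nonneg u)

/-- Absolutely summable coordinates make the eigenfield series converge uniformly, and its sum
represents u by uniqueness of limits in `L²`. Each eigenfield is bounded by 2, whence 20 from 10. -/
theorem ae_norm_invRoot_invRoot_le (a : H) : ∀ᵐ x ∂torusMeasure,
    ‖((invRoot (invRoot a) : H) : L2Field) x‖ ≤ 20 * (√‖invRoot (invRoot a)‖ * √‖a‖) := by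
  set u := invRoot (invRoot a) with hu
  have hsum : Summable fun k : Wave => |inner ℝ (eigenbasis k) u| :=
    summable_of_sum_le (fun _ => abs_nonneg _) (sum_abs_inner_le a)
  have htsum : ∑' k : Wave, |inner ℝ (eigenbasis k) u| ≤ 10 * (√‖u‖ * √‖a‖) :=
    hsum.tsum_le_of_sum_le (sum_abs_inner_le a)
  have hnorm : ∀ k : Wave, ‖inner ℝ (eigenbasis k) u • casField k.1‖
      ≤ |inner ℝ (eigenbasis k) u| * 2 := by
    intro k
    rw [norm_smul, Real.norm_eq_abs]
    exact mul_le_mul_of_nonneg_left ((ContinuousMap.norm_le _ zero_le_two).2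
      (norm_casField_le k.2)) (abs_nonneg _)
  have hf : Summable fun k : Wave => inner ℝ (eigenbasis k) u • casField k.1 :=
    Summable.of_norm_bounded (hsum.mul_right 2) hnorm
  set f := ∑' k : Wave, inner ℝ (eigenbasis k) u • casField k.1 with hfdef
  have hfnorm : ‖f‖ ≤ 20 * (√‖u‖ * √‖a‖) := by
    refine (tsum_of_norm_bounded (hsum.mul_right 2).hasSum hnorm).trans ?_
    rw [tsum_mul_right]
    linarith
  have h1 : HasSum (fun k : Wave => inner ℝ (eigenbasis k) u • casFieldLp k.1)
      (ContinuousMap.toLp (E := Vec) 2 torusMeasure ℝ f) := by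
    have := hf.hasSum.mapL (ContinuousMap.toLp (E := Vec) 2 torusMeasure ℝ)
    simp only [map_smul] at this
    exact this
  have h2 : HasSum (fun k : Wave => inner ℝ (eigenbasis k) u • casFieldLp k.1) (u : L2Field) := by
    have := (eigenbasis.hasSum_repr u).mapL H.subtypeL
    simp only [HilbertBasis.repr_apply_apply, map_smul, eigenbasis_apply] at this ⊢
    exact this
  have h3 := h1.unique h2
  filter_upwards [ContinuousMap.coeFn_toLp (p := 2) (𝕜 := ℝ) torusMeasure f] with x hx
  rw [← h3, hx]
  exact (f.norm_coe_le_norm x).trans hfnorm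

end Agmon

end SyncNSE

/-! ### The convection as a bounded bilinear map. -/

namespace SyncNSE

open Set Filter Topology

section Bilinear

theorem abs_component_le (v : Vec) (j : Fin 2) : |v j| ≤ ‖v‖ := by
  simpa using PiLp.norm_apply_le v j

theorem memLp_transport (j : Fin 2) (a x : H) :
    MemLp (fun y => ((invRoot (invRoot a) : H) : L2Field) y j • ((riesz j x : H) : L2Field) y) 2
      torusMeasure := by
  refine MemLp.of_le_mul (c := 20 * (√‖invRoot (invRoot a)‖ * √‖a‖))
    (Lp.memLp ((riesz j x : H) : L2Field)) ?_ ?_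
  · exact (integrable_component _ j).aestronglyMeasurable.smul (Lp.aestronglyMeasurable _)
  · filter_upwards [ae_norm_invRoot_invRoot_le a] with y hy
    rw [norm_smul, Real.norm_eq_abs]
    exact mul_le_mul_of_nonneg_right ((abs_component_le _ _).trans hy) (norm_nonneg _)

/-- The term `u_j ∂_j w` of the convection of `w = A^{-1/2} x` by `u = A⁻¹ a`. -/
noncomputable def transport (j : Fin 2) (a x : H) : L2Field := (memLp_transport j a x).toLp

theorem coeFn_transport (j : Fin 2) (a x : H) : transport j a x =ᵐ[torusMeasure]
    fun y => ((invRoot (invRoot a) : H) : L2Field) y j • ((riesz j x : H) : L2Field) y :=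
  MemLp.coeFn_toLp _

theorem norm_transport_le (j : Fin 2) (a x : H) :
    ‖transport j a x‖ ≤ 20 * (√‖invRoot (invRoot a)‖ * √‖a‖) * ‖x‖ := by
  refine (Lp.norm_le_mul_norm_of_ae_le_mul (g := ((riesz j x : H) : L2Field))
    (c := 20 * (√‖invRoot (invRoot a)‖ * √‖a‖)) ?_).trans
    (mul_le_mul_of_nonneg_left (norm_riesz_le j x) (by positivity))
  filter_upwards [ae_norm_invRoot_invRoot_le a, coeFn_transport j a x] with y hy hy'
  rw [hy', norm_smul, Real.norm_eq_abs]
  exact mul_le_mul_of_nonneg_right ((abs_component_le _ _).trans hy) (norm_nonneg _)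

/-- Hölder with the roles exchanged: for the transported field A^{-3/2} z it is the gradient that is
bounded, and the transporting field is measured only in `L²`. -/
theorem norm_transport_le_of_smooth (j : Fin 2) (a z : H) :
    ‖transport j a (invRoot (invRoot z))‖ ≤ 20 * ‖z‖ * ‖invRoot (invRoot a)‖ := by
  refine Lp.norm_le_mul_norm_of_ae_le_mul (g := ((invRoot (invRoot a) : H) : L2Field)) ?_
  have hz : 20 * (√‖invRoot (invRoot (riesz j z))‖ * √‖riesz j z‖) ≤ 20 * ‖z‖ := by
    have h1 : ‖invRoot (invRoot (riesz j z))‖ ≤ ‖z‖ :=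
      ((stokesData.norm_root_le _).trans (stokesData.norm_root_le _)).trans (norm_riesz_le j z)
    calc _ ≤ 20 * (√‖z‖ * √‖z‖) := by
          gcongr
          exact norm_riesz_le j z
      _ = 20 * ‖z‖ := by rw [Real.mul_self_sqrt (norm_nonneg z)]
  filter_upwards [ae_norm_invRoot_invRoot_le (riesz j z),
    coeFn_transport j a (invRoot (invRoot z))] with y hy hy'
  rw [hy', riesz_invRoot, riesz_invRoot, norm_smul, Real.norm_eq_abs, mul_comm]
  exact mul_le_mul (hy.trans hz) (abs_component_le _ _) (abs_nonneg _) (by positivity)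

theorem transport_add_left (j : Fin 2) (a a' x : H) :
    transport j (a + a') x = transport j a x + transport j a' x := by
  refine Lp.ext ?_
  filter_upwards [coeFn_transport j (a + a') x, coeFn_transport j a x, coeFn_transport j a' x,
    Lp.coeFn_add (transport j a x) (transport j a' x),
    Lp.coeFn_add ((invRoot (invRoot a) : H) : L2Field) ((invRoot (invRoot a') : H) : L2Field)]
    with y h1 h2 h3 h4 h5
  rw [h1, h4, Pi.add_apply, h2, h3, ← add_smul]
  congr 1
  rw [map_add, map_add, Submodule.coe_add, h5]
  rfl

theorem transport_smul_left (j : Fin 2) (c : ℝ) (a x : H) :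
    transport j (c • a) x = c • transport j a x := by
  refine Lp.ext ?_
  filter_upwards [coeFn_transport j (c • a) x, coeFn_transport j a x,
    Lp.coeFn_smul c (transport j a x),
    Lp.coeFn_smul c ((invRoot (invRoot a) : H) : L2Field)] with y h1 h2 h3 h4
  rw [h1, h3, Pi.smul_apply, h2, smul_smul]
  congr 1
  rw [map_smul, map_smul, Submodule.coe_smul, h4]
  rfl

theorem transport_add_right (j : Fin 2) (a x x' : H) :
    transport j a (x + x') = transport j a x + transport j a x' := by
  refine Lp.ext ?_
  filter_upwards [coeFn_transport j a (x + x'), coeFn_transport j a x, coeFn_transport j a x',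
    Lp.coeFn_add (transport j a x) (transport j a x'),
    Lp.coeFn_add ((riesz j x : H) : L2Field) ((riesz j x' : H) : L2Field)]
    with y h1 h2 h3 h4 h5
  rw [h1, h4, Pi.add_apply, h2, h3, ← smul_add]
  congr 1
  rw [map_add, Submodule.coe_add, h5]
  rfl

theorem transport_smul_right (j : Fin 2) (c : ℝ) (a x : H) :
    transport j a (c • x) = c • transport j a x := by
  refine Lp.ext ?_
  filter_upwards [coeFn_transport j a (c • x), coeFn_transport j a x,
    Lp.coeFn_smul c (transport j a x),
    Lp.coeFn_smul c ((riesz j x : H) : L2Field)] with y h1 h2 h3 h4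
  rw [h1, h3, Pi.smul_apply, h2, smul_comm c]
  congr 1
  rw [map_smul, Submodule.coe_smul, h4]
  rfl

/-- The convection `(A⁻¹ a · ∇) A⁻¹ b`, projected onto divergence-free fields. -/
noncomputable def convect (a b : H) : H := leray (∑ j, transport j a (invRoot b))

theorem norm_leray_le (f : L2Field) : ‖leray f‖ ≤ ‖f‖ :=
  Submodule.norm_orthogonalProjectionOnto_apply_le _ _

theorem norm_convect_le (a b : H) :
    ‖convect a b‖ ≤ 40 * (√‖invRoot (invRoot a)‖ * √‖a‖ * ‖invRoot b‖) := by
  refine (norm_leray_le _).trans ((norm_sum_le _ _).trans ?_)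
  rw [Fin.sum_univ_two]
  have h0 := norm_transport_le 0 a (invRoot b)
  have h1 := norm_transport_le 1 a (invRoot b)
  linarith

/-- On D(A) the convection is square integrable, so the case distinction in `bilin` never falls to
its default value there. -/
theorem bilin_invRoot_invRoot (a b : H) :
    bilin (invRoot (invRoot a)) (invRoot (invRoot b)) = convect a b := by
  have hae : (∑ j, transport j a (invRoot b) : L2Field) =ᵐ[torusMeasure]
      convection (invRoot (invRoot a) : H) (invRoot (invRoot b) : H) := by
    rw [Fin.sum_univ_two]
    filter_upwards [coeFn_transport 0 a (invRoot b), coeFn_transport 1 a (invRoot b),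
      Lp.coeFn_add (transport 0 a (invRoot b)) (transport 1 a (invRoot b))] with y h0 h1 h2
    rw [h2, Pi.add_apply, h0, h1, convection, Fin.sum_univ_two, partialDeriv_invRoot,
      partialDeriv_invRoot]
  have hmem : MemLp (convection (invRoot (invRoot a) : H) (invRoot (invRoot b) : H)) 2
      torusMeasure := (memLp_congr_ae hae).1 (Lp.memLp _)
  rw [bilin, dif_pos hmem, convect]
  congr 1
  refine Lp.ext ((MemLp.coeFn_toLp hmem).trans hae.symm)

/-- The bounded bilinear map `(a, b) ↦ B(A⁻¹ a, A⁻¹ b)`. -/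
noncomputable def convectL : H →L[ℝ] H →L[ℝ] H :=
  LinearMap.mkContinuous₂
    (LinearMap.mk₂ ℝ convect
      (fun a a' b => by simp only [convect, transport_add_left, Finset.sum_add_distrib, map_add])
      (fun c a b => by simp only [convect, transport_smul_left, ← Finset.smul_sum, map_smul])
      (fun a b b' => by
        simp only [convect, map_add, transport_add_right, Finset.sum_add_distrib])
      (fun c a b => by
        simp only [convect, map_smul, transport_smul_right, ← Finset.smul_sum]))
    40 fun a b => by
      refine (norm_convect_le a b).trans ?_
      have h1 : ‖invRoot (invRoot a)‖ ≤ ‖a‖ :=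
        (stokesData.norm_root_le _).trans (stokesData.norm_root_le _)
      have h2 : ‖invRoot b‖ ≤ ‖b‖ := stokesData.norm_root_le _
      calc _ ≤ 40 * (√‖a‖ * √‖a‖ * ‖b‖) := by gcongr
        _ = 40 * ‖a‖ * ‖b‖ := by rw [Real.mul_self_sqrt (norm_nonneg a)]; ring

theorem convectL_apply (a b : H) : convectL a b = convect a b := rfl

theorem inner_leray (f : L2Field) (z : H) : inner ℝ (leray f) z = inner ℝ f (z : L2Field) :=
  Submodule.inner_orthogonalProjectionOnto_eq_of_mem_right z f

end Bilinear

/-! ### Antisymmetry of the trilinear form, mode by mode. -/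

section Antisymmetry

open UnitAddTorus

theorem invRoot_basis (k : Wave) : invRoot (eigenbasis k) = (waveNorm k.1)⁻¹ • eigenbasis k :=
  permDiag_basis (σ := Equiv.refl Wave) k

theorem coeFn_smul_eigenbasis (c : ℝ) (k : Wave) :
    ((c • eigenbasis k : H) : L2Field) =ᵐ[torusMeasure] fun y => c • casField k.1 y := by
  rw [eigenbasis_apply]
  filter_upwards [Lp.coeFn_smul c (casFieldLp k.1), coeFn_casFieldLp k.1] with y h1 h2
  rw [← h2]
  exact h1

/-- Each `A⁻¹` contributes |·|⁻², and ∂_j turns cas(l·x) into l_j cas(-l·x); what is left is a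
scalar triple integral. -/
theorem inner_transport_basis (j : Fin 2) (k l m : Wave) :
    inner ℝ (transport j (eigenbasis k) (invRoot (eigenbasis l)))
        ((invRoot (invRoot (eigenbasis m)) : H) : L2Field)
      = (waveNorm k.1 * waveNorm l.1 * waveNorm m.1)⁻¹ ^ 2 * (∑ i, perp l.1 i * perp m.1 i)
        * (perp k.1 j * (l.1 j : ℝ)) * ∫ y, cas k.1 y * (cas (-l.1) y * cas m.1 y) ∂torusMeasure := by
  rw [← integral_const_mul, L2.inner_def]
  refine integral_congr_ae ?_
  have hu : ∀ k : Wave, invRoot (invRoot (eigenbasis k))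
      = ((waveNorm k.1)⁻¹ * (waveNorm k.1)⁻¹) • eigenbasis k := fun k => by
    rw [invRoot_basis, map_smul, invRoot_basis, smul_smul]
  have hr : riesz j (invRoot (eigenbasis l))
      = ((waveNorm l.1)⁻¹ * -((l.1 j : ℝ) / waveNorm l.1)) • eigenbasis (-l) := by
    rw [invRoot_basis, map_smul, riesz_basis, smul_smul]
  have h1 := coeFn_transport j (eigenbasis k) (invRoot (eigenbasis l))
  rw [hu, hr] at h1
  rw [hu]
  filter_upwards [h1, coeFn_smul_eigenbasis ((waveNorm k.1)⁻¹ * (waveNorm k.1)⁻¹) k,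
    coeFn_smul_eigenbasis ((waveNorm l.1)⁻¹ * -((l.1 j : ℝ) / waveNorm l.1)) (-l),
    coeFn_smul_eigenbasis ((waveNorm m.1)⁻¹ * (waveNorm m.1)⁻¹) m] with y e1 e2 e3 e4
  rw [e1, e2, e3, e4]
  simp only [casField_apply, Wave.coe_neg, perp_neg, inner_smul_left, inner_smul_right,
    inner_neg_left, PiLp.smul_apply, smul_eq_mul, smul_neg, PiLp.inner_apply, map_mul, conj_trivial,
    Fin.sum_univ_two, RCLike.inner_apply, map_neg]
  ring

/-- Incompressibility of one mode: orthogonality leaves only n = k, where k^⊥·k = 0. -/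
theorem perp_dot_mul_integral (k n : Fin 2 → ℤ) :
    (∑ j, perp k j * (n j : ℝ)) * ∫ y, cas k y * cas n y ∂torusMeasure = 0 := by
  rw [integral_cas_mul_cas]
  split_ifs with h
  · subst h
    rw [mul_one, ← sum_mul_perp k]
    exact Finset.sum_congr rfl fun j _ => mul_comm _ _
  · rw [mul_zero]

/-- The mode form of ∫ u·∇(φψ) = 0 for divergence-free u. Products of `cas` expand in the
wavenumbers ±(l + m) and ±(m - l), the coefficients combine to k^⊥·(l + m) and k^⊥·(l - m), and each
resulting term vanishes by `perp_dot_mul_integral`. -/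
theorem perp_dot_mul_integral_add (k l m : Fin 2 → ℤ) :
    (∑ j, perp k j * (l j : ℝ)) * (∫ y, cas k y * (cas (-l) y * cas m y) ∂torusMeasure)
      + (∑ j, perp k j * (m j : ℝ)) * (∫ y, cas k y * (cas (-m) y * cas l y) ∂torusMeasure) = 0 := by
  have hi : ∀ n, Integrable (fun y => cas k y * cas n y) torusMeasure := fun n =>
    integrable_torus (cas k * cas n)
  have key : ∀ l m : Fin 2 → ℤ, ∫ y, cas k y * (cas (-l) y * cas m y) ∂torusMeasure
      = 1 / 2 * ((∫ y, cas k y * cas (l + m) y ∂torusMeasure)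
        + (∫ y, cas k y * cas (-(l + m)) y ∂torusMeasure)
        + (∫ y, cas k y * cas (m - l) y ∂torusMeasure)
        - ∫ y, cas k y * cas (-(m - l)) y ∂torusMeasure) := by
    intro l m
    have hi2 : Integrable (fun y => cas k y * cas (l + m) y + cas k y * cas (-(l + m)) y)
      torusMeasure := (hi _).add (hi _)
    have hi3 : Integrable (fun y => cas k y * cas (l + m) y + cas k y * cas (-(l + m)) y
      + cas k y * cas (m - l) y) torusMeasure := hi2.add (hi _)
    rw [← integral_add (hi _) (hi _), ← integral_add hi2 (hi _), ← integral_sub hi3 (hi _),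
      ← integral_const_mul]
    refine integral_congr_ae (Eventually.of_forall fun y => ?_)
    have e1 : -l - m = -(l + m) := by abel
    have e2 : -l + m = m - l := by abel
    simp only [cas_mul_cas (-l) m y, e1, e2]
    rw [cas_apply (m - l), cas_neg_apply (m - l), cas_apply (l + m), cas_neg_apply (l + m),
      mFourier_neg, Complex.conj_re]
    ring
  have h1 := perp_dot_mul_integral k (l + m)
  have h2 := perp_dot_mul_integral k (-(l + m))
  have h3 := perp_dot_mul_integral k (m - l)
  have h4 := perp_dot_mul_integral k (-(m - l))
  rw [key l m, key m l, add_comm m l, neg_sub, ← neg_sub m l, neg_neg]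
  simp only [Fin.sum_univ_two, Pi.add_apply, Pi.sub_apply, Pi.neg_apply, Int.cast_add, Int.cast_sub,
    Int.cast_neg] at h1 h2 h3 h4 ⊢
  linear_combination (1 / 2) * h1 - (1 / 2) * h2 - (1 / 2) * h3 - (1 / 2) * h4

theorem inner_convect_basis (k l m : Wave) :
    inner ℝ (convect (eigenbasis k) (eigenbasis l)) (invRoot (invRoot (eigenbasis m)))
      = (waveNorm k.1 * waveNorm l.1 * waveNorm m.1)⁻¹ ^ 2 * (∑ i, perp l.1 i * perp m.1 i)
        * ((∑ j, perp k.1 j * (l.1 j : ℝ))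
          * ∫ y, cas k.1 y * (cas (-l.1) y * cas m.1 y) ∂torusMeasure) := by
  rw [convect, inner_leray, sum_inner]
  simp only [inner_transport_basis, ← Finset.sum_mul, ← Finset.mul_sum]
  ring

theorem HilbertBasis.clm_eq_zero {ι E F : Type*} [NormedAddCommGroup E] [InnerProductSpace ℝ E]
    [NormedAddCommGroup F] [NormedSpace ℝ F] (b : HilbertBasis ι ℝ E) (f : E →L[ℝ] F)
    (h : ∀ i, f (b i) = 0) (x : E) : f x = 0 := by
  have := (b.hasSum_repr x).mapL f
  simp only [map_smul, h, smul_zero] at this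
  exact this.unique hasSum_zero

/-- The trilinear form of the convection is antisymmetric in its last two arguments. -/
theorem inner_convectL_antisymm (a b c : H) :
    inner ℝ (convectL a b) (invRoot (invRoot c))
      + inner ℝ (convectL a c) (invRoot (invRoot b)) = 0 := by
  have h1 : ∀ k l m : Wave,
      inner ℝ (convectL (eigenbasis k) (eigenbasis l)) (invRoot (invRoot (eigenbasis m)))
      + inner ℝ (convectL (eigenbasis k) (eigenbasis m)) (invRoot (invRoot (eigenbasis l))) = 0 := by
    intro k l m
    rw [convectL_apply, convectL_apply, inner_convect_basis, inner_convect_basis]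
    have h := perp_dot_mul_integral_add k.1 l.1 m.1
    have e : ∑ i, perp m.1 i * perp l.1 i = ∑ i, perp l.1 i * perp m.1 i :=
      Finset.sum_congr rfl fun i _ => mul_comm _ _
    rw [e, mul_right_comm (waveNorm k.1) (waveNorm m.1), ← mul_add, h, mul_zero]
  -- The identity extends from basis fields by linearity and continuity, one argument at a time.
  have h2 : ∀ (k l : Wave) (c : H),
      inner ℝ (convectL (eigenbasis k) (eigenbasis l)) (invRoot (invRoot c))
      + inner ℝ (convectL (eigenbasis k) c) (invRoot (invRoot (eigenbasis l))) = 0 := by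
    intro k l c
    rw [real_inner_comm (invRoot (invRoot (eigenbasis l)))]
    refine HilbertBasis.clm_eq_zero eigenbasis
      ((innerSL ℝ (convectL (eigenbasis k) (eigenbasis l))).comp (invRoot.comp invRoot)
        + (innerSL ℝ (invRoot (invRoot (eigenbasis l)))).comp (convectL (eigenbasis k)))
      (fun m => ?_) c
    have := h1 k l m
    rw [real_inner_comm (invRoot (invRoot (eigenbasis l)))] at this
    exact this
  have h3 : ∀ (k : Wave) (b c : H),
      inner ℝ (convectL (eigenbasis k) b) (invRoot (invRoot c))
      + inner ℝ (convectL (eigenbasis k) c) (invRoot (invRoot b)) = 0 := by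
    intro k b c
    rw [real_inner_comm (invRoot (invRoot c))]
    refine HilbertBasis.clm_eq_zero eigenbasis
      ((innerSL ℝ (invRoot (invRoot c))).comp (convectL (eigenbasis k))
        + (innerSL ℝ (convectL (eigenbasis k) c)).comp (invRoot.comp invRoot))
      (fun m => ?_) b
    have := h2 k m c
    rw [real_inner_comm (invRoot (invRoot c))] at this
    exact this
  rw [real_inner_comm (invRoot (invRoot c)), real_inner_comm (invRoot (invRoot b))]
  refine HilbertBasis.clm_eq_zero eigenbasis
    ((innerSL ℝ (invRoot (invRoot c))).comp (convectL.flip b)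
      + (innerSL ℝ (invRoot (invRoot b))).comp (convectL.flip c)) (fun k => ?_) a
  have := h3 k b c
  rw [real_inner_comm (invRoot (invRoot c)), real_inner_comm (invRoot (invRoot b))] at this
  exact this

/-- Antisymmetry moves the derivative from u_b to the band-limited field, whose gradient is bounded
at the cost |N|³; u_a and u_b then enter only through their `L²` norms. -/
theorem abs_inner_convectL_PN_le (N : ℝ) (a b z : H) : |inner ℝ (convectL a b) (PN N z)|
    ≤ 40 * |N| ^ 3 * (‖invRoot (invRoot a)‖ * ‖invRoot (invRoot b)‖ * ‖z‖) := by
  set y := lowStokes N z with hy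
  have hyz : ‖y‖ ≤ |N| ^ 3 * ‖z‖ := norm_lowStokes_le N z
  have hn : ‖convectL a (invRoot y)‖ ≤ 40 * ‖y‖ * ‖invRoot (invRoot a)‖ := by
    rw [convectL_apply]
    refine (norm_leray_le _).trans ((norm_sum_le _ _).trans ?_)
    rw [Fin.sum_univ_two]
    have h0 := norm_transport_le_of_smooth 0 a y
    have h1 := norm_transport_le_of_smooth 1 a y
    linarith
  have hanti := inner_convectL_antisymm a b (invRoot y)
  rw [← invRoot_lowStokes, ← hy, eq_neg_of_add_eq_zero_left hanti, abs_neg]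
  calc _ ≤ ‖convectL a (invRoot y)‖ * ‖invRoot (invRoot b)‖ := abs_real_inner_le_norm _ _
    _ ≤ 40 * (|N| ^ 3 * ‖z‖) * ‖invRoot (invRoot a)‖ * ‖invRoot (invRoot b)‖ := by
        gcongr
        exact hn.trans (by gcongr)
    _ = _ := by ring

/-- The nonlinearity of the intertwined Navier-Stokes system. -/
noncomputable def convectionData (N : ℝ) : NonlinearData stokesData where
  B := convectL
  P := PN N
  C := 40
  C_nonneg := by norm_num
  norm_B_le := norm_convect_le
  inner_B_self a b := by
    have := inner_convectL_antisymm a b b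
    change inner ℝ (convectL a b) (invRoot (invRoot b)) = 0
    linarith
  inner_P_comm := inner_PN_comm N
  P_P := PN_PN N
  P_root := PN_invRoot N
  D := 40 * |N| ^ 3
  D_nonneg := by positivity
  inner_B_P_le := abs_inner_convectL_PN_le N

end Antisymmetry

end SyncNSE

/-! ### Translation between the concrete and the abstract problem, and conclusion. -/

namespace SyncNSE

open Set Filter Topology

section WellPosed

variable {ν N T : ℝ} {M : Matrix (Fin 2) (Fin 2) ℝ} {g : Fin 2 → ℝ → H}

theorem SpectralData.Traj.congr_traj {ι E : Type*} [NormedAddCommGroup E] [InnerProductSpace ℝ E]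
    {S : SpectralData ι E} {s : ℝ} {x x' a d : ℝ → E} (h : S.Traj s T x a d) (hsT : s ≤ T)
    (hx : EqOn x' x (Icc s T)) : S.Traj s T x' a d where
  cont := h.cont.congr hx
  memLp_stokes := h.memLp_stokes
  memLp_deriv := h.memLp_deriv
  ae_eq := by
    filter_upwards [h.ae_eq, ae_restrict_mem measurableSet_Ioc] with t ht htm
    rw [hx (Ioc_subset_Icc_self htm), ht]
  eq_integral t ht := by rw [hx ht, hx (left_mem_Icc.2 hsT), h.eq_integral t ht]

/-- A solution of the intertwined system yields a solution of the abstract problem. -/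
theorem IsSolutionOn.isSol {v₀ : Fin 2 → H} {v : Fin 2 → ℝ → H} (hT : 0 < T)
    (h : IsSolutionOn ν g M (syncFunction N) v₀ T v) :
    (convectionData N).IsSol ν M g 0 T (fun i t => stokesPow 1 (v i t))
      fun i t => stokes (v i t) := by
  intro i
  obtain ⟨d, hd, heq⟩ := h.equation i
  have hV : ∀ t ∈ Icc 0 T, invRoot (stokesPow 1 (v i t)) = v i t := fun t ht =>
    invRoot_stokesPow_one ((h.continuous_V i).1 t ht)
  have htraj : stokesData.Traj 0 T (fun t => stokesPow 1 (v i t)) (fun t => stokes (v i t)) d :=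
    { cont := (h.continuous_V i).2
      memLp_stokes := (h.sq_int_DA i).2
      memLp_deriv := hd.1
      ae_eq := by
        filter_upwards [(h.sq_int_DA i).1] with t ht
        have := stokesPow_one_invRoot (invRoot (stokes (v i t)))
        rwa [invRoot_invRoot_stokes ht] at this
      eq_integral := by
        intro t ht
        change invRoot _ = invRoot _ + _
        rw [hV t ht, hV 0 (left_mem_Icc.2 hT.le), hd.2 t ht] }
  refine htraj.congr_deriv ?_
  filter_upwards [heq, ae_all_iff.2 fun j => (h.sq_int_DA j).1] with t ht htD
  have hB : ∀ j, bilin (v j t) (v j t) = convectL (stokes (v j t)) (stokes (v j t)) := by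
    intro j
    rw [convectL_apply, ← bilin_invRoot_invRoot, invRoot_invRoot_stokes (htD j)]
  simp only [syncFunction, hB] at ht
  change d t = g i t - convectL _ _ + ∑ j, M i j • PN N (convectL _ _) - ν • stokes (v i t)
  have e := eq_sub_of_add_eq (eq_sub_of_add_eq ht)
  rw [e]
  abel

/-- A solution of the abstract problem yields a solution of the intertwined system. -/
theorem isSolutionOn_of_isSol {x a : Fin 2 → ℝ → H} (h : (convectionData N).IsSol ν M g 0 T x a) :
    IsSolutionOn ν g M (syncFunction N) (fun i => invRoot (x i 0)) T
      fun i t => invRoot (x i t) := by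
  have hae : ∀ j, ∀ᵐ t ∂volume.restrict (Ioc 0 T), invRoot (x j t) = invRoot (invRoot (a j t)) := by
    intro j
    filter_upwards [(h j).ae_eq] with t ht
    exact congrArg invRoot ht
  refine ⟨fun i => ⟨fun t _ => ⟨_, isStokesPow_invRoot _⟩, ?_⟩, fun i => ⟨?_, ?_⟩, fun i => rfl,
    fun i => ⟨_, ⟨(h i).memLp_deriv, (h i).eq_integral⟩, ?_⟩⟩
  · simp only [stokesPow_one_invRoot]
    exact (h i).cont
  · filter_upwards [hae i] with t ht
    rw [ht]
    exact ⟨_, isStokesPow_invRoot_invRoot _⟩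
  · refine (h i).memLp_stokes.ae_eq ?_
    filter_upwards [hae i] with t ht
    rw [ht, stokes_invRoot_invRoot]
  · filter_upwards [ae_all_iff.2 hae] with t ht
    simp only [syncFunction, ht, bilin_invRoot_invRoot, stokes_invRoot_invRoot]
    change g i t - convect _ _ + ∑ j, M i j • PN N (convect _ _) - ν • a i t + _ + _ = _
    abel

end WellPosed

end SyncNSE
theorem mainTheorem12 (ν : ℝ) (hν : 0 < ν) (N : ℝ) (hN : 0 < N)
    (θ₁ θ₂ : ℝ) (hθ₁ : 0 ≤ θ₁) (hθ₂ : 0 ≤ θ₂) (hθ : θ₁ + θ₂ = 1)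
    (g : Fin 2 → ℝ → SyncNSE.H)
    (hg : ∀ i, MeasureTheory.MemLp (g i) ⊤ (MeasureTheory.volume.restrict (Set.Ioi 0))) :
    SyncNSE.GloballyWellPosed ν g (SyncNSE.mutualMatrix θ₁ θ₂) (SyncNSE.syncFunction N) := by
  intro v₀ hv₀
  -- On an interval of finite measure, bounded implies square integrable.
  have hg2 : ∀ T : ℝ, ∀ i, MemLp (g i) 2 (volume.restrict (Set.Ioc 0 T)) := fun T i =>
    ((hg i).mono_measure (Measure.restrict_mono Set.Ioc_subset_Ioi_self le_rfl)).mono_exponent le_top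
  have hex : ∀ T : ℝ, ∃ x a : Fin 2 → ℝ → SyncNSE.H, 0 < T →
      (∀ i, x i 0 = SyncNSE.stokesPow 1 (v₀ i)) ∧
        (SyncNSE.convectionData N).IsSol ν (SyncNSE.mutualMatrix θ₁ θ₂) g 0 T x a := by
    intro T
    by_cases hT : 0 < T
    · obtain ⟨x, a, h⟩ := (SyncNSE.convectionData N).exists_isSol hν hθ₁ hθ₂ hθ hT (hg2 T)
        fun i => SyncNSE.stokesPow 1 (v₀ i)
      exact ⟨x, a, fun _ => h⟩
    · exact ⟨0, 0, fun h => absurd h hT⟩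
  choose X A hXA using hex
  -- The global solution takes its value at t from the solution on [0, |t| + 1]; the shift keeps
  -- this horizon positive at t = 0. By uniqueness the choices agree on their common intervals.
  set x : Fin 2 → ℝ → SyncNSE.H := fun i t => X (|t| + 1) i t with hx
  have hpos : ∀ t : ℝ, 0 < |t| + 1 := fun t => by positivity
  have hx0 : ∀ i, x i 0 = SyncNSE.stokesPow 1 (v₀ i) := fun i => (hXA _ (hpos 0)).1 i
  have hsol : ∀ T > 0,
      (SyncNSE.convectionData N).IsSol ν (SyncNSE.mutualMatrix θ₁ θ₂) g 0 T x (A T) := by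
    intro T hT i
    refine ((hXA T hT).2 i).congr_traj hT.le fun t ht => ?_
    have hle : t ≤ |t| + 1 := (le_abs_self t).trans (by linarith)
    exact SyncNSE.NonlinearData.IsSol.unique (T := t) hν
      (fun j => ((hXA _ (hpos t)).2 j).mono hle) (fun j => ((hXA T hT).2 j).mono ht.2)
      (fun j => ((hXA _ (hpos t)).1 j).trans ((hXA T hT).1 j).symm) i (Set.right_mem_Icc.2 ht.1)
  refine ⟨fun i t => SyncNSE.invRoot (x i t), fun T hT => ?_, fun T hT w hw i t ht => ?_⟩
  · have h := SyncNSE.isSolutionOn_of_isSol (hsol T hT)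
    have e : (fun i => SyncNSE.invRoot (x i 0)) = v₀ := by
      funext i
      rw [hx0, SyncNSE.invRoot_stokesPow_one (hv₀ i)]
    rwa [e] at h
  · have h := SyncNSE.NonlinearData.IsSol.unique hν (hw.isSol hT) (hsol T hT)
      (fun j => by rw [hx0, hw.initial]) i ht
    rw [← SyncNSE.invRoot_stokesPow_one ((hw.continuous_V i).1 t ht), h]
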